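/- Model. There are $N\ge 2$ players; each has a safe arm paying the flow $s>0$ and a risky arm whose cumulative payoff in state $\theta\in\{0,1\}$ is $X^n_t=\alpha_\theta t+\sigma Z^n_t+hN^n_t$, with $\sigma,h>0$, $Z^n$ a standard Wiener process and $N^n$ a Poisson process of intensity $\lambda_\theta$, $\lambda_1\ge\lambda_0\ge 0$, all independent across players given $\theta$. Put $m_\theta=\alpha_\theta+\lambda_\theta h$ and assume $m_0<s<m_1$. The discount rate is $r>0$. The state is unknown and has common prior probability $p=\mathbb P[\theta=1]$. In the discrete game with period length $\Delta>0$, players choose between the arms only at times $0,\Delta,2\Delta,\dots$; at each such time there is first a public draw, uniform on $[0,1]$ and independent of everything else. All actions, and the payoff paths on $[\ell\Delta,(\ell+1)\Delta)$ of the risky arms in use, are publicly observed. A behavioral strategy is a measurable map from histories (with public draws) to probabilities of using the risky arm. With $\delta=e^{-r\Delta}$, player $n$'s payoff is $(1-\delta)\,\mathbb E\big[\sum_{\ell\ge0}\delta^\ell\{(1-\sigma_{n,\ell\Delta})s+\sigma_{n,\ell\Delta}m_\theta\}\big]$, where $\sigma_{n,\ell\Delta}$ is the probability with which $n$ uses the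 risky arm in period $\ell$. The belief after a history is the posterior probability of $\theta=1$ obtained from the prior and all past observations by Bayes' rule, on and off the path of play. A PBE is a strategy profile in which, after every history, each player's continuation strategy is optimal given this belief and the other players' strategies. An SSE is a PBE in which all players use the same strategy. Let $\rho=(\alpha_1-\alpha_0)^2/\sigma^2$, let $p^m=(s-m_0)/(m_1-m_0)$ be the myopic cutoff, and let $$p_1^*=\frac{\mu_1(s-m_0)}{(\mu_1+1)(m_1-s)+\mu_1(s-m_0)}$$ be the single-agent continuous-time cutoff, where $\mu_1$ is the positive solution of $\frac{\rho}{2}\mu(\mu+1)+(\lambda_1-\lambda_0)\mu+\lambda_0(\lambda_0/\lambda_1)^\mu-\lambda_0-r=0$. Proposition 8. Let $\rho=0$ and $\lambda_0=0$. For any beliefs $\underline p,\bar p$ with $p_1^*<\underline p<p^m<\bar p<1$ there exists $\bar\Delta>0$ such that for all $\Delta\in(0,\bar\Delta)$ the following hold. (1) For every prior $p\in(\underline p,1]$ there is an SSE in which, almost surely on the path of play, all players use the risky arm whenever the belief exceeds $\underline p$, and in which all players use the safe arm after every history with belief below $p_1^*$. (2) For every prior $p\in[\underline p,\bar p]$ there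 is an SSE in which each player's payoff is no larger than this player's best-reply payoff, in the same game with prior $p$, against opponents who use the risky arm if the belief lies in $[p_1^*,\underline p]\cup[\bar p,1]$ and the safe arm otherwise. -/

import Mathlib

open MeasureTheory ProbabilityTheory Filter Topology
open scoped NNReal ENNReal

/-- Primitives of the two-armed bandit problem faced by every player: discount rate `r`, flow payoff
`s` of the safe arm, volatility `σ` and lump-sum size `h` of the risky arm, and, for each state
`θ ∈ {0, 1}`, the drift `α θ` and the intensity `lam θ` of the lump-sums of the risky arm. -/
structure Bandit where
  r : ℝ
  s : ℝ
  σ : ℝ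
  h : ℝ
  α : Fin 2 → ℝ
  lam : Fin 2 → ℝ
  r_pos : 0 < r
  s_pos : 0 < s
  σ_pos : 0 < σ
  h_pos : 0 < h
  lam_zero_nonneg : 0 ≤ lam 0
  lam_le : lam 0 ≤ lam 1
  low_lt_safe : α 0 + lam 0 * h < s
  safe_lt_high : s < α 1 + lam 1 * h

/-- `N` is a Poisson process with intensity `l` under `P`. -/
structure IsPoissonProcess {Ω : Type} [MeasurableSpace Ω] (l : ℝ≥0) (N : ℝ≥0 → Ω → ℕ)
    (P : Measure Ω) : Prop where
  zero : ∀ᵐ ω ∂P, N 0 ω = 0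
  paths : ∀ᵐ ω ∂P, Monotone (fun t => N t ω) ∧
    ∀ t, ContinuousWithinAt (fun u => N u ω) (Set.Ici t) t
  incr : HasIndepIncrements N P
  law : ∀ t u, t ≤ u → HasLaw (fun ω => N u ω - N t ω) (poissonMeasure (l * (u - t))) P

namespace Bandit

variable (G : Bandit)

/-- Expected flow payoff of the risky arm in state `θ`. -/
def m (θ : Fin 2) : ℝ := G.α θ + G.lam θ * G.h

/-- Signal-to-noise ratio of the continuous payoff component. -/
noncomputable def rho : ℝ := (G.α 1 - G.α 0) ^ 2 / G.σ ^ 2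

/-- `μ` is the positive solution of the equation that determines the cutoff of the planner's
problem with `K` players. -/
def IsExponent (K : ℕ) (μ : ℝ) : Prop :=
  0 < μ ∧ G.rho / 2 * μ * (μ + 1) + (G.lam 1 - G.lam 0) * μ
    + G.lam 0 * (G.lam 0 / G.lam 1) ^ μ - G.lam 0 - G.r / K = 0

/-- The cutoff belief associated with the exponent `μ`. -/
noncomputable def cutoff (μ : ℝ) : ℝ :=
  μ * (G.s - G.m 0) / ((μ + 1) * (G.m 1 - G.s) + μ * (G.s - G.m 0))

/-- The belief at which a myopic player is indifferent between the two arms. -/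
noncomputable def myopicCutoff : ℝ := (G.s - G.m 0) / (G.m 1 - G.m 0)

/-! ### The payoff process of a risky arm over one period of length `Δ` -/

/-- Sample paths on `[0, Δ)` of the (cumulative) payoff process of a risky arm: a continuous
path plus `h` times a right-continuous counting path, both starting at `0`. The `σ`-algebra is the
one generated by the evaluations. -/
abbrev ArmPath (Δ : ℝ≥0) : Type :=
  {x : Set.Iio Δ → ℝ // ∃ (w : ℝ≥0 → ℝ) (n : ℝ≥0 → ℕ), Continuous w ∧ w 0 = 0 ∧
    Monotone n ∧ (∀ t, ContinuousWithinAt n (Set.Ici t) t) ∧ n 0 = 0 ∧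
    ∀ t : Set.Iio Δ, x t = w t + G.h * n t}

/-- `Q` is the law on path space, in state `θ`, of the payoff process
`X_t = α_θ t + σ Z_t + h N_t`, `0 ≤ t < Δ`, with `Z` a standard Wiener process and `N` an independent
Poisson process of intensity `λ_θ`. -/
def IsArmLaw (Δ : ℝ≥0) (θ : Fin 2) (Q : Measure (G.ArmPath Δ)) : Prop :=
  ∃ (Ω : Type) (_ : MeasurableSpace Ω) (P : Measure Ω) (Z : ℝ≥0 → Ω → ℝ) (N : ℝ≥0 → Ω → ℕ)
    (X : Ω → G.ArmPath Δ),
    IsProbabilityMeasure P ∧ IsBrownianReal Z P ∧ IsPoissonProcess (G.lam θ).toNNReal N P ∧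
    IndepFun (fun ω t => Z t ω) (fun ω t => N t ω) P ∧
    (∀ᵐ ω ∂P, ∀ t : Set.Iio Δ, (X ω).1 t = G.α θ * (t : ℝ≥0) + G.σ * Z t ω + G.h * N t ω) ∧
    HasLaw X Q P

/-- What is observed of one player in one period: `inl ()` if the player used the safe arm,
`inr y` if the player used the risky arm and its payoff path was `y`. -/
abbrev Obs (Δ : ℝ≥0) : Type := Unit ⊕ G.ArmPath Δ

/-! ### Histories and strategies in the game with `N` players and period length `Δ` -/

/-- Public record of one period: the public randomization draw made at the start of the period,
and the observations about all players. -/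
abbrev Period (N : ℕ) (Δ : ℝ≥0) : Type := unitInterval × (Fin N → G.Obs Δ)

/-- Information on which actions in period `ℓ` can be based: the history of the `ℓ` preceding
periods and the current public randomization draw. -/
abbrev Info (N : ℕ) (Δ : ℝ≥0) : Type := Σ ℓ : ℕ, (Fin ℓ → G.Period N Δ) × unitInterval

/-- The information at the start of the game, given the first public randomization draw. -/
def start (N : ℕ) (Δ : ℝ≥0) (u : unitInterval) : G.Info N Δ := ⟨0, (Fin.elim0, u)⟩

/-- The information in the next period, given the observations made in the current period and the
next public randomization draw. -/
def next {N : ℕ} {Δ : ℝ≥0} (x : G.Info N Δ) (y : (Fin N → G.Obs Δ) × unitInterval) : G.Info N Δ :=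
  ⟨x.1 + 1, (Fin.snoc x.2.1 (x.2.2, y.1), y.2)⟩

/-- A behavioral strategy: the probability of using the risky arm as a measurable function of the
available information. -/
structure Strategy (N : ℕ) (Δ : ℝ≥0) where
  act : G.Info N Δ → unitInterval
  measurable_act : Measurable act

/-! ### Beliefs -/

/-- Number of lump-sums along a path. -/
noncomputable def lumps {Δ : ℝ≥0} (y : G.ArmPath Δ) : ℕ := {t | ¬ ContinuousAt y.1 t}.ncard

/-- Total increment of the continuous component of a path over `[0, Δ)`. -/
noncomputable def contIncr {Δ : ℝ≥0} (y : G.ArmPath Δ) : ℝ :=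
  limUnder atTop y.1 - G.h * G.lumps y

/-- Likelihood in state `θ` of the observation of one player in one period (up to a factor that
does not depend on `θ`). -/
noncomputable def obsLikelihood {Δ : ℝ≥0} (θ : Fin 2) : G.Obs Δ → ℝ
  | Sum.inl _ => 1
  | Sum.inr y =>
      Real.exp (G.α θ * G.contIncr y / G.σ ^ 2 - G.α θ ^ 2 * Δ / (2 * G.σ ^ 2)) *
        (G.lam θ ^ G.lumps y * Real.exp (-G.lam θ * Δ))

/-- Likelihood in state `θ` of all past observations. -/
noncomputable def likelihood {N : ℕ} {Δ : ℝ≥0} (θ : Fin 2) (x : G.Info N Δ) : ℝ :=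
  ∏ i : Fin x.1, ∏ n : Fin N, G.obsLikelihood θ ((x.2.1 i).2 n)

/-- The common posterior probability of state `1`, by Bayes' rule from the prior `p`. -/
noncomputable def belief {N : ℕ} {Δ : ℝ≥0} (p : ℝ) (x : G.Info N Δ) : ℝ :=
  p * G.likelihood 1 x / (p * G.likelihood 1 x + (1 - p) * G.likelihood 0 x)

/-! ### Outcome distributions and payoffs

Below, `Q θ` is the law in state `θ` of the payoff path of a risky arm over one period. -/

section Play

variable {N : ℕ} {Δ : ℝ≥0}

lemma measurable_sigma_mk (ℓ : ℕ) :
    Measurable (fun z => (⟨ℓ, z⟩ : G.Info N Δ)) :=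
  measurable_iff_comap_le.2 (MeasurableSpace.comap_le_iff_le_map.2 (iInf_le _ ℓ))

lemma measurable_of_fibers {β : Type*} [MeasurableSpace β] {f : G.Info N Δ → β}
    (hf : ∀ ℓ, Measurable (fun z => f ⟨ℓ, z⟩)) : Measurable f := by
  intro t ht
  refine MeasurableSpace.measurableSet_iInf.2 fun ℓ => ?_
  exact hf ℓ ht

lemma measurable_next_fiber (ℓ : ℕ) :
    Measurable (fun z : ((Fin ℓ → G.Period N Δ) × unitInterval) ×
      ((Fin N → G.Obs Δ) × unitInterval) => G.next (⟨ℓ, z.1⟩ : G.Info N Δ) z.2) := by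
  unfold next
  refine (G.measurable_sigma_mk (ℓ + 1)).comp (Measurable.prodMk (measurable_pi_iff.2 fun i => ?_)
    (by fun_prop))
  refine Fin.lastCases ?_ (fun j => ?_) i
  · simp only [Fin.snoc_last]; fun_prop
  · simp only [Fin.snoc_castSucc]; fun_prop

/-- Law of the observation of one player who uses the risky arm (`a = true`) or the safe arm
(`a = false`). -/
noncomputable def obsLaw (Q : ProbabilityMeasure (G.ArmPath Δ)) (a : Bool) : Measure (G.Obs Δ) :=
  if a then (Q : Measure (G.ArmPath Δ)).map Sum.inr else Measure.dirac (Sum.inl ())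

instance (Q : ProbabilityMeasure (G.ArmPath Δ)) (a : Bool) :
    IsProbabilityMeasure (G.obsLaw Q a) := by
  unfold obsLaw
  split_ifs
  · exact Measure.isProbabilityMeasure_map measurable_inr.aemeasurable
  · infer_instance

/-- Probability of the action profile `a` if every player `n` independently uses the risky arm
with the probability given by the strategy `S n`. -/
noncomputable def profileProb (S : Fin N → G.Strategy N Δ) (x : G.Info N Δ) (a : Fin N → Bool) :
    ℝ≥0∞ :=
  ∏ n, ENNReal.ofReal (if a n then ((S n).act x : ℝ) else 1 - ((S n).act x : ℝ))

lemma measurable_profileProb (S : Fin N → G.Strategy N Δ) (a : Fin N → Bool) :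
    Measurable (fun x => G.profileProb S x a) := by
  unfold profileProb
  refine Finset.measurable_prod _ fun n _ => ENNReal.measurable_ofReal.comp ?_
  have h := measurable_subtype_coe.comp (S n).measurable_act
  split_ifs
  · exact h
  · exact measurable_const.sub h

/-- One-period transition kernel under the strategy profile `S`: independent action choices, then
independent payoff paths of the risky arms in use, then a new uniform public draw. -/
noncomputable def step (Q : ProbabilityMeasure (G.ArmPath Δ)) (S : Fin N → G.Strategy N Δ) :
    Kernel (G.Info N Δ) (G.Info N Δ) where
  toFun x := ∑ a : Fin N → Bool, G.profileProb S x a •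
    ((Measure.pi fun n => G.obsLaw Q (a n)).prod (volume : Measure unitInterval)).map (G.next x)
  measurable' := by
    refine Measure.measurable_of_measurable_coe _ fun s hs => ?_
    simp only [Measure.coe_finsetSum, Finset.sum_apply, Measure.smul_apply, smul_eq_mul]
    refine Finset.measurable_sum _ fun a _ => (G.measurable_profileProb S a).mul
      (G.measurable_of_fibers fun ℓ => ?_)
    have hm := G.measurable_next_fiber (N := N) (Δ := Δ) ℓ
    have heq : ∀ z, (((Measure.pi fun n => G.obsLaw Q (a n)).prod
        (volume : Measure unitInterval)).map (G.next ⟨ℓ, z⟩)) s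
        = ((Measure.pi fun n => G.obsLaw Q (a n)).prod (volume : Measure unitInterval))
          (Prod.mk z ⁻¹' ((fun z : ((Fin ℓ → G.Period N Δ) × unitInterval) ×
            ((Fin N → G.Obs Δ) × unitInterval) => G.next (⟨ℓ, z.1⟩ : G.Info N Δ) z.2) ⁻¹' s)) := by
      intro z
      exact Measure.map_apply (hm.comp measurable_prodMk_left) hs
    simp only [heq]
    exact measurable_measure_prodMk_left (hm hs)

/-- Distribution of the information available `j` periods later. -/
noncomputable def ahead (Q : ProbabilityMeasure (G.ArmPath Δ)) (S : Fin N → G.Strategy N Δ) :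
    ℕ → Kernel (G.Info N Δ) (G.Info N Δ)
  | 0 => Kernel.id
  | j + 1 => ahead Q S j ∘ₖ G.step Q S

/-- Distribution of the information available in period `ℓ`, from the perspective of the start of
the game with prior `p`. -/
noncomputable def pathLaw (Q : Fin 2 → ProbabilityMeasure (G.ArmPath Δ))
    (S : Fin N → G.Strategy N Δ) (p : ℝ) (ℓ : ℕ) : Measure (G.Info N Δ) :=
  ENNReal.ofReal p • ((volume : Measure unitInterval).map (G.start N Δ)).bind (G.ahead (Q 1) S ℓ) +
  ENNReal.ofReal (1 - p) •
    ((volume : Measure unitInterval).map (G.start N Δ)).bind (G.ahead (Q 0) S ℓ)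

/-- Discount factor per period. -/
noncomputable def discount (Δ : ℝ≥0) : ℝ := Real.exp (-G.r * Δ)

/-- Player `n`'s expected discounted payoff (in per-period units) conditional on state `θ`, in the
continuation of the game from the information `x` on. -/
noncomputable def statePayoff (Q : Fin 2 → ProbabilityMeasure (G.ArmPath Δ))
    (S : Fin N → G.Strategy N Δ) (n : Fin N) (θ : Fin 2) (x : G.Info N Δ) : ℝ :=
  (1 - G.discount Δ) * ∑' j : ℕ, G.discount Δ ^ j *
    ∫ y, ((1 - ((S n).act y : ℝ)) * G.s + ((S n).act y : ℝ) * G.m θ) ∂(G.ahead (Q θ) S j x)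

/-- Player `n`'s expected continuation payoff from the information `x` on, if state `1` has
probability `q`. -/
noncomputable def contPayoff (Q : Fin 2 → ProbabilityMeasure (G.ArmPath Δ))
    (S : Fin N → G.Strategy N Δ) (n : Fin N) (q : ℝ) (x : G.Info N Δ) : ℝ :=
  q * G.statePayoff Q S n 1 x + (1 - q) * G.statePayoff Q S n 0 x

/-- Player `n`'s expected payoff in the game with prior `p`. -/
noncomputable def payoff (Q : Fin 2 → ProbabilityMeasure (G.ArmPath Δ))
    (S : Fin N → G.Strategy N Δ) (n : Fin N) (p : ℝ) : ℝ :=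
  ∫ u : unitInterval, G.contPayoff Q S n p (G.start N Δ u)

/-- Player `n`'s best-reply payoff against the opponents' strategies in `S`, with prior `p`. -/
noncomputable def bestReplyPayoff (Q : Fin 2 → ProbabilityMeasure (G.ArmPath Δ))
    (S : Fin N → G.Strategy N Δ) (n : Fin N) (p : ℝ) : ℝ :=
  ⨆ T : G.Strategy N Δ, G.payoff Q (Function.update S n T) n p

/-- Perfect Bayesian equilibrium of the game with prior `p`: after every history, on and off the
path, every player's continuation strategy is optimal given the posterior belief. -/
def IsPBE (Q : Fin 2 → ProbabilityMeasure (G.ArmPath Δ)) (p : ℝ) (S : Fin N → G.Strategy N Δ) :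
    Prop :=
  ∀ (x : G.Info N Δ) (n : Fin N) (T : G.Strategy N Δ),
    G.contPayoff Q (Function.update S n T) n (G.belief p x) x ≤
      G.contPayoff Q S n (G.belief p x) x

/-- Strongly symmetric equilibrium: a perfect Bayesian equilibrium in which all players use the
same strategy. -/
def IsSSE (Q : Fin 2 → ProbabilityMeasure (G.ArmPath Δ)) (p : ℝ) (S : Fin N → G.Strategy N Δ) :
    Prop :=
  G.IsPBE Q p S ∧ ∀ (n n' : Fin N) (x : G.Info N Δ), (S n).act x = (S n').act x

end Play
end Bandit

/-! With equal drifts and no lump-sums in the bad state, a lump-sum proves that the state is good.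
Until then the belief depends only on the number `j` of failed arm-periods: its odds, normalized to
`1` at the myopic cutoff, are `X * q ^ j`, where `q` is the probability that an arm in the good
state yields no lump-sum in a period. Measure payoffs by their shortfall from full information (`m
1` in the good state, `s` in the bad one), per unit of likelihood of the bad state. In units of `(1
- p) * (s - m 0)`, a period with the safe arm costs `(1 - δ) * (X * q ^ j)`, a period with the risky
arm costs `1 - δ`, and all costs end with the first lump-sum if the risky arm is used from then on.
What remains is a cost game on the grid of the `j`, solved backwards from low odds.

Two cutoffs organize the grid: `lowCut`, where a lone player stops, and `highCut`, above which a
last joint round of experiments is worthwhile. Both tend to `r / (r + l)` with `l = lam 1`, which is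
the odds ratio of the single-agent cutoff. Below `lowCut` everybody plays safe. Between the cutoffs
everybody mixes with a small probability, found by the intermediate value theorem
(`FinePeriod.exists_mixing`). From `highCut` on there are two modes. In the normal mode all use the
risky arm, and any deviation leads to the punishment mode. In the punishment mode all play safe, up
to odds `top`; its cost `VP` is that of one lone experiment followed by more punishment, and after
unanimous safe play a public randomization returns to the normal mode with just the probability that
makes the safe arm equally costly. Above `top` the risky arm is myopically so good that no
punishment is needed.

The main difficulty is that the return probability be at most one. Below odds `1` the safe arm is
myopically cheaper, and the recursions suffice (`punish_feasible_of_le_one`). Above odds `1` the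
normal mode runs for a fixed amount of real time before reaching `highCut`, which creates a gap
between the modes that is bounded away from zero, whereas a period of safe play costs only order `Δ`
(`normal_gap`, `one_sub_VP_ge`, `punish_feasible_of_one_le`).

Normal mode gives the first claim. For the second, start in punishment mode: `VP` is a supersolution
for a player who uses the risky arm exactly at odds above `xlow`, against opponents who experiment
only at low and high beliefs (`free_riding_le`), so the best reply is at least as good as the
punishment. The passage to the actual game rests on the change of measure
`IsArmLaw.restrict_lumpFree` and on the comparison lemmas `le_cost` and `cost_le`. -/

/-! ### Binomial expectations and backward recursion. -/

/-- Expectation of `g K` for a binomial random variable `K` with parameters `M` and `π`. -/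
noncomputable def bexp : ℕ → ℝ → (ℕ → ℝ) → ℝ
  | 0, _, g => g 0
  | M + 1, π, g => (1 - π) * bexp M π g + π * bexp M π (fun k => g (k + 1))

lemma bexp_add (M : ℕ) (π : ℝ) (g f : ℕ → ℝ) :
    bexp M π (fun k => g k + f k) = bexp M π g + bexp M π f := by
  induction M generalizing g f with
  | zero => rfl
  | succ M ih =>
    simp only [bexp, ih g f, ih (fun k => g (k + 1)) (fun k => f (k + 1))]
    ring

lemma bexp_const_mul (M : ℕ) (π a : ℝ) (g : ℕ → ℝ) :
    bexp M π (fun k => a * g k) = a * bexp M π g := by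
  induction M generalizing g with
  | zero => rfl
  | succ M ih =>
    simp only [bexp, ih g, ih (fun k => g (k + 1))]
    ring

lemma bexp_sub (M : ℕ) (π : ℝ) (g f : ℕ → ℝ) :
    bexp M π (fun k => g k - f k) = bexp M π g - bexp M π f := by
  have h := bexp_add M π g (fun k => (-1) * f k)
  rw [bexp_const_mul] at h
  rw [show (fun k => g k - f k) = fun k => g k + (-1) * f k by ext; ring, h]
  ring

lemma bexp_const (M : ℕ) (π a : ℝ) : bexp M π (fun _ => a) = a := by
  induction M with
  | zero => rfl
  | succ M ih => simp only [bexp, ih]; ring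

lemma bexp_mono {M : ℕ} {π : ℝ} (h0 : 0 ≤ π) (h1 : π ≤ 1) {g f : ℕ → ℝ}
    (h : ∀ k ≤ M, g k ≤ f k) : bexp M π g ≤ bexp M π f := by
  induction M generalizing g f with
  | zero => exact h 0 le_rfl
  | succ M ih =>
    simp only [bexp]
    have := ih (g := g) (f := f) fun k hk => h k (by omega)
    have := ih (g := fun k => g (k + 1)) (f := fun k => f (k + 1)) fun k hk => h (k + 1) (by omega)
    have : 0 ≤ 1 - π := by linarith
    gcongr

@[simp] lemma bexp_zero (M : ℕ) (g : ℕ → ℝ) : bexp M 0 g = g 0 := by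
  induction M generalizing g with
  | zero => rfl
  | succ M ih => simp [bexp, ih]

@[simp] lemma bexp_one (M : ℕ) (g : ℕ → ℝ) : bexp M 1 g = g M := by
  induction M generalizing g with
  | zero => rfl
  | succ M ih => simp [bexp, ih]

lemma continuous_bexp (M : ℕ) {g : ℝ → ℕ → ℝ} (hg : ∀ k, Continuous fun π => g π k) :
    Continuous fun π => bexp M π (g π) := by
  induction M generalizing g with
  | zero => exact hg 0
  | succ M ih =>
    have := ih hg
    have := ih (g := fun π k => g π (k + 1)) fun k => hg (k + 1)
    simp only [bexp]
    fun_prop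

lemma bexp_id (M : ℕ) (π : ℝ) : bexp M π (fun k => (k : ℝ)) = M * π := by
  induction M with
  | zero => simp [bexp]
  | succ M ih =>
    simp only [bexp, ih, Nat.cast_add, Nat.cast_one, bexp_add, bexp_const]
    ring

lemma bexp_indicator_zero (M : ℕ) (π a : ℝ) :
    bexp M π (fun k => if k = 0 then a else 0) = (1 - π) ^ M * a := by
  induction M with
  | zero => simp [bexp]
  | succ M ih =>
    simp only [bexp, ih, Nat.add_eq_zero_iff, one_ne_zero, and_false, if_false, bexp_const]
    ring

/-- Bounds on the values at positive arguments bound the expectation. -/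
lemma bexp_le_of_pos_le {M : ℕ} {π B : ℝ} (h0 : 0 ≤ π) (h1 : π ≤ 1) {g : ℕ → ℝ}
    (h : ∀ k, 1 ≤ k → k ≤ M → g k ≤ B) :
    bexp M π g ≤ (1 - π) ^ M * g 0 + (1 - (1 - π) ^ M) * B := by
  have h2 : bexp M π g ≤ bexp M π (fun k => (if k = 0 then g 0 - B else 0) + B) := by
    refine bexp_mono h0 h1 fun k hk => ?_
    rcases Nat.eq_zero_or_pos k with rfl | hk0
    · simp
    · simpa [hk0.ne'] using h k hk0 hk
  rw [bexp_add, bexp_const, bexp_indicator_zero] at h2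
  linarith

lemma le_bexp_of_le_pos {M : ℕ} {π B : ℝ} (h0 : 0 ≤ π) (h1 : π ≤ 1) {g : ℕ → ℝ}
    (h : ∀ k, 1 ≤ k → k ≤ M → B ≤ g k) :
    (1 - π) ^ M * g 0 + (1 - (1 - π) ^ M) * B ≤ bexp M π g := by
  have h2 : bexp M π (fun k => (if k = 0 then g 0 - B else 0) + B) ≤ bexp M π g := by
    refine bexp_mono h0 h1 fun k hk => ?_
    rcases Nat.eq_zero_or_pos k with rfl | hk0
    · simp
    · simpa [hk0.ne'] using h k hk0 hk
  rw [bexp_add, bexp_const, bexp_indicator_zero] at h2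
  linarith

/-- Induction downwards from large indices. -/
lemma downward_induction {T : ℕ → Prop} (J : ℕ) (base : ∀ j ≥ J, T j)
    (step : ∀ j, (∀ k > j, T k) → T j) (j : ℕ) : T j := by
  have h : ∀ n j, J ≤ j + n → T j := by
    intro n
    induction n with
    | zero => exact fun j hj => base j hj
    | succ n ih => exact fun j hj => step j fun k hk => ih k (by omega)
  exact h J j (by omega)

/-- Sequences can be constructed downwards from large indices. -/
lemma exists_seq_downward {α : Type*} (P : ℕ → (ℕ → α) → Prop)
    (hP : ∀ j f g, (∀ k ≥ j, f k = g k) → P j f → P j g) (J : ℕ) (f₀ : ℕ → α)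
    (base : ∀ j ≥ J, P j f₀)
    (step : ∀ j f, (∀ k > j, P k f) → ∃ v, P j (Function.update f j v)) :
    ∃ f, ∀ j, P j f := by
  have h : ∀ n, ∃ f, ∀ j, J ≤ j + n → P j f := by
    intro n
    induction n with
    | zero => exact ⟨f₀, fun j hj => base j hj⟩
    | succ n ih =>
      obtain ⟨f, hf⟩ := ih
      by_cases hn : J ≤ n
      · exact ⟨f, fun j hj => hf j (by omega)⟩
      · obtain ⟨v, hv⟩ := step (J - (n + 1)) f fun k hk => hf k (by omega)
        refine ⟨Function.update f (J - (n + 1)) v, fun j hj => ?_⟩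
        · rcases eq_or_lt_of_le (show J - (n + 1) ≤ j by omega) with h | h
          · rw [← h]; exact hv
          · refine hP j f _ (fun k hk => ?_) (hf j (by omega))
            rw [Function.update_of_ne (by omega)]
  obtain ⟨f, hf⟩ := h J
  exact ⟨f, fun j => hf j (by omega)⟩

/-! ### The two cutoffs and mixing between them. -/

/-- Odds ratio below which a single player gives up experimenting in the discrete game. -/
noncomputable def lowCut (δ q : ℝ) : ℝ := (1 - δ) / (1 - δ * q)

/-- Odds ratio above which experimentation is worthwhile for one round even if `M` opponents
experiment as well and everybody gives up afterwards. -/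
noncomputable def highCut (M : ℕ) (δ q : ℝ) : ℝ := (1 - δ) / (1 - δ + δ * q ^ M * (1 - q))

/-- Smallness conditions on the period length, in terms of the discount factor `δ` and the
probability `q` that a risky arm in the good state generates no lump-sum within a period. -/
structure FinePeriod (M : ℕ) (δ q π₀ : ℝ) : Prop where
  one_le : 1 ≤ M
  δ_pos : 0 < δ
  δ_lt : δ < 1
  q_pos : 0 < q
  q_lt : q < 1
  π_pos : 0 < π₀
  mul_π_le : M * π₀ ≤ 1 / 8
  pow_le : 1 - q ^ (M + 1) ≤ 1 / 8
  -- `mixing` makes the error from several simultaneous experiments small against one period's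
  -- myopic gain, `impatience` pushes the mixing probability below `π₀`, and `cut_gap` keeps the
  -- lower cutoff away from the myopic odds `1` relative to the effect of `M + 1` failures.
  mixing : 10 * (M + 1) * (1 - q) * (M * π₀) ≤ 1 - δ
  impatience : 8 * (M + 1) * (1 - δ) < δ ^ 2 * π₀
  cut_gap : 8 * (M + 1) * (1 - q) ≤ 1 - lowCut δ q

namespace FinePeriod

variable {M : ℕ} {δ q π₀ : ℝ} (H : FinePeriod M δ q π₀)
include H

lemma δq_lt : δ * q < 1 := by
  nlinarith [H.δ_pos, H.δ_lt, H.q_lt, H.q_pos]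

lemma lowCut_eq : lowCut δ q * (1 - δ * q) = 1 - δ := by
  have := H.δq_lt
  unfold lowCut
  field_simp [show (1 - δ * q) ≠ 0 by linarith]

lemma lowCut_pos : 0 < lowCut δ q := by
  have := H.δq_lt
  have := H.δ_lt
  unfold lowCut
  exact div_pos (by linarith) (by linarith)

/-- Indifference of a lone player who stops after one more failure: the myopic gain from the safe
arm equals the discounted fall of the odds. Later estimates use this as the conversion rate between
`1 - δ` and `1 - q`. -/
lemma lowCut_indiff : (1 - δ) * (1 - lowCut δ q) = δ * (lowCut δ q * (1 - q)) := by
  linear_combination (-1 : ℝ) * H.lowCut_eq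

lemma lowCut_lt_one : lowCut δ q < 1 := by
  have h := H.lowCut_indiff
  have h1 : 0 < δ * (lowCut δ q * (1 - q)) :=
    mul_pos H.δ_pos (mul_pos H.lowCut_pos (by linarith [H.q_lt]))
  rw [← h] at h1
  by_contra hc
  nlinarith [H.δ_lt]

lemma highDen_pos : 0 < 1 - δ + δ * q ^ M * (1 - q) := by
  have := mul_pos (mul_pos H.δ_pos (pow_pos H.q_pos M)) (show 0 < 1 - q by linarith [H.q_lt])
  linarith [H.δ_lt]

lemma highCut_eq : highCut M δ q * (1 - δ + δ * q ^ M * (1 - q)) = 1 - δ := by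
  have := H.highDen_pos.ne'
  unfold highCut
  field_simp

lemma highCut_pos : 0 < highCut M δ q := div_pos (by linarith [H.δ_lt]) H.highDen_pos

lemma highCut_indiff : (1 - δ) * (1 - highCut M δ q) = δ * (highCut M δ q * q ^ M * (1 - q)) := by
  linear_combination (-1 : ℝ) * H.highCut_eq

lemma highCut_lt_one : highCut M δ q < 1 := by
  have h := H.highCut_indiff
  have h1 : 0 < δ * (highCut M δ q * q ^ M * (1 - q)) :=
    mul_pos H.δ_pos (mul_pos (mul_pos H.highCut_pos (pow_pos H.q_pos M)) (by linarith [H.q_lt]))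
  rw [← h] at h1
  by_contra hc
  nlinarith [H.δ_lt]

lemma pow_le_one (k : ℕ) : q ^ k ≤ 1 := pow_le_one₀ H.q_pos.le H.q_lt.le

lemma lowCut_le_highCut : lowCut δ q ≤ highCut M δ q := by
  unfold lowCut highCut
  have := H.highDen_pos
  have h1 := H.pow_le_one M
  have h2 : 0 ≤ δ * (1 - q) := mul_nonneg H.δ_pos.le (by linarith [H.q_lt])
  gcongr
  · linarith [H.δ_lt]
  · nlinarith

lemma lowCut_lt_highCut : lowCut δ q < highCut M δ q := by
  refine lt_of_le_of_ne H.lowCut_le_highCut fun h => ?_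
  have h1 := H.lowCut_indiff
  have h2 := H.highCut_indiff
  rw [← h, h1] at h2
  have h3 : q ^ M ≤ q := by
    calc q ^ M ≤ q ^ 1 := pow_le_pow_of_le_one H.q_pos.le H.q_lt.le H.one_le
      _ = q := pow_one q
  have h4 : 0 < δ * (lowCut δ q * (1 - q)) :=
    mul_pos H.δ_pos (mul_pos H.lowCut_pos (by linarith [H.q_lt]))
  have h5 : δ * (lowCut δ q * (1 - q)) * (1 - q ^ M) = 0 := by linear_combination h2
  rcases mul_eq_zero.1 h5 with h6 | h6
  · exact h4.ne' h6
  · linarith [H.q_lt]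

/-- The region between the cutoffs is crossed by at most `M` failures. After cross-multiplication
this is just `q ^ M ≤ 1`. -/
lemma highCut_mul_pow_le : highCut M δ q * q ^ M ≤ lowCut δ q := by
  have := H.highDen_pos
  have hd : 0 < 1 - δ * q := by linarith [H.δq_lt]
  unfold lowCut highCut
  rw [div_mul_eq_mul_div, div_le_div_iff₀ this hd]
  have h1 := H.pow_le_one M
  have h2 : q ^ M * (1 - δ) ≤ 1 - δ := by nlinarith [H.δ_lt]
  have : 0 ≤ 1 - δ := by linarith [H.δ_lt]
  nlinarith

lemma one_sub_pow_le (k : ℕ) : 1 - q ^ k ≤ k * (1 - q) := by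
  have := one_add_mul_le_pow (a := q - 1) (by linarith [H.q_pos]) k
  rw [show 1 + (q - 1) = q by ring] at this
  linarith

lemma pow_ge (k : ℕ) (hk : k ≤ M + 1) : 7 / 8 ≤ q ^ k := by
  have := pow_le_pow_of_le_one H.q_pos.le H.q_lt.le hk
  linarith [H.pow_le]

set_option maxHeartbeats 1600000 in
/-- One step of the construction of the mixed equilibrium at an odds ratio `y` between the two
cutoffs; `φ k` is the cost after `k ≥ 1` further failed experiments. -/
lemma exists_mixing {y : ℝ} (hy : lowCut δ q < y) (hy' : y < highCut M δ q) {φ : ℕ → ℝ}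
    (hlow : ∀ k, 1 ≤ k → k ≤ M + 1 → lowCut δ q * q ^ (M + 1) ≤ φ k)
    (hψl : ∀ k, 1 ≤ k → k ≤ M →
      lowCut δ q * (1 - q) * (1 - 4 * (1 - q ^ (M + 1))) ≤ φ k - φ (k + 1))
    (hψu : ∀ k, 1 ≤ k → k ≤ M →
      φ k - φ (k + 1) ≤ lowCut δ q * (1 - q) * (1 + 4 * (1 - q ^ (M + 1))))
    (h1 : φ 1 ≤ y * q) :
    ∃ π v : ℝ, 0 ≤ π ∧ π ≤ 1 ∧ v = (1 - δ) + δ * bexp M π (fun k => φ (k + 1)) ∧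
      v = (1 - δ) * y + δ * bexp M π (fun k => if k = 0 then v else φ k) ∧
      v ≤ y ∧ lowCut δ q * q ^ (M + 1) ≤ v ∧
      lowCut δ q * (1 - q) * (1 - 4 * (1 - q ^ (M + 1))) ≤ v - φ 1 ∧
      v - φ 1 ≤ lowCut δ q * (1 - q) * (1 + 4 * (1 - q ^ (M + 1))) ∧
      ∀ z, z * q ^ M = y → (1 - δ) * (1 - z) ≤ δ * (v - φ 1) := by
  set c := lowCut δ q with hc
  set u := c * (1 - q) with hu
  set ε := 1 - q ^ (M + 1) with hε
  have hδ := H.δ_pos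
  have hδ1 := H.δ_lt
  have hq := H.q_pos
  have hq1 := H.q_lt
  have hcpos : 0 < c := H.lowCut_pos
  have hc1 : c < 1 := H.lowCut_lt_one
  have hupos : 0 < u := mul_pos hcpos (by linarith)
  have hε0 : 0 ≤ ε := by have := H.pow_le_one (M + 1); linarith
  have hε1 : ε ≤ 1 / 8 := H.pow_le
  have hy1 : y < 1 := hy'.trans H.highCut_lt_one
  have hπ₀ := H.π_pos
  have hτ := H.mul_π_le
  have hM : (1 : ℝ) ≤ M := by exact_mod_cast H.one_le
  have hπ₀1 : π₀ ≤ 1 / 8 := by nlinarith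
  have hψ0 : ∀ k, 1 ≤ k → k ≤ M → φ (k + 1) ≤ φ k := by
    intro k hk hk'
    have := hψl k hk hk'
    have : 0 ≤ u * (1 - 4 * ε) := mul_nonneg hupos.le (by linarith)
    linarith
  have hmono : ∀ k, 1 ≤ k → k ≤ M + 1 → φ k ≤ φ 1 := by
    intro k hk
    induction k, hk using Nat.le_induction with
    | base => exact fun _ => le_rfl
    | succ k hk ih => exact fun hk' => (hψ0 k hk (by omega)).trans (ih (by omega))
  have hdrop : ∀ k : ℕ, k ≤ M → φ 1 - φ (k + 1) ≤ (u * (1 + 4 * ε)) * k := by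
    intro k
    induction k with
    | zero => simp
    | succ k ih =>
      intro hk
      have h2 := ih (by omega)
      have h3 := hψu (k + 1) (by omega) hk
      push_cast
      linarith
  -- cost of the risky arm
  set CR : ℝ → ℝ := fun π => (1 - δ) + δ * bexp M π (fun k => φ (k + 1)) with hCR
  have hCRcont : Continuous CR := by
    have := continuous_bexp M (g := fun _ k => φ (k + 1)) fun k => continuous_const
    fun_prop
  -- Excess of the safe over the risky cost. If nobody experiments the situation repeats, and the
  -- unknown value there is replaced by `CR π`; at a root both costs therefore equal `v = CR π`.
  set F : ℝ → ℝ := fun π =>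
    (1 - δ) * y + δ * bexp M π (fun k => if k = 0 then CR π else φ k) - CR π with hF
  have hFcont : Continuous F := by
    have := continuous_bexp M (g := fun π k => if k = 0 then CR π else φ k) fun k => by
      split_ifs <;> fun_prop
    fun_prop
  have hCRle : ∀ π, 0 ≤ π → π ≤ 1 → CR π ≤ y := by
    intro π h0 h01
    have h2 : bexp M π (fun k => φ (k + 1)) ≤ bexp M π (fun _ => φ 1) :=
      bexp_mono h0 h01 fun k hk => hmono _ (by omega) (by omega)
    rw [bexp_const] at h2
    have h3 : δ * bexp M π (fun k => φ (k + 1)) ≤ δ * (y * q) := by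
      gcongr
      exact h2.trans h1
    have h4 : (1 - δ) ≤ y * (1 - δ * q) := by
      rw [← H.lowCut_eq]
      have : 0 ≤ 1 - δ * q := by linarith [H.δq_lt]
      gcongr
    simp only [hCR]
    linarith
  have hCRge : ∀ π, 0 ≤ π → π ≤ 1 → c * q ^ (M + 1) ≤ CR π := by
    intro π h0 h01
    have h2 : bexp M π (fun _ => c * q ^ (M + 1)) ≤ bexp M π (fun k => φ (k + 1)) :=
      bexp_mono h0 h01 fun k hk => hlow _ (by omega) (by omega)
    rw [bexp_const] at h2
    have h3 : c * q ^ (M + 1) ≤ 1 := by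
      have := H.pow_le_one (M + 1)
      have := pow_pos hq (M + 1)
      nlinarith
    simp only [hCR]
    nlinarith
  have hF0 : 0 ≤ F 0 := by
    have := hCRle 0 le_rfl zero_le_one
    simp only [hF, bexp_zero, if_true]
    nlinarith
  have hRu : (1 - δ) * (1 - c) = δ * u := H.lowCut_indiff
  -- Since `y` lies between the cutoffs, the myopic gain `(1 - δ) * (1 - y)` from the safe arm is `δ
  -- * u` up to the relative error `ε`.
  have hRy : δ * (u * (1 - ε)) ≤ (1 - δ) * (1 - y) := by
    have h2 := H.highCut_indiff
    have h3 : (1 - δ) * (1 - highCut M δ q) ≤ (1 - δ) * (1 - y) :=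
      mul_le_mul_of_nonneg_left (by linarith) (by linarith)
    have h4 : c * q ^ (M + 1) ≤ highCut M δ q * q ^ M := by
      have := H.lowCut_le_highCut
      have h5 : q ^ (M + 1) ≤ q ^ M := pow_le_pow_of_le_one hq.le hq1.le (by omega)
      have := pow_pos hq M
      have := pow_pos hq (M + 1)
      have := H.highCut_pos
      gcongr
    have h6 : u * (1 - ε) ≤ highCut M δ q * q ^ M * (1 - q) := by
      have : u * (1 - ε) = c * q ^ (M + 1) * (1 - q) := by simp only [hu, hε]; ring
      rw [this]
      exact mul_le_mul_of_nonneg_right h4 (by linarith)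
    calc δ * (u * (1 - ε)) ≤ δ * (highCut M δ q * q ^ M * (1 - q)) := by gcongr
      _ ≤ _ := by linarith
  have hRy' : (1 - δ) * (1 - y) ≤ δ * u := by
    rw [← hRu]
    exact mul_le_mul_of_nonneg_left (by linarith) (by linarith)
  -- At `π₀`, some opponent experiments with probability at least `π₀` and then saves a safe player
  -- at least `δ * u / 2`. The myopic excess `(1 - δ) * (y - CR π₀)` is at most `(1 - δ) * 4 * (M +
  -- 1) * u`, which is smaller by `impatience`.
  have hFπ : F π₀ ≤ 0 := by
    set P := (1 - π₀) ^ M with hP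
    have hPle : P ≤ 1 - π₀ := by
      calc P ≤ (1 - π₀) ^ 1 := pow_le_pow_of_le_one (by linarith) (by linarith) H.one_le
        _ = _ := pow_one _
    have hD : CR π₀ - φ 1 ≥ δ * (u / 2) := by
      have h2 : bexp M π₀ (fun k => φ 1 - φ (k + 1)) ≤ bexp M π₀ fun k => (u * (1 + 4 * ε)) * k :=
        bexp_mono hπ₀.le (by linarith) fun k hk => hdrop k hk
      rw [bexp_sub, bexp_const, bexp_const_mul, bexp_id] at h2
      have h3 : (1 - δ) * (1 - φ 1) ≥ (1 - δ) * (1 - y) :=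
        mul_le_mul_of_nonneg_left (by nlinarith) (by linarith)
      have h4 : u * (1 + 4 * ε) * (M * π₀) ≤ u * (1 + 4 * ε) * (1 / 8) := by
        gcongr
      have h5 : CR π₀ - φ 1 = (1 - δ) * (1 - φ 1)
          - δ * (φ 1 - bexp M π₀ (fun k => φ (k + 1))) := by
        simp only [hCR]; ring
      have h6 : δ * (φ 1 - bexp M π₀ (fun k => φ (k + 1))) ≤ δ * (u * (1 + 4 * ε) * (1 / 8)) := by
        gcongr
        linarith
      have h7 : u * (1 + 4 * ε) * (1 / 8) ≤ u * (3 / 16) := by nlinarith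
      have h8 : u * (7 / 8) ≤ u * (1 - ε) := by nlinarith
      nlinarith
    have hA : bexp M π₀ (fun k => if k = 0 then CR π₀ else φ k) ≤ P * CR π₀ + (1 - P) * φ 1 := by
      have h2 := bexp_le_of_pos_le (M := M) (B := φ 1) hπ₀.le (by linarith)
        (g := fun k => if k = 0 then CR π₀ else φ k) fun k hk hk' => by
          simpa [show k ≠ 0 by omega] using hmono k hk (by omega)
      simpa using h2
    have hyC : y - CR π₀ ≤ 4 * (M + 1) * u := by
      have h2 := hCRge π₀ hπ₀.le (by linarith)
      have h3 : y * q ^ M ≤ c := by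
        refine le_trans ?_ H.highCut_mul_pow_le
        have := pow_pos hq M
        gcongr
      have h4 := H.pow_ge M (by omega)
      have h5 := H.one_sub_pow_le (M + (M + 1))
      rw [pow_add] at h5
      push_cast at h5
      -- `(y - c q^{M+1}) q^M ≤ c (1 - q^{2M+1})`
      have h6 : (y - c * q ^ (M + 1)) * q ^ M ≤ c * ((M + (M + 1)) * (1 - q)) := by
        have : c * (1 - q ^ M * q ^ (M + 1)) ≤ c * ((M + (M + 1)) * (1 - q)) := by gcongr
        nlinarith
      have h7 : 0 ≤ y - c * q ^ (M + 1) := by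
        have := H.pow_le_one (M + 1)
        nlinarith
      have h8 : (y - c * q ^ (M + 1)) * (7 / 8) ≤ (y - c * q ^ (M + 1)) * q ^ M := by gcongr
      have h9 : c * ((M + (M + 1)) * (1 - q)) ≤ (2 * (M + 1)) * u := by
        simp only [hu]; nlinarith
      have h10 : 0 ≤ (M + 1) * u := by positivity
      nlinarith
    have h2 : F π₀ ≤ (1 - δ) * (y - CR π₀) - δ * ((1 - P) * (CR π₀ - φ 1)) := by
      have : δ * bexp M π₀ (fun k => if k = 0 then CR π₀ else φ k)
        ≤ δ * (P * CR π₀ + (1 - P) * φ 1) := by gcongr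
      simp only [hF]
      nlinarith
    have h3 : (1 - δ) * (y - CR π₀) ≤ (1 - δ) * (4 * (M + 1) * u) :=
      mul_le_mul_of_nonneg_left hyC (by linarith)
    have h4 : π₀ * (δ * (u / 2)) ≤ (1 - P) * (CR π₀ - φ 1) := by
      have : 0 ≤ δ * (u / 2) := by positivity
      have h5 : 0 ≤ CR π₀ - φ 1 := by linarith
      calc π₀ * (δ * (u / 2)) ≤ π₀ * (CR π₀ - φ 1) := by gcongr
        _ ≤ _ := mul_le_mul_of_nonneg_right (by linarith) h5
    have h5 : δ * (π₀ * (δ * (u / 2))) ≤ δ * ((1 - P) * (CR π₀ - φ 1)) := by gcongr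
    have h6 : (1 - δ) * (4 * (M + 1) * u) ≤ δ * (π₀ * (δ * (u / 2))) := by
      have h7 := mul_le_mul_of_nonneg_right H.impatience.le (show 0 ≤ u / 2 by positivity)
      nlinarith
    linarith
  obtain ⟨π, ⟨hπ0, hπ1⟩, hroot⟩ : ∃ π ∈ Set.Icc 0 π₀, F π = 0 := by
    have := intermediate_value_Icc' hπ₀.le hFcont.continuousOn
    exact this ⟨hFπ, hF0⟩
  have hπ1' : π ≤ 1 := by linarith
  have hCSeq : CR π = (1 - δ) * y + δ * bexp M π (fun k => if k = 0 then CR π else φ k) := by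
    simp only [hF] at hroot
    linarith
  set P := (1 - π) ^ M with hP
  have hP1 : P ≤ 1 := pow_le_one₀ (by linarith) (by linarith)
  have hPτ : 1 - M * π₀ ≤ P := by
    have h2 := one_add_mul_le_pow (a := -π) (by linarith) M
    rw [← sub_eq_add_neg] at h2
    have : (M : ℝ) * π ≤ M * π₀ := by gcongr
    linarith
  -- indifference
  set ψ : ℕ → ℝ := fun k => (if k = 0 then CR π else φ k) - φ (k + 1) with hψ
  have hind : δ * bexp M π ψ = (1 - δ) * (1 - y) := by
    simp only [hψ]
    rw [bexp_sub]
    have : CR π = (1 - δ) + δ * bexp M π (fun k => φ (k + 1)) := rfl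
    linarith
  have hψ00 : ψ 0 = CR π - φ 1 := by simp [hψ]
  have hψk : ∀ k, 1 ≤ k → ψ k = φ k - φ (k + 1) := fun k hk => by
    simp [hψ, show k ≠ 0 by omega]
  have hup : δ * (P * (CR π - φ 1)) + δ * ((1 - P) * (u * (1 - 4 * ε))) ≤ (1 - δ) * (1 - y) := by
    rw [← hind, ← hψ00, ← mul_add]
    refine mul_le_mul_of_nonneg_left (le_bexp_of_le_pos hπ0 hπ1' fun k hk hk' => ?_) hδ.le
    rw [hψk k hk]
    exact hψl k hk hk'
  have hdn : (1 - δ) * (1 - y) ≤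
      δ * (P * (CR π - φ 1)) + δ * ((1 - P) * (u * (1 + 4 * ε))) := by
    rw [← hind, ← hψ00, ← mul_add]
    refine mul_le_mul_of_nonneg_left (bexp_le_of_pos_le hπ0 hπ1' fun k hk hk' => ?_) hδ.le
    rw [hψk k hk]
    exact hψu k hk hk'
  have hPpos : 7 / 8 ≤ P := by linarith
  refine ⟨π, CR π, hπ0, hπ1', rfl, hCSeq, hCRle π hπ0 hπ1', hCRge π hπ0 hπ1', ?_, ?_, ?_⟩
  -- The term `k = 0` has weight `P` and the others obey the inductive bounds. The factor `4`
  -- reproduces itself: the lower bound needs only `5 ≤ 8 * P`, the upper one `1 ≤ 2 * P`.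
  · have h2 : P * (CR π - φ 1) ≥ u * (1 - ε) - (1 - P) * (u * (1 + 4 * ε)) := by
      have : δ * (u * (1 - ε) - (1 - P) * (u * (1 + 4 * ε))) ≤ δ * (P * (CR π - φ 1)) := by
        linarith
      exact le_of_mul_le_mul_left this hδ
    have h3 : P * (u * (1 - 4 * ε)) ≤ P * (CR π - φ 1) := by
      refine le_trans ?_ h2
      have h4 : 0 ≤ u * ε := by positivity
      nlinarith
    exact le_of_mul_le_mul_left h3 (by linarith)
  · have h2 : P * (CR π - φ 1) ≤ u - (1 - P) * (u * (1 - 4 * ε)) := by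
      have : δ * (P * (CR π - φ 1)) ≤ δ * (u - (1 - P) * (u * (1 - 4 * ε))) := by
        linarith
      exact le_of_mul_le_mul_left this hδ
    have h3 : P * (CR π - φ 1) ≤ P * (u * (1 + 4 * ε)) := by
      refine le_trans h2 ?_
      have h4 : 0 ≤ u * ε := by positivity
      nlinarith
    exact le_of_mul_le_mul_left h3 (by linarith)
  · intro z hz
    -- The `M` failures leading from `z` to `y` lower the odds by at least `u`, so the myopic gain
    -- at `z` is smaller than at `y` by at least `(1 - δ) * u`. Through `mixing` this pays for the
    -- error `5 * ε * u`, the sum of the relative errors `4 * ε` and `ε`.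
    have hzy : c * (1 - q) ≤ z - y := by
      have hz0 : y ≤ z := by
        have := pow_pos hq M
        have := H.pow_le_one M
        by_contra hlt
        nlinarith
      have h2 : q ^ M ≤ q := by
        calc q ^ M ≤ q ^ 1 := pow_le_pow_of_le_one hq.le hq1.le H.one_le
          _ = q := pow_one q
      have h3 : y ≤ z * q := by
        rw [← hz]
        exact mul_le_mul_of_nonneg_left h2 (by linarith)
      nlinarith
    have hεN : ε ≤ (M + 1) * (1 - q) := by
      have := H.one_sub_pow_le (M + 1)
      push_cast at this
      linarith
    -- `(1 - P) * 5 ε u ≤ P (1 - δ)(z - y)`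
    have h2 : (1 - P) * (5 * ε * u) ≤ P * ((1 - δ) * (z - y)) := by
      have h3 : (1 - P) * (5 * ε * u) ≤ (M * π₀) * (5 * ((M + 1) * (1 - q)) * u) := by
        have : 0 ≤ 1 - P := by linarith
        gcongr
        linarith
      have h4 : (M * π₀) * (5 * ((M + 1) * (1 - q)) * u) ≤ (1 - δ) / 2 * u := by
        have := mul_le_mul_of_nonneg_right H.mixing hupos.le
        nlinarith
      have h5 : (1 - δ) / 2 * u ≤ P * ((1 - δ) * (z - y)) := by
        have h6 : (1 - δ) * u ≤ (1 - δ) * (z - y) :=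
          mul_le_mul_of_nonneg_left hzy (by linarith)
        have h7 : 0 ≤ (1 - δ) * u := mul_nonneg (by linarith) hupos.le
        nlinarith
      linarith
    have h3 : δ * ((1 - P) * (5 * ε * u)) ≤ (1 - P) * (5 * ε * u) := by
      have : 0 ≤ (1 - P) * (5 * ε * u) := mul_nonneg (by linarith) (by positivity)
      nlinarith
    have h4 : P * ((1 - δ) * (1 - z)) ≤ P * (δ * (CR π - φ 1)) := by
      have h5 : (1 - P) * (δ * (u * (1 - ε))) ≤ (1 - P) * ((1 - δ) * (1 - y)) :=
        mul_le_mul_of_nonneg_left hRy (by linarith)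
      nlinarith
    exact le_of_mul_le_mul_left h4 (by linarith)

end FinePeriod

/-! ### Costs below the upper cutoff and costs of the two modes. -/

/-- Properties of the cost `φ j` of mixing with probability `π j` after `j` failed experiments, for
an odds ratio between the two cutoffs. -/
structure MixingAt (M : ℕ) (δ q X : ℝ) (φ π : ℕ → ℝ) (j : ℕ) : Prop where
  nonneg : 0 ≤ π j
  le_one : π j ≤ 1
  risky : φ j = (1 - δ) + δ * bexp M (π j) (fun k => φ (j + (k + 1)))
  safe : φ j = (1 - δ) * (X * q ^ j) + δ * bexp M (π j) (fun k => φ (j + k))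
  le : φ j ≤ X * q ^ j
  ge : lowCut δ q * q ^ (M + 1) ≤ φ j
  diff_ge : lowCut δ q * (1 - q) * (1 - 4 * (1 - q ^ (M + 1))) ≤ φ j - φ (j + 1)
  diff_le : φ j - φ (j + 1) ≤ lowCut δ q * (1 - q) * (1 + 4 * (1 - q ^ (M + 1)))
  -- For odds `z` that `M` failures turn into the current ones: in the normal mode at `z`, joining
  -- the `M` risky opponents beats deviating to the safe arm.
  slack : ∀ z, z * q ^ M = X * q ^ j → (1 - δ) * (1 - z) ≤ δ * (φ j - φ (j + 1))

/-- Costs of the equilibrium at low odds ratios. -/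
structure LowCost (M : ℕ) (δ q X : ℝ) (φ π : ℕ → ℝ) : Prop where
  below : ∀ j, X * q ^ j ≤ lowCut δ q → φ j = X * q ^ j
  mixing : ∀ j, lowCut δ q < X * q ^ j → X * q ^ j < highCut M δ q → MixingAt M δ q X φ π j

/-- Costs in the normal (`VN`) and in the punishment (`VP`) mode. -/
structure ModeCost (M : ℕ) (δ q X top : ℝ) (φ VN VP : ℕ → ℝ) : Prop where
  low : ∀ j, X * q ^ j < highCut M δ q → VN j = φ j ∧ VP j = φ j
  normal : ∀ j, highCut M δ q ≤ X * q ^ j → VN j = (1 - δ) + δ * VN (j + (M + 1))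
  -- A lone experiment followed by more punishment. Defining `VP` in this way makes the deviation to
  -- the risky arm neutral.
  punish : ∀ j, highCut M δ q ≤ X * q ^ j → X * q ^ j ≤ top → VP j = (1 - δ) + δ * VP (j + 1)
  top : ∀ j, highCut M δ q ≤ X * q ^ j → top < X * q ^ j → VP j = VN j

lemma MixingAt.congr {M : ℕ} {δ q X : ℝ} {φ π φ' π' : ℕ → ℝ} {j : ℕ}
    (hφ : ∀ k ≥ j, φ k = φ' k) (hπ : π j = π' j) (h : MixingAt M δ q X φ π j) :
    MixingAt M δ q X φ' π' j := by
  have e1 : (fun k => φ' (j + (k + 1))) = fun k => φ (j + (k + 1)) := by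
    ext k; rw [hφ _ (by omega)]
  have e2 : (fun k => φ' (j + k)) = fun k => φ (j + k) := by
    ext k; rw [hφ _ (by omega)]
  obtain ⟨h1, h2, h3, h4, h5, h6, h7, h8, h9⟩ := h
  rw [hφ j le_rfl] at h3 h4 h5 h6 h7 h8 h9
  rw [hφ (j + 1) (by omega)] at h7 h8 h9
  rw [← e1] at h3
  rw [← e2] at h4
  rw [hπ] at h1 h2 h3 h4
  exact ⟨h1, h2, h3, h4, h5, h6, h7, h8, h9⟩

namespace FinePeriod

variable {M : ℕ} {δ q π₀ : ℝ} (H : FinePeriod M δ q π₀) {X : ℝ}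
include H

lemma exists_lt_lowCut : ∃ J, ∀ j ≥ J, X * q ^ j < lowCut δ q := by
  have h := (tendsto_pow_atTop_nhds_zero_of_lt_one H.q_pos.le H.q_lt).const_mul X
  rw [mul_zero] at h
  exact eventually_atTop.1 (h.eventually_lt_const H.lowCut_pos)

lemma grid_anti (hX : 0 < X) {j k : ℕ} (hjk : j ≤ k) : X * q ^ k ≤ X * q ^ j :=
  mul_le_mul_of_nonneg_left (pow_le_pow_of_le_one H.q_pos.le H.q_lt.le hjk) hX.le

lemma grid_pos (hX : 0 < X) (j : ℕ) : 0 < X * q ^ j := mul_pos hX (pow_pos H.q_pos j)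

lemma grid_ge {j k : ℕ} (hj : lowCut δ q ≤ X * q ^ j) (hk : k ≤ M + 1) :
    lowCut δ q * q ^ (M + 1) ≤ X * q ^ (j + k) := by
  rw [pow_add q j k, ← mul_assoc]
  have h1 : q ^ (M + 1) ≤ q ^ k := pow_le_pow_of_le_one H.q_pos.le H.q_lt.le hk
  have h2 := H.lowCut_pos
  have h3 := pow_pos H.q_pos (M + 1)
  calc lowCut δ q * q ^ (M + 1) ≤ lowCut δ q * q ^ k := by gcongr
    _ ≤ _ := mul_le_mul_of_nonneg_right hj (pow_pos H.q_pos k).le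

lemma exists_lowCost (hX : 0 < X) : ∃ φ π, LowCost M δ q X φ π := by
  obtain ⟨J, hJ⟩ := H.exists_lt_lowCut (X := X)
  obtain ⟨f, hf⟩ : ∃ f : ℕ → ℝ × ℝ, ∀ j, (X * q ^ j ≤ lowCut δ q → (f j).1 = X * q ^ j) ∧
      (lowCut δ q < X * q ^ j → X * q ^ j < highCut M δ q →
        MixingAt M δ q X (fun k => (f k).1) (fun k => (f k).2) j) := by
    refine exists_seq_downward _ ?_ J (fun j => (X * q ^ j, 0)) ?_ ?_
    · rintro j f g hfg ⟨h1, h2⟩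
      refine ⟨fun h => by rw [← hfg j le_rfl]; exact h1 h, fun h h' => ?_⟩
      exact (h2 h h').congr (fun k hk => by rw [hfg k hk]) (by rw [hfg j le_rfl])
    · exact fun j hj => ⟨fun _ => rfl, fun h => absurd (hJ j hj) (not_lt.2 h.le)⟩
    · intro j f hf
      rcases le_or_gt (X * q ^ j) (lowCut δ q) with h | h
      · exact ⟨(X * q ^ j, 0), fun _ => by simp, fun h' => absurd h (not_le.2 h')⟩
      rcases le_or_gt (highCut M δ q) (X * q ^ j) with h' | h'
      · exact ⟨0, fun h'' => absurd h'' (not_le.2 h), fun _ h'' => absurd h' (not_le.2 h'')⟩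
      have hc := H.lowCut_pos
      have hu : 0 ≤ lowCut δ q * (1 - q) := mul_nonneg hc.le (by linarith [H.q_lt])
      have hε : 0 ≤ 1 - q ^ (M + 1) := by linarith [H.pow_le_one (M + 1)]
      -- The next `M + 1` grid points stay above `lowCut * q ^ (M + 1)`. The increments of `φ` are
      -- of size `lowCut * (1 - q)` on both sides of the lower cutoff: by direct computation below
      -- it and by the inductive bounds above it.
      have key : ∀ k, 1 ≤ k → k ≤ M + 1 →
          lowCut δ q * q ^ (M + 1) ≤ (f (j + k)).1 ∧ (k ≤ M →
          lowCut δ q * (1 - q) * (1 - 4 * (1 - q ^ (M + 1))) ≤ (f (j + k)).1 - (f (j + (k + 1))).1 ∧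
          (f (j + k)).1 - (f (j + (k + 1))).1 ≤
            lowCut δ q * (1 - q) * (1 + 4 * (1 - q ^ (M + 1)))) := by
        intro k hk hk'
        have hge := H.grid_ge h.le hk'
        rcases le_or_gt (X * q ^ (j + k)) (lowCut δ q) with h2 | h2
        · have e1 := (hf (j + k) (by omega)).1 h2
          have e2 := (hf (j + (k + 1)) (by omega)).1 ((H.grid_anti hX (by omega)).trans h2)
          rw [e1, e2, show X * q ^ (j + (k + 1)) = X * q ^ (j + k) * q by ring]
          refine ⟨hge, fun _ => ?_⟩
          rw [show X * q ^ (j + k) - X * q ^ (j + k) * q = X * q ^ (j + k) * (1 - q) by ring]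
          have hq : 0 ≤ 1 - q := by linarith [H.q_lt]
          have h3 := mul_le_mul_of_nonneg_right hge hq
          have h4 := mul_le_mul_of_nonneg_right h2 hq
          have h5 := mul_nonneg hu hε
          constructor <;> nlinarith
        · have h3 := (hf (j + k) (by omega)).2 h2
            ((H.grid_anti hX (Nat.le_add_right j k)).trans_lt h')
          exact ⟨h3.ge, fun _ => ⟨h3.diff_ge, h3.diff_le⟩⟩
      have h1 : (f (j + 1)).1 ≤ X * q ^ j * q := by
        rw [mul_assoc, ← pow_succ]
        rcases le_or_gt (X * q ^ (j + 1)) (lowCut δ q) with h2 | h2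
        · exact ((hf (j + 1) (by omega)).1 h2).le
        · exact ((hf (j + 1) (by omega)).2 h2 ((H.grid_anti hX (Nat.le_add_right j 1)).trans_lt h')).le
      obtain ⟨π, v, m1, m2, m3, m4, m5, m6, m7, m8, m9⟩ := H.exists_mixing h h'
        (φ := fun k => (f (j + k)).1) (fun k a b => (key k a b).1)
        (fun k a b => ((key k a (by omega)).2 b).1) (fun k a b => ((key k a (by omega)).2 b).2) h1
      refine ⟨(v, π), fun h'' => absurd h'' (not_le.2 h), fun _ _ => ?_⟩
      have u1 : ∀ k, Function.update f j (v, π) (j + (k + 1)) = f (j + (k + 1)) := fun k => by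
        rw [Function.update_of_ne (by omega)]
      have u2 : ∀ k, (Function.update f j (v, π) (j + k)).1 = if k = 0 then v else (f (j + k)).1 := by
        intro k
        rcases Nat.eq_zero_or_pos k with rfl | hk
        · simp
        · rw [Function.update_of_ne (by omega), if_neg (by omega)]
      constructor <;> simp only [Function.update_self, u1, u2] <;> assumption
  exact ⟨_, _, fun j => (hf j).1, fun j => (hf j).2⟩

/-- The costs at `j` involve only those at `j + 1` and `j + (M + 1)`, and are prescribed once the
odds are low, so backward recursion determines both modes. -/
lemma exists_modeCost (top : ℝ) (φ : ℕ → ℝ) :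
    ∃ VN VP, ModeCost M δ q X top φ VN VP := by
  obtain ⟨J, hJ⟩ := H.exists_lt_lowCut (X := X)
  have hce := H.lowCut_le_highCut
  obtain ⟨f, hf⟩ : ∃ f : ℕ → ℝ × ℝ, ∀ j, f j = if X * q ^ j < highCut M δ q then (φ j, φ j) else
      ((1 - δ) + δ * (f (j + (M + 1))).1,
        if X * q ^ j ≤ top then (1 - δ) + δ * (f (j + 1)).2
          else (1 - δ) + δ * (f (j + (M + 1))).1) := by
    refine exists_seq_downward _ ?_ J (fun j => (φ j, φ j)) ?_ ?_
    · intro j f g hfg h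
      rw [← hfg j le_rfl, ← hfg (j + (M + 1)) (by omega), ← hfg (j + 1) (by omega)]
      exact h
    · exact fun j hj => by simp only [if_pos ((hJ j hj).trans_le hce)]
    · intro j f _
      simp only [Function.update_self, Function.update_of_ne (show j + (M + 1) ≠ j by omega),
        Function.update_of_ne (show j + 1 ≠ j by omega)]
      exact ⟨_, rfl⟩
  refine ⟨fun j => (f j).1, fun j => (f j).2, fun j h => ?_, fun j h => ?_, fun j h h' => ?_,
    fun j h h' => ?_⟩
  · simp only [hf j, if_pos h, and_self]
  · simp only [hf j, if_neg (not_lt.2 h)]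
  · simp only [hf j, if_neg (not_lt.2 h), if_pos h']
  · simp only [hf j, if_neg (not_lt.2 h), if_neg (not_le.2 h')]

end FinePeriod

/-! ### Incentives in the normal and in the punishment mode. -/

namespace FinePeriod

variable {M : ℕ} {δ q π₀ : ℝ} (H : FinePeriod M δ q π₀) {X top : ℝ} {φ π VN VP : ℕ → ℝ}

section Low

variable (hX : 0 < X) (hL : LowCost M δ q X φ π)
include H hX hL

lemma low_le {j : ℕ} (hj : X * q ^ j < highCut M δ q) : φ j ≤ X * q ^ j := by
  rcases le_or_gt (X * q ^ j) (lowCut δ q) with h | h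
  · exact (hL.below j h).le
  · exact (hL.mixing j h hj).le

lemma low_diff_ge {j : ℕ} (hj : X * q ^ j < highCut M δ q)
    (hj' : lowCut δ q * q ^ (M + 1) ≤ X * q ^ j) :
    lowCut δ q * (1 - q) * (1 - 4 * (1 - q ^ (M + 1))) ≤ φ j - φ (j + 1) := by
  rcases le_or_gt (X * q ^ j) (lowCut δ q) with h | h
  · rw [hL.below j h, hL.below (j + 1) ((H.grid_anti hX (by omega)).trans h), pow_succ q j]
    have hq := H.q_lt
    have h1 : 0 ≤ lowCut δ q * (1 - q) * (1 - q ^ (M + 1)) :=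
      mul_nonneg (mul_nonneg H.lowCut_pos.le (by linarith)) (by linarith [H.pow_le_one (M + 1)])
    have h2 := mul_le_mul_of_nonneg_right hj' (show 0 ≤ 1 - q by linarith)
    nlinarith
  · exact (hL.mixing j h hj).diff_ge

lemma low_anti {j : ℕ} (hj : X * q ^ j < highCut M δ q) : φ (j + 1) ≤ φ j := by
  rcases le_or_gt (X * q ^ j) (lowCut δ q) with h | h
  · have h1 : X * q ^ (j + 1) ≤ X * q ^ j := H.grid_anti hX (by omega)
    rw [hL.below j h, hL.below (j + 1) (h1.trans h)]
    exact h1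
  · have h1 := (hL.mixing j h hj).diff_ge
    have h2 : 0 ≤ lowCut δ q * (1 - q) * (1 - 4 * (1 - q ^ (M + 1))) :=
      mul_nonneg (mul_nonneg H.lowCut_pos.le (by linarith [H.q_lt])) (by linarith [H.pow_le])
    linarith

lemma low_ge {j : ℕ} (hj : X * q ^ j < highCut M δ q)
    (hj' : lowCut δ q * q ^ (M + 1) ≤ X * q ^ j) : lowCut δ q * q ^ (M + 1) ≤ φ j := by
  rcases le_or_gt (X * q ^ j) (lowCut δ q) with h | h
  · rwa [hL.below j h]
  · exact (hL.mixing j h hj).ge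

end Low

section Modes

variable (hX : 0 < X) (hL : LowCost M δ q X φ π) (hC : ModeCost M δ q X top φ VN VP)
include H hX hL hC

omit hX hL hC in
-- The odds tend to zero along the grid, so all indices with low odds serve as the base of a
-- downward induction.
lemma grid_induction {T : ℕ → Prop} (low : ∀ j, X * q ^ j < highCut M δ q → T j)
    (high : ∀ j, highCut M δ q ≤ X * q ^ j → (∀ k > j, T k) → T j) (j : ℕ) : T j := by
  obtain ⟨J, hJ⟩ := H.exists_lt_lowCut (X := X)
  refine downward_induction J (fun j hj => low j ((hJ j hj).trans_le H.lowCut_le_highCut))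
    (fun j ih => ?_) j
  rcases lt_or_ge (X * q ^ j) (highCut M δ q) with h | h
  exacts [low j h, high j h ih]

lemma VN_lt_one (j : ℕ) : VN j < 1 := by
  refine H.grid_induction (X := X) (T := fun j => VN j < 1) (fun j hj => ?_)
    (fun j hj ih => ?_) j
  · rw [(hC.low j hj).1]
    exact ((H.low_le hX hL hj).trans_lt hj).trans H.highCut_lt_one
  · rw [hC.normal j hj]
    have := ih (j + (M + 1)) (by omega)
    nlinarith [H.δ_pos]

lemma VP_lt_one (j : ℕ) : VP j < 1 := by
  refine H.grid_induction (X := X) (T := fun j => VP j < 1) (fun j hj => ?_)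
    (fun j hj ih => ?_) j
  · rw [(hC.low j hj).2]
    exact ((H.low_le hX hL hj).trans_lt hj).trans H.highCut_lt_one
  · rcases le_or_gt (X * q ^ j) top with h | h
    · rw [hC.punish j hj h]
      have := ih (j + 1) (by omega)
      nlinarith [H.δ_pos]
    · rw [hC.top j hj h]
      exact H.VN_lt_one hX hL hC j

lemma VN_nonneg (j : ℕ) : 0 ≤ VN j := by
  refine H.grid_induction (X := X) (T := fun j => 0 ≤ VN j) (fun j hj => ?_)
    (fun j hj ih => ?_) j
  · rw [(hC.low j hj).1]
    rcases le_or_gt (X * q ^ j) (lowCut δ q) with h | h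
    · rw [hL.below j h]; exact (H.grid_pos hX j).le
    · exact le_trans (mul_pos H.lowCut_pos (pow_pos H.q_pos _)).le (hL.mixing j h hj).ge
  · rw [hC.normal j hj]
    have := ih (j + (M + 1)) (by omega)
    nlinarith [H.δ_pos, H.δ_lt]

lemma VP_anti {j : ℕ} (ht : X * q ^ j ≤ top) : VP (j + 1) ≤ VP j := by
  rcases lt_or_ge (X * q ^ j) (highCut M δ q) with hj | hj
  · have h1 : X * q ^ (j + 1) ≤ X * q ^ j := H.grid_anti hX (by omega)
    rw [(hC.low j hj).2, (hC.low (j + 1) (h1.trans_lt hj)).2]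
    exact H.low_anti hX hL hj
  · rw [hC.punish j hj ht]
    nlinarith [H.VP_lt_one hX hL hC (j + 1), H.δ_lt]

lemma VP_anti_of_le {j k : ℕ} (ht : X * q ^ j ≤ top) (hk : j ≤ k) : VP k ≤ VP j := by
  induction k, hk using Nat.le_induction with
  | base => rfl
  | succ k hk ih => exact (H.VP_anti hX hL hC ((H.grid_anti hX hk).trans ht)).trans ih

/-- Giving up forever costs the current odds, and above `lowCut` one more lone experiment is
worthwhile. This is what keeps the return probability of the punishment mode nonnegative. -/
lemma VP_le {j : ℕ} (ht : X * q ^ j ≤ top) : VP j ≤ X * q ^ j := by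
  revert ht
  refine H.grid_induction (X := X) (T := fun j => X * q ^ j ≤ top → VP j ≤ X * q ^ j)
    (fun j hj _ => ?_) (fun j hj ih ht => ?_) j
  · rw [(hC.low j hj).2]
    exact H.low_le hX hL hj
  · rw [hC.punish j hj ht]
    have h1 := ih (j + 1) (by omega) ((H.grid_anti hX (by omega)).trans ht)
    have h2 := H.lowCut_le_highCut.trans hj
    have h3 : lowCut δ q * (1 - δ * q) ≤ X * q ^ j * (1 - δ * q) :=
      mul_le_mul_of_nonneg_right h2 (by linarith [H.δq_lt])
    rw [H.lowCut_eq] at h3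
    rw [pow_succ] at h1
    have h4 := mul_le_mul_of_nonneg_left h1 H.δ_pos.le
    linarith

/-- A period costs `1 - δ` in either recursion, but it advances by `M + 1` failures in the normal
mode and by one in the punishment mode, and `VP` decreases along the grid below `top`. -/
lemma VN_le_VP (j : ℕ) : VN j ≤ VP j := by
  refine H.grid_induction (X := X) (T := fun j => VN j ≤ VP j) (fun j hj => ?_)
    (fun j hj ih => ?_) j
  · rw [(hC.low j hj).1, (hC.low j hj).2]
  · rcases le_or_gt (X * q ^ j) top with h | h
    · rw [hC.punish j hj h, hC.normal j hj]
      have h1 := ih (j + (M + 1)) (by omega)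
      have h2 := H.VP_anti_of_le hX hL hC (j := j + 1) (k := j + (M + 1))
        ((H.grid_anti hX (by omega)).trans h) (by omega)
      nlinarith [H.δ_pos]
    · rw [hC.top j hj h]

/-- Approximate monotonicity. The error stems from the step across the upper cutoff, where all the
odds involved lie in a range of width of order `(M + 1) * (1 - q)`; the recursion hands it on with a
factor `δ`. -/
lemma VN_drop (j : ℕ) : VN (j + 1) ≤ VN j + 4 * (M + 1) * (1 - q) := by
  have hs : 0 ≤ 4 * (M + 1) * (1 - q) := mul_nonneg (by positivity) (by linarith [H.q_lt])
  refine H.grid_induction (X := X) (T := fun j => VN (j + 1) ≤ VN j + 4 * (M + 1) * (1 - q))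
    (fun j hj => ?_) (fun j hj ih => ?_) j
  · have h1 : X * q ^ (j + 1) ≤ X * q ^ j := H.grid_anti hX (by omega)
    rw [(hC.low j hj).1, (hC.low (j + 1) (h1.trans_lt hj)).1]
    linarith [H.low_anti hX hL hj]
  · rcases lt_or_ge (X * q ^ (j + 1)) (highCut M δ q) with h | h
    · have h1 : X * q ^ (j + (M + 1)) ≤ X * q ^ (j + 1) := H.grid_anti hX (by omega)
      have h2 := H.grid_ge (H.lowCut_le_highCut.trans hj) (le_refl (M + 1))
      have h3 := H.low_ge hX hL (h1.trans_lt h) h2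
      have h4 := H.low_le hX hL h
      rw [← (hC.low _ h).1] at h4
      rw [← (hC.low _ (h1.trans_lt h)).1] at h3
      have h5 : VN (j + (M + 1)) ≤ VN j := by
        rw [hC.normal j hj]
        nlinarith [H.VN_lt_one hX hL hC (j + (M + 1)), H.δ_lt]
      have h6 := H.highCut_mul_pow_le
      have h7 := H.pow_ge M (by omega)
      have h8 := H.one_sub_pow_le (M + (M + 1))
      rw [pow_add] at h8
      push_cast at h8
      have hc1 := H.lowCut_lt_one
      have hc0 := H.lowCut_pos
      have hqM := pow_pos H.q_pos (M + 1)
      set d := highCut M δ q - lowCut δ q * q ^ (M + 1) with hd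
      have hd0 : 0 ≤ d := by
        have := H.lowCut_le_highCut
        have := H.pow_le_one (M + 1)
        nlinarith
      have h9 : d * q ^ M ≤ (M + (M + 1)) * (1 - q) := by
        have : lowCut δ q * (1 - q ^ M * q ^ (M + 1)) ≤ 1 * ((M + (M + 1)) * (1 - q)) := by
          have : 0 ≤ 1 - q ^ M * q ^ (M + 1) := by
            rw [← pow_add]; linarith [H.pow_le_one (M + (M + 1))]
          gcongr
        rw [hd]
        nlinarith
      have h10 : d * (7 / 8) ≤ d * q ^ M := mul_le_mul_of_nonneg_left h7 hd0
      have h11 : (0 : ℝ) ≤ M * (1 - q) := mul_nonneg (by positivity) (by linarith [H.q_lt])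
      have h12 := H.q_lt
      linarith
    · rw [hC.normal j hj, hC.normal (j + 1) h]
      have h1 := ih (j + (M + 1)) (by omega)
      rw [show j + (M + 1) + 1 = j + 1 + (M + 1) by ring] at h1
      have h2 := mul_le_mul_of_nonneg_left h1 H.δ_pos.le
      have h3 : δ * (4 * (M + 1) * (1 - q)) ≤ 4 * (M + 1) * (1 - q) :=
        mul_le_of_le_one_left hs H.δ_lt.le
      linarith

/-- In the normal mode, using the risky arm is optimal. -/
lemma normal_optimal (htop : 4 * (M + 1) * (1 - q) ≤ (1 - δ) * (top - 1)) {j : ℕ}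
    (hj : highCut M δ q ≤ X * q ^ j) :
    (1 - δ) + δ * VN (j + (M + 1)) ≤ (1 - δ) * (X * q ^ j) + δ * VP (j + M) := by
  have hδ := H.δ_pos
  have hδ1 := H.δ_lt
  -- Above `top` the myopic loss from the safe arm exceeds the error in `VN_drop`, so no punishment
  -- is needed.
  rcases lt_or_ge top (X * q ^ j) with ht | ht
  · have h1 := H.VN_drop hX hL hC (j + M)
    have h2 := H.VN_le_VP hX hL hC (j + M)
    have h3 : δ * VN (j + (M + 1)) ≤ δ * (VP (j + M) + 4 * (M + 1) * (1 - q)) := by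
      rw [← add_assoc]
      gcongr
      linarith
    have hs : 0 ≤ 4 * (M + 1) * (1 - q) := mul_nonneg (by positivity) (by linarith [H.q_lt])
    have h4 : δ * (4 * (M + 1) * (1 - q)) ≤ 4 * (M + 1) * (1 - q) :=
      mul_le_of_le_one_left hs hδ1.le
    have h5 : (1 - δ) * (top - 1) ≤ (1 - δ) * (X * q ^ j - 1) :=
      mul_le_mul_of_nonneg_left (by linarith) (by linarith)
    linarith
  · have hyx : X * q ^ (j + M) ≤ X * q ^ j := H.grid_anti hX (by omega)
    have hNP : VN (j + (M + 1)) ≤ VP (j + M + 1) := by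
      rw [← add_assoc]; exact H.VN_le_VP hX hL hC _
    have hNP' := mul_le_mul_of_nonneg_left hNP hδ.le
    -- Where do `M` failures lead? If below `lowCut`, the claim is the definition of `highCut`; if
    -- to the mixing region, it is `slack`; if to odds still above `highCut`, the punishment
    -- recursion and `VP_le` give it.
    rcases lt_or_ge (X * q ^ (j + M)) (highCut M δ q) with h | h
    · have h' : X * q ^ (j + M + 1) < highCut M δ q := (H.grid_anti hX (by omega)).trans_lt h
      rw [(hC.low _ h').2] at hNP'
      rw [(hC.low _ h).2]
      rcases le_or_gt (X * q ^ (j + M)) (lowCut δ q) with h2 | h2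
      · rw [hL.below _ h2]
        rw [hL.below _ ((H.grid_anti hX (by omega)).trans h2)] at hNP'
        have h3 : highCut M δ q * (1 - δ + δ * q ^ M * (1 - q))
          ≤ X * q ^ j * (1 - δ + δ * q ^ M * (1 - q)) :=
          mul_le_mul_of_nonneg_right hj H.highDen_pos.le
        rw [H.highCut_eq] at h3
        have e1 : X * q ^ (j + M) = X * q ^ j * q ^ M := by ring
        have e2 : X * q ^ (j + M + 1) = X * q ^ j * q ^ M * q := by ring
        rw [e2] at hNP'
        rw [e1]
        linarith
      · have := (hL.mixing _ h2 h).slack (X * q ^ j) (by ring)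
        linarith
    · have ht' : X * q ^ (j + M) ≤ top := hyx.trans ht
      have h1 := H.VP_le hX hL hC ht'
      have h2 := hC.punish _ h ht'
      have h3 : (1 - δ) * VP (j + M) ≤ (1 - δ) * (X * q ^ j) :=
        mul_le_mul_of_nonneg_left (h1.trans hyx) (by linarith)
      linarith

/-- As `M ≥ 1`, a normal period brings at least two failures, one more than a lone experiment. -/
lemma normal_le_punish_aux {j : ℕ} (hj : highCut M δ q ≤ X * q ^ j) (ht : X * q ^ j ≤ top) :
    VN j ≤ (1 - δ) + δ * VP (j + 1 + 1) := by
  rw [hC.normal j hj]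
  have h1 := H.VN_le_VP hX hL hC (j + (M + 1))
  have hM := H.one_le
  have h2 := H.VP_anti_of_le hX hL hC (j := j + 1 + 1) (k := j + (M + 1))
    ((H.grid_anti hX (by omega)).trans ht) (by omega)
  have := mul_le_mul_of_nonneg_left (h1.trans h2) H.δ_pos.le
  linarith

/-- Below the myopic cutoff, a reward for using the safe arm suffices for punishments. -/
lemma punish_feasible_of_le_one {j : ℕ} (hj : highCut M δ q ≤ X * q ^ j) (ht : X * q ^ j ≤ top)
    (hx1 : X * q ^ j ≤ 1) : (1 - δ) * (X * q ^ j) + δ * VN j ≤ VP j := by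
  have hδ := H.δ_pos
  have hδ1 := H.δ_lt
  have hN := H.normal_le_punish_aux hX hL hC hj ht
  have ht1 : X * q ^ (j + 1) ≤ top := (H.grid_anti hX (by omega)).trans ht
  rw [hC.punish j hj ht]
  rcases lt_or_ge (X * q ^ (j + 1)) (highCut M δ q) with h | h
  · have h2 : X * q ^ (j + 1 + 1) < highCut M δ q := (H.grid_anti hX (by omega)).trans_lt h
    rw [(hC.low _ h).2]
    rw [(hC.low _ h2).2] at hN
    have hM := H.one_le
    have hge1 := H.grid_ge (H.lowCut_le_highCut.trans hj) (show 1 ≤ M + 1 by omega)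
    have hge2 := H.grid_ge (H.lowCut_le_highCut.trans hj) (show 2 ≤ M + 1 by omega)
    have h3 := H.low_diff_ge hX hL h hge1
    have h4 := H.low_ge hX hL h2 hge2
    set c := lowCut δ q with hc
    have hc0 : 0 < c := H.lowCut_pos
    have hc1 : c < 1 := H.lowCut_lt_one
    have hε := H.pow_le
    have hεu : 1 - q ^ (M + 1) ≤ (M + 1) * (1 - q) := by
      have := H.one_sub_pow_le (M + 1); push_cast at this; linarith
    have hgap := H.cut_gap
    rw [← hc] at hgap
    have hind : (1 - δ) * (1 - c) = δ * (c * (1 - q)) := H.lowCut_indiff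
    -- `x ≤ c + 4 (M + 1) (1 - q)`
    have hx : X * q ^ j * q ^ (M + 1) ≤ c := by
      calc X * q ^ j * q ^ (M + 1) = X * q ^ (j + 1) * q ^ M := by ring
        _ ≤ highCut M δ q * q ^ M :=
          mul_le_mul_of_nonneg_right h.le (pow_pos H.q_pos M).le
        _ ≤ c := H.highCut_mul_pow_le
    have hx' : X * q ^ j - c ≤ 1 - q ^ (M + 1) := by
      have h0 : 0 ≤ 1 - q ^ (M + 1) := by linarith [H.pow_le_one (M + 1)]
      have := mul_le_mul_of_nonneg_right hx1 h0
      linarith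
    have hcq : c - c * q ^ (M + 1) ≤ 1 - q ^ (M + 1) := by
      have h0 : 0 ≤ 1 - q ^ (M + 1) := by linarith [H.pow_le_one (M + 1)]
      have := mul_le_mul_of_nonneg_right hc1.le h0
      linarith
    -- reduce to `φ` differences
    have h5 : (1 - δ) * (1 - φ (j + 1 + 1)) ≤ (1 - δ) * (1 - c * q ^ (M + 1)) :=
      mul_le_mul_of_nonneg_left (by linarith) (by linarith)
    have h6 : δ * (φ (j + 1) - φ (j + 1 + 1)) ≥ (1 - δ) * (1 - c) * (1 - 4 * (1 - q ^ (M + 1))) := by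
      have := mul_le_mul_of_nonneg_left h3 hδ.le
      calc (1 - δ) * (1 - c) * (1 - 4 * (1 - q ^ (M + 1)))
          = δ * (c * (1 - q) * (1 - 4 * (1 - q ^ (M + 1)))) := by rw [hind]; ring
        _ ≤ _ := this
    -- Up to multiples of `1 - q ^ (M + 1)`, the left side is `1 - c` and the right side is `2 * (1
    -- - c)`; by `cut_gap`, the spare `1 - c` is at least eight times that error.
    have h7 : 1 - c * q ^ (M + 1) ≤ (1 - c) * (1 - 4 * (1 - q ^ (M + 1))) + (1 - X * q ^ j) := by
      have h0 : 0 ≤ 1 - q ^ (M + 1) := by linarith [H.pow_le_one (M + 1)]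
      nlinarith
    have h8 := mul_le_mul_of_nonneg_left h7 (show 0 ≤ 1 - δ by linarith)
    have h9 := mul_le_mul_of_nonneg_left hN hδ.le
    have h10 : δ * ((1 - δ) * (1 - φ (j + 1 + 1))) ≤ (1 - δ) * (1 - φ (j + 1 + 1)) := by
      have : φ (j + 1 + 1) < 1 := by
        rw [← (hC.low _ h2).2]; exact H.VP_lt_one hX hL hC _
      exact mul_le_of_le_one_left (mul_nonneg (by linarith) (by linarith)) hδ1.le
    nlinarith
  · rw [← hC.punish (j + 1) h ht1] at hN
    have h1 := mul_le_mul_of_nonneg_left hN hδ.le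
    have h2 : (1 - δ) * (X * q ^ j) ≤ (1 - δ) * 1 := mul_le_mul_of_nonneg_left hx1 (by linarith)
    linarith

/-- `1 - VN` loses a factor `δ` per `M + 1` failures, whereas `1 - VP` loses a factor `δ` per single
failure, hence at least `δ ^ 2` over the same stretch. Each of the `m` normal periods thus widens
the gap by a factor `δ`. -/
lemma normal_gap (m : ℕ) {j : ℕ} (hj : highCut M δ q ≤ X * q ^ (j + (M + 1) * m))
    (ht : X * q ^ j ≤ top) : 1 - VP j ≤ δ ^ m * (1 - VN j) := by
  induction m generalizing j with
  | zero =>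
    have := H.VN_le_VP hX hL hC j
    simp only [pow_zero, one_mul]
    linarith
  | succ m ih =>
    have hjj : highCut M δ q ≤ X * q ^ j := hj.trans (H.grid_anti hX (by omega))
    have h1 := ih (j := j + (M + 1)) (by convert hj using 3; ring)
      ((H.grid_anti hX (by omega)).trans ht)
    have hstep : ∀ k ≤ M + 1, 1 - VP j ≤ δ ^ k * (1 - VP (j + k)) := by
      intro k
      induction k with
      | zero => simp
      | succ k ihk =>
        intro hk
        have h2 := ihk (by omega)
        have h3 : highCut M δ q ≤ X * q ^ (j + k) := hj.trans (H.grid_anti hX (by nlinarith))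
        rw [hC.punish (j + k) h3 ((H.grid_anti hX (by omega)).trans ht)] at h2
        rw [pow_succ, ← add_assoc]
        linarith
    have h2 := hstep (M + 1) le_rfl
    have hM := H.one_le
    have h3 : δ ^ (M + 1) ≤ δ ^ 2 := pow_le_pow_of_le_one H.δ_pos.le H.δ_lt.le (by omega)
    have h4 : 0 ≤ 1 - VP (j + (M + 1)) := by linarith [H.VP_lt_one hX hL hC (j + (M + 1))]
    calc 1 - VP j ≤ δ ^ 2 * (1 - VP (j + (M + 1))) :=
          h2.trans (mul_le_mul_of_nonneg_right h3 h4)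
      _ ≤ δ ^ 2 * (δ ^ m * (1 - VN (j + (M + 1)))) :=
          mul_le_mul_of_nonneg_left h1 (sq_nonneg δ)
      _ = δ ^ (m + 1) * (1 - VN j) := by rw [hC.normal j hjj]; ring

/-- Lower bound on the benefit of punishments relative to the myopic cost. -/
lemma one_sub_VP_ge {μ : ℝ} (hμ : 0 ≤ μ) (hqμ : q ^ μ = δ) {j : ℕ}
    (hj : highCut M δ q ≤ X * q ^ j) (ht : X * q ^ j ≤ top) :
    δ * (1 - highCut M δ q) * highCut M δ q ^ μ ≤ (1 - VP j) * top ^ μ := by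
  -- One failure earlier, `1 - VP` is multiplied by `δ` and the odds to the power `μ` are divided by
  -- `q ^ μ = δ`. Their product is constant along the grid, so it suffices to bound it at the last
  -- point above `highCut`.
  have key : highCut M δ q ≤ X * q ^ j → X * q ^ j ≤ top →
      δ * (1 - highCut M δ q) * highCut M δ q ^ μ ≤ (1 - VP j) * (X * q ^ j) ^ μ := by
    refine H.grid_induction (X := X) (T := fun j => highCut M δ q ≤ X * q ^ j → X * q ^ j ≤ top →
      δ * (1 - highCut M δ q) * highCut M δ q ^ μ ≤ (1 - VP j) * (X * q ^ j) ^ μ)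
      (fun j hj hj' => absurd hj (not_lt.2 hj')) (fun j hj ih _ ht => ?_) j
    have ht' : X * q ^ (j + 1) ≤ top := (H.grid_anti hX (by omega)).trans ht
    rw [hC.punish j hj ht]
    rcases lt_or_ge (X * q ^ (j + 1)) (highCut M δ q) with h | h
    · have h1 := H.VP_le hX hL hC ht'
      have h2 : highCut M δ q ^ μ ≤ (X * q ^ j) ^ μ :=
        Real.rpow_le_rpow H.highCut_pos.le hj hμ
      have h3 : 0 ≤ highCut M δ q ^ μ := Real.rpow_nonneg H.highCut_pos.le _
      have h4 : δ * (1 - highCut M δ q) ≤ 1 - ((1 - δ) + δ * VP (j + 1)) := by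
        nlinarith [H.δ_pos]
      have h5 : 0 ≤ δ * (1 - highCut M δ q) :=
        mul_nonneg H.δ_pos.le (by linarith [H.highCut_lt_one])
      exact mul_le_mul h4 h2 h3 (h5.trans h4)
    · have h1 := ih (j + 1) (by omega) h ht'
      have h2 : (X * q ^ (j + 1)) ^ μ = (X * q ^ j) ^ μ * δ := by
        rw [pow_succ, ← mul_assoc, Real.mul_rpow (H.grid_pos hX j).le H.q_pos.le, hqμ]
      rw [h2] at h1
      linarith
  refine (key hj ht).trans (mul_le_mul_of_nonneg_left ?_ ?_)
  · exact Real.rpow_le_rpow (H.grid_pos hX j).le ht hμ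
  · linarith [H.VP_lt_one hX hL hC j]

/-- Above the myopic cutoff, the gap between the two modes makes punishments feasible. -/
lemma punish_feasible_of_one_le {κ : ℝ} {m : ℕ} (hm : highCut M δ q ≤ q ^ ((M + 1) * m))
    (hκ : δ ^ m * (κ + (1 - δ) * top) ≤ δ * κ) (hm1 : 1 ≤ m) {j : ℕ} (ht : X * q ^ j ≤ top) (hκj : κ ≤ 1 - VP j)
    (hx1 : 1 ≤ X * q ^ j) : (1 - δ) * (X * q ^ j) + δ * VN j ≤ VP j := by
  have hδ := H.δ_pos
  have hδ1 := H.δ_lt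
  -- `hm` counts rounds from odds `1`; with odds at least `1` the same number of rounds stays above
  -- `highCut`.
  have hg := H.normal_gap hX hL hC m (j := j) (by
    rw [pow_add, ← mul_assoc]
    nlinarith [pow_pos H.q_pos ((M + 1) * m)]) ht
  have hδm : 0 < δ ^ m := pow_pos hδ m
  have hδm' : δ ^ m ≤ δ := by
    calc δ ^ m ≤ δ ^ 1 := pow_le_pow_of_le_one hδ.le hδ1.le hm1
      _ = δ := pow_one δ
  have h1 : δ ^ m * ((1 - VP j) + (1 - δ) * (X * q ^ j)) ≤ δ * (δ ^ m * (1 - VN j)) := by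
    have h2 : δ ^ m * ((1 - δ) * (X * q ^ j)) ≤ δ ^ m * ((1 - δ) * top) := by
      have : 0 ≤ 1 - δ := by linarith
      gcongr
    have h3 : (δ - δ ^ m) * κ ≤ (δ - δ ^ m) * (1 - VP j) :=
      mul_le_mul_of_nonneg_left hκj (by linarith)
    have h4 := mul_le_mul_of_nonneg_left hg hδ.le
    linarith
  have h5 : (1 - VP j) + (1 - δ) * (X * q ^ j) ≤ δ * (1 - VN j) := by
    refine le_of_mul_le_mul_left ?_ hδm
    linarith
  linarith

/-- The punishment costs at least as much as relying on opponents who experiment at low and high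
beliefs. -/
lemma free_riding_le {xmin xlow xhigh : ℝ} (hmin : xmin ≤ lowCut δ q)
    (hlow : highCut M δ q ≤ xlow) (hlow1 : xlow ≤ 1) (hlh : xlow < xhigh) (hhigh : xhigh ≤ top)
    {j : ℕ} (hj : X * q ^ j ≤ xhigh) :
    (if xlow < X * q ^ j then (1 - δ) else (1 - δ) * (X * q ^ j)) +
      δ * VP (j + ((if xmin ≤ X * q ^ j ∧ X * q ^ j ≤ xlow ∨ xhigh ≤ X * q ^ j then M else 0) +
        if xlow < X * q ^ j then 1 else 0)) ≤ VP j := by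
  have hδ := H.δ_pos
  have hδ1 := H.δ_lt
  have ht : X * q ^ j ≤ top := hj.trans hhigh
  have anti : ∀ k, VP (j + k) ≤ VP j := fun k => H.VP_anti_of_le hX hL hC ht (by omega)
  -- Above `xlow` the player experiments, which alone already gives the recursion of `VP`;
  -- experiments by the opponents only help.
  rcases lt_or_ge xlow (X * q ^ j) with h1 | h1
  · have hh := hlow.trans h1.le
    rw [if_pos h1, if_pos h1]
    have h2 := H.VP_anti_of_le hX hL hC (j := j + 1)
      (k := j + ((if xmin ≤ X * q ^ j ∧ X * q ^ j ≤ xlow ∨ xhigh ≤ X * q ^ j then M else 0) + 1))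
      ((H.grid_anti hX (by omega)).trans ht) (by omega)
    have h3 := mul_le_mul_of_nonneg_left h2 hδ.le
    rw [hC.punish j hh ht]
    linarith
  · rw [if_neg (not_lt.2 h1), if_neg (not_lt.2 h1), add_zero]
    have hnh : ¬ xhigh ≤ X * q ^ j := not_le.2 (h1.trans_lt hlh)
    rcases le_or_gt xmin (X * q ^ j) with h2 | h2
    · rw [if_pos (Or.inl ⟨h2, h1⟩)]
      rcases lt_or_ge (X * q ^ j) (highCut M δ q) with hh | hh
      · rcases le_or_gt (X * q ^ j) (lowCut δ q) with hl | hl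
        · have e1 := (hC.low j hh).2
          rw [hL.below j hl] at e1
          have := mul_le_mul_of_nonneg_left (anti M) hδ.le
          rw [e1] at this ⊢
          linarith
        · have hmix := hL.mixing j hl hh
          have hVP : ∀ k, VP (j + k) = φ (j + k) := fun k =>
            (hC.low _ ((H.grid_anti hX (by omega)).trans_lt hh)).2
          -- In the mixing region the player plays safe against `M` certain experiments, which is
          -- better than against the random number of at most `M` experiments that leaves the safe
          -- cost at `φ j`.
          have h3 : bexp M (π j) (fun _ => φ (j + M)) ≤ bexp M (π j) fun k => φ (j + k) := by
            refine bexp_mono hmix.nonneg hmix.le_one fun k hk => ?_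
            rw [← hVP, ← hVP]
            exact H.VP_anti_of_le hX hL hC ((H.grid_anti hX (by omega)).trans ht) (by omega)
          rw [bexp_const] at h3
          rw [hVP M, (hC.low j hh).2]
          have h4 := hmix.safe
          have := mul_le_mul_of_nonneg_left h3 hδ.le
          linarith
      · have hM := H.one_le
        have h3 := H.VP_anti_of_le hX hL hC (j := j + 1) (k := j + M)
          ((H.grid_anti hX (by omega)).trans ht) (by omega)
        rw [hC.punish j hh ht]
        have h4 := mul_le_mul_of_nonneg_left h3 hδ.le
        have h5 : (1 - δ) * (X * q ^ j) ≤ (1 - δ) * 1 :=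
          mul_le_mul_of_nonneg_left (h1.trans hlow1) (by linarith)
        linarith
    · rw [if_neg (by rintro (h | h); exacts [not_le.2 h2 h.1, hnh h]), add_zero]
      have hl : X * q ^ j ≤ lowCut δ q := h2.le.trans hmin
      rcases lt_or_ge (X * q ^ j) (highCut M δ q) with hh | hh
      · have e1 := (hC.low j hh).2
        rw [hL.below j hl] at e1
        rw [e1]
        linarith
      · linarith [H.lowCut_le_highCut]

end Modes
end FinePeriod

/-! ### The equilibrium automaton. -/

/-- A symmetric two-mode automaton. After `j` failed experiments in mode `i`, every player uses the
risky arm with probability `mix i j`; if `k` players do so and none of them obtains a lump-sum, the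
next mode is `true` with probability `rew i j k`. -/
structure Automaton where
  mix : Bool → ℕ → unitInterval
  rew : Bool → ℕ → ℕ → unitInterval

namespace Automaton

/-- Expected continuation cost after `k` failed experiments. -/
noncomputable def cont (A : Automaton) (val : Bool → ℕ → ℝ) (i : Bool) (j k : ℕ) : ℝ :=
  A.rew i j k * val true (j + k) + (1 - A.rew i j k) * val false (j + k)

/-- Cost of using the safe arm once. -/
noncomputable def safeCost (A : Automaton) (M : ℕ) (δ q X : ℝ) (val : Bool → ℕ → ℝ) (i : Bool)
    (j : ℕ) : ℝ :=
  (1 - δ) * (X * q ^ j) + δ * bexp M (A.mix i j) (A.cont val i j)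

/-- Cost of using the risky arm once. -/
noncomputable def riskyCost (A : Automaton) (M : ℕ) (δ : ℝ) (val : Bool → ℕ → ℝ) (i : Bool)
    (j : ℕ) : ℝ :=
  (1 - δ) + δ * bexp M (A.mix i j) (fun k => A.cont val i j (k + 1))

/-- No player gains from a one-shot deviation, and `val` is the cost under the automaton. -/
structure IsEquilibrium (A : Automaton) (M : ℕ) (δ q X : ℝ) (val : Bool → ℕ → ℝ) : Prop where
  bdd : ∀ i j, 0 ≤ val i j ∧ val i j ≤ 1
  safe : ∀ i j, val i j ≤ A.safeCost M δ q X val i j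
  risky : ∀ i j, val i j ≤ A.riskyCost M δ val i j
  mixed : ∀ i j, (1 - A.mix i j) * A.safeCost M δ q X val i j
    + A.mix i j * A.riskyCost M δ val i j = val i j

lemma cont_of_eq (A : Automaton) {val : Bool → ℕ → ℝ} {i : Bool} {j k : ℕ} {v : ℝ}
    (h0 : val false (j + k) = v) (h1 : val true (j + k) = v) : A.cont val i j k = v := by
  unfold cont
  rw [h0, h1]
  ring

end Automaton

namespace FinePeriod

variable {M : ℕ} {δ q π₀ : ℝ} (H : FinePeriod M δ q π₀) {X top : ℝ}
include H

/-- Equilibrium of the cost game. -/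
lemma exists_equilibrium (hX : 0 < X) {μ κ : ℝ} {m : ℕ}
    (htop : 4 * (M + 1) * (1 - q) ≤ (1 - δ) * (top - 1)) (hμ : 0 ≤ μ) (hqμ : q ^ μ = δ)
    (hm : highCut M δ q ≤ q ^ ((M + 1) * m)) (hm1 : 1 ≤ m)
    (hκ : δ ^ m * (κ + (1 - δ) * top) ≤ δ * κ)
    (hκ' : κ * top ^ μ ≤ δ * (1 - highCut M δ q) * highCut M δ q ^ μ) :
    ∃ (A : Automaton) (val : Bool → ℕ → ℝ), A.IsEquilibrium M δ q X val ∧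
      (∀ i j, X * q ^ j ≤ lowCut δ q → A.mix i j = 0) ∧
      (∀ j, highCut M δ q ≤ X * q ^ j → A.mix true j = 1) ∧
      (∀ j, A.rew true j (M + 1) = 1) ∧
      ∀ xmin xlow xhigh : ℝ, xmin ≤ lowCut δ q → highCut M δ q ≤ xlow → xlow ≤ 1 →
        xlow < xhigh → xhigh ≤ top → X ≤ xhigh → ∀ j,
        (if xlow < X * q ^ j then (1 - δ) else (1 - δ) * (X * q ^ j)) + δ * val false (j +
          ((if xmin ≤ X * q ^ j ∧ X * q ^ j ≤ xlow ∨ xhigh ≤ X * q ^ j then M else 0) +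
            if xlow < X * q ^ j then 1 else 0)) ≤ val false j := by
  classical
  obtain ⟨φ, π, hL⟩ := H.exists_lowCost hX
  obtain ⟨VN, VP, hC⟩ := H.exists_modeCost (X := X) top φ
  have hδ := H.δ_pos
  have hδ1 := H.δ_lt
  have htop1 : 1 < top := by
    have h1 : 0 < 4 * ((M : ℝ) + 1) * (1 - q) := mul_pos (by positivity) (by linarith [H.q_lt])
    by_contra hcon
    have : (1 - δ) * (top - 1) ≤ 0 :=
      mul_nonpos_of_nonneg_of_nonpos (by linarith) (by linarith)
    linarith
  have hfeas : ∀ j, highCut M δ q ≤ X * q ^ j → X * q ^ j ≤ top →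
      (1 - δ) * (X * q ^ j) + δ * VN j ≤ VP j := by
    intro j hj ht
    rcases le_total (X * q ^ j) 1 with h | h
    · exact H.punish_feasible_of_le_one hX hL hC hj ht h
    · refine H.punish_feasible_of_one_le hX hL hC hm hκ hm1 ht ?_ h
      have h1 := H.one_sub_VP_ge hX hL hC hμ hqμ hj ht
      exact le_of_mul_le_mul_right (hκ'.trans h1) (Real.rpow_pos_of_pos (by linarith) μ)
  -- The return probability equates the safe cost with `VP j`. At `η = 1` the safe cost is too low
  -- by `hfeas`, at `η = 0` it is too high by `VP_le`.
  have hη : ∀ j, ∃ η : unitInterval, highCut M δ q ≤ X * q ^ j → X * q ^ j ≤ top →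
      (1 - δ) * (X * q ^ j) + δ * (η * VN j + (1 - η) * VP j) = VP j := by
    intro j
    by_cases hj : highCut M δ q ≤ X * q ^ j ∧ X * q ^ j ≤ top
    · obtain ⟨hj, ht⟩ := hj
      have h1 := hfeas j hj ht
      have h2 := H.VP_le hX hL hC ht
      have hcont : ContinuousOn
          (fun η : ℝ => (1 - δ) * (X * q ^ j) + δ * (η * VN j + (1 - η) * VP j))
          (Set.Icc 0 1) := by fun_prop
      have h3 := intermediate_value_Icc' zero_le_one hcont
      obtain ⟨η, hη, hη'⟩ := h3 (show VP j ∈ _ by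
        constructor
        · simpa using h1
        · have := mul_le_mul_of_nonneg_left h2 (show 0 ≤ 1 - δ by linarith)
          simp only [zero_mul, sub_zero, one_mul, zero_add]
          linarith)
      exact ⟨⟨η, hη⟩, fun _ _ => hη'⟩
    · exact ⟨0, fun h h' => absurd ⟨h, h'⟩ hj⟩
  choose η hη using hη
  have hπ : ∀ j, ∃ p : unitInterval, lowCut δ q < X * q ^ j → X * q ^ j < highCut M δ q →
      (p : ℝ) = π j := by
    intro j
    by_cases hj : lowCut δ q < X * q ^ j ∧ X * q ^ j < highCut M δ q
    · have := hL.mixing j hj.1 hj.2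
      exact ⟨⟨π j, this.nonneg, this.le_one⟩, fun _ _ => rfl⟩
    · exact ⟨0, fun h h' => absurd ⟨h, h'⟩ hj⟩
  choose p hp using hπ
  -- `rew` is the probability of the normal mode. Punishment ends only after unanimous safe play (`k
  -- = 0`), and elsewhere only unanimous risky play (`k = M + 1`) leads to the normal mode. Below
  -- `highCut` both modes have the same costs, so transitions there do not matter.
  set A : Automaton :=
    { mix := fun i j => if X * q ^ j ≤ lowCut δ q then 0 else
        if X * q ^ j < highCut M δ q then p j else
        if i = false ∧ X * q ^ j ≤ top then 0 else 1
      rew := fun i j k => if i = false ∧ X * q ^ j ≤ top then (if k = 0 then η j else 0) else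
        if k = M + 1 then 1 else 0 } with hA
  set val : Bool → ℕ → ℝ := fun i j => if i = true then VN j else VP j with hval
  have vT : ∀ j, val true j = VN j := fun j => rfl
  have vF : ∀ j, val false j = VP j := fun j => rfl
  have hce := H.lowCut_le_highCut
  have lowval : ∀ i j, X * q ^ j < highCut M δ q → val i j = φ j := by
    intro i j hj
    cases i
    · exact (hC.low j hj).2
    · exact (hC.low j hj).1
  have lowcont : ∀ i j, X * q ^ j < highCut M δ q → ∀ k, A.cont val i j k = φ (j + k) :=
    fun i j hj k => A.cont_of_eq
      (lowval _ _ ((H.grid_anti hX (by omega)).trans_lt hj))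
      (lowval _ _ ((H.grid_anti hX (by omega)).trans_lt hj))
  have key : ∀ i j, val i j ≤ A.safeCost M δ q X val i j ∧ val i j ≤ A.riskyCost M δ val i j ∧
      (1 - A.mix i j) * A.safeCost M δ q X val i j + A.mix i j * A.riskyCost M δ val i j
        = val i j := by
    intro i j
    rcases lt_or_ge (X * q ^ j) (highCut M δ q) with hj | hj
    · rcases le_or_gt (X * q ^ j) (lowCut δ q) with hl | hl
      · have hmix : A.mix i j = 0 := by simp only [hA, if_pos hl]
        have h1 : A.safeCost M δ q X val i j = val i j := by
          rw [Automaton.safeCost, hmix, Set.Icc.coe_zero, bexp_zero, lowcont i j hj, add_zero,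
            lowval i j hj, hL.below j hl]
          ring
        have h2 : val i j ≤ A.riskyCost M δ val i j := by
          have e1 := hL.below (j + 1) ((H.grid_anti hX (by omega)).trans hl)
          rw [Automaton.riskyCost, hmix, Set.Icc.coe_zero, bexp_zero, lowcont i j hj, zero_add,
            lowval i j hj, hL.below j hl, e1, pow_succ]
          have h3 : X * q ^ j * (1 - δ * q) ≤ lowCut δ q * (1 - δ * q) :=
            mul_le_mul_of_nonneg_right hl (by linarith [H.δq_lt])
          rw [H.lowCut_eq] at h3
          linarith
        refine ⟨h1.ge, h2, ?_⟩
        rw [hmix, h1]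
        simp
      · have hm := hL.mixing j hl hj
        have hmix : (A.mix i j : ℝ) = π j := by
          simp only [hA, if_neg (not_le.2 hl), if_pos hj, hp j hl hj]
        have h1 : A.safeCost M δ q X val i j = val i j := by
          rw [Automaton.safeCost, hmix, lowval i j hj,
            show A.cont val i j = fun k => φ (j + k) from funext (lowcont i j hj), ← hm.safe]
        have h2 : A.riskyCost M δ val i j = val i j := by
          rw [Automaton.riskyCost, hmix, lowval i j hj]
          simp only [lowcont i j hj]
          exact hm.risky.symm
        refine ⟨h1.ge, h2.ge, ?_⟩
        rw [h1, h2]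
        ring
    · have hl : ¬ X * q ^ j ≤ lowCut δ q := not_le.2 (H.lowCut_lt_highCut.trans_le hj)
      by_cases hi : i = false ∧ X * q ^ j ≤ top
      · have hmix : A.mix i j = 0 := by simp only [hA, if_neg hl, if_neg (not_lt.2 hj), if_pos hi]
        obtain ⟨rfl, ht⟩ := hi
        have h0 : A.cont val false j 0 = η j * VN j + (1 - η j) * VP j := by
          simp [Automaton.cont, hA, ht, vT, vF]
        have h1 : A.cont val false j 1 = VP (j + 1) := by
          simp [Automaton.cont, hA, ht, vF]
        have h2 : A.safeCost M δ q X val false j = val false j := by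
          rw [Automaton.safeCost, hmix, Set.Icc.coe_zero, bexp_zero, h0, vF, hη j hj ht]
        have h3 : A.riskyCost M δ val false j = val false j := by
          rw [Automaton.riskyCost, hmix, Set.Icc.coe_zero, bexp_zero, zero_add, h1, vF,
            hC.punish j hj ht]
        refine ⟨h2.ge, h3.ge, ?_⟩
        rw [hmix, h2]
        simp
      · have hmix : A.mix i j = 1 := by simp only [hA, if_neg hl, if_neg (not_lt.2 hj), if_neg hi]
        have hrew : ∀ k, A.rew i j k = if k = M + 1 then 1 else 0 := fun k => by
          simp only [hA, if_neg hi]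
        have hv : val i j = VN j := by
          cases i
          · rw [vF]
            exact hC.top j hj (not_le.1 fun h => hi ⟨rfl, h⟩)
          · rfl
        have h0 : A.cont val i j M = VP (j + M) := by
          simp [Automaton.cont, hrew, vF]
        have h1 : A.cont val i j (M + 1) = VN (j + (M + 1)) := by
          simp [Automaton.cont, hrew, vT]
        have h2 : A.riskyCost M δ val i j = val i j := by
          rw [Automaton.riskyCost, hmix, Set.Icc.coe_one, bexp_one, h1, hv, hC.normal j hj]
        refine ⟨?_, h2.ge, ?_⟩
        · rw [Automaton.safeCost, hmix, Set.Icc.coe_one, bexp_one, h0, hv, hC.normal j hj]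
          exact H.normal_optimal hX hL hC htop hj
        · rw [hmix, h2]
          simp
  refine ⟨A, val, ⟨fun i j => ?_, fun i j => (key i j).1, fun i j => (key i j).2.1,
    fun i j => (key i j).2.2⟩, fun i j hj => ?_, fun j hj => ?_, fun j => ?_, ?_⟩
  · cases i
    · exact ⟨(H.VN_nonneg hX hL hC j).trans (H.VN_le_VP hX hL hC j), (H.VP_lt_one hX hL hC j).le⟩
    · exact ⟨H.VN_nonneg hX hL hC j, (H.VN_lt_one hX hL hC j).le⟩
  · simp only [hA, if_pos hj]
  · simp [hA, not_le.2 (H.lowCut_lt_highCut.trans_le hj), not_lt.2 hj]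
  · simp [hA]
  · intro xmin xlow xhigh h1 h2 h3 h4 h5 h6 j
    refine H.free_riding_le hX hL hC h1 h2 h3 h4 h5 (le_trans ?_ h6)
    exact mul_le_of_le_one_right hX.le (H.pow_le_one j)

end FinePeriod

/-! ### Small period lengths. -/

lemma tendsto_one_sub_exp_div (a : ℝ) :
    Tendsto (fun Δ : ℝ => (1 - Real.exp (-a * Δ)) / Δ) (𝓝[>] 0) (𝓝 a) := by
  have h : HasDerivAt (fun Δ : ℝ => 1 - Real.exp (-a * Δ)) a 0 := by
    have := (((hasDerivAt_id (0 : ℝ)).const_mul (-a)).exp).const_sub 1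
    simpa using this
  have h2 := h.tendsto_slope
  have h3 : Tendsto (slope (fun Δ : ℝ => 1 - Real.exp (-a * Δ)) 0) (𝓝[>] 0) (𝓝 a) :=
    h2.mono_left (nhdsWithin_mono _ fun x hx => ne_of_gt hx)
  refine h3.congr fun Δ => ?_
  simp [slope_def_field]

lemma tendsto_exp_neg_mul (a : ℝ) :
    Tendsto (fun Δ : ℝ => Real.exp (-a * Δ)) (𝓝[>] 0) (𝓝 1) := by
  have : ContinuousAt (fun Δ : ℝ => Real.exp (-a * Δ)) 0 := by fun_prop
  have h := this.tendsto
  simp only [mul_zero, Real.exp_zero] at h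
  exact h.mono_left nhdsWithin_le_nhds

/-- The continuous-time cutoff bounds the single-agent cutoff in discrete time from below. -/
lemma le_lowCut {r l Δ : ℝ} (hr : 0 < r) (hl : 0 < l) (hΔ : 0 < Δ) :
    r / (r + l) ≤ lowCut (Real.exp (-r * Δ)) (Real.exp (-l * Δ)) := by
  have h1 : Real.exp (-r * Δ) < 1 := Real.exp_lt_one_iff.2 (by nlinarith)
  have h2 : Real.exp (-l * Δ) < 1 := Real.exp_lt_one_iff.2 (by nlinarith)
  have h3 := Real.exp_pos (-r * Δ)
  have h4 := Real.exp_pos (-l * Δ)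
  set δ := Real.exp (-r * Δ)
  set q := Real.exp (-l * Δ) with hq
  have h5 : 1 - q ≤ l * Δ := by
    have := Real.add_one_le_exp (-l * Δ); linarith
  have h6 : r * Δ * δ ≤ 1 - δ := by
    have h7 := Real.add_one_le_exp (r * Δ)
    have h8 : δ * Real.exp (r * Δ) = 1 := by rw [← Real.exp_add]; simp
    nlinarith
  have h9 : δ * q < 1 := by nlinarith
  rw [lowCut, div_le_div_iff₀ (by linarith) (by linarith)]
  have h10 : r * δ * (1 - q) ≤ l * (1 - δ) := by
    calc r * δ * (1 - q) ≤ r * δ * (l * Δ) := by gcongr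
      _ = l * (r * Δ * δ) := by ring
      _ ≤ _ := by gcongr
  nlinarith

section Limits

variable {r l : ℝ} (hr : 0 < r) (hl : 0 < l)
include hr hl

lemma tendsto_lowCut :
    Tendsto (fun Δ : ℝ => lowCut (Real.exp (-r * Δ)) (Real.exp (-l * Δ))) (𝓝[>] 0)
      (𝓝 (r / (r + l))) := by
  have h := (tendsto_one_sub_exp_div r).div (tendsto_one_sub_exp_div (r + l)) (by linarith)
  refine h.congr' ?_
  filter_upwards [self_mem_nhdsWithin] with Δ hΔ
  have hΔ' : Δ ≠ 0 := (ne_of_gt hΔ)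
  simp only [Pi.div_apply]
  rw [div_div_div_cancel_right₀ hΔ', lowCut, ← Real.exp_add]
  congr 3
  ring_nf

lemma tendsto_highCut (M : ℕ) :
    Tendsto (fun Δ : ℝ => highCut M (Real.exp (-r * Δ)) (Real.exp (-l * Δ))) (𝓝[>] 0)
      (𝓝 (r / (r + l))) := by
  have h0 := ((tendsto_exp_neg_mul r).mul ((tendsto_exp_neg_mul l).pow M)).mul
    (tendsto_one_sub_exp_div l)
  have h := (tendsto_one_sub_exp_div r).div ((tendsto_one_sub_exp_div r).add h0) (by simp; linarith)
  simp only [one_pow, one_mul] at h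
  refine h.congr' ?_
  filter_upwards [self_mem_nhdsWithin] with Δ hΔ
  have hΔ' : Δ ≠ 0 := (ne_of_gt hΔ)
  simp only [Pi.div_apply]
  rw [← mul_div_assoc, ← add_div, div_div_div_cancel_right₀ hΔ', highCut]

set_option maxHeartbeats 800000 in
/-- All smallness conditions hold if the period length is small. -/
lemma eventually_finePeriod {M : ℕ} (hM : 1 ≤ M) {xlow : ℝ} (hlow : r / (r + l) < xlow)
    (xhigh : ℝ) :
    ∃ π₀ top κ : ℝ, xhigh ≤ top ∧ ∀ᶠ Δ : ℝ in 𝓝[>] 0,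
      FinePeriod M (Real.exp (-r * Δ)) (Real.exp (-l * Δ)) π₀ ∧
      4 * (M + 1) * (1 - Real.exp (-l * Δ)) ≤ (1 - Real.exp (-r * Δ)) * (top - 1) ∧
      highCut M (Real.exp (-r * Δ)) (Real.exp (-l * Δ)) ≤ xlow ∧
      κ * top ^ (r / l) ≤ Real.exp (-r * Δ) *
        (1 - highCut M (Real.exp (-r * Δ)) (Real.exp (-l * Δ))) *
        highCut M (Real.exp (-r * Δ)) (Real.exp (-l * Δ)) ^ (r / l) ∧
      ∃ m : ℕ, 1 ≤ m ∧
        highCut M (Real.exp (-r * Δ)) (Real.exp (-l * Δ)) ≤ Real.exp (-l * Δ) ^ ((M + 1) * m) ∧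
        Real.exp (-r * Δ) ^ m * (κ + (1 - Real.exp (-r * Δ)) * top) ≤ Real.exp (-r * Δ) * κ := by
  have hMr : (1 : ℝ) ≤ M := by exact_mod_cast hM
  have hrl : 0 < r + l := by linarith
  set x := r / (r + l) with hx
  have hx0 : 0 < x := div_pos hr hrl
  have hx1 : x < 1 := by rw [hx, div_lt_one hrl]; linarith
  -- After division by `Δ`, `mixing` tends to `10 * (M + 1) * l * (M * π₀) ≤ r`; this choice makes
  -- the left side `r * l / (2 * (r + l))`.
  set π₀ := r / (20 * (M + 1) * M * (r + l)) with hπ₀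
  have hπ₀0 : 0 < π₀ := by positivity
  have hMπ : M * π₀ = r / (20 * (M + 1) * (r + l)) := by
    rw [hπ₀]; field_simp
  -- Large enough that `4 * (M + 1) * l < r * (top - 1)`, the limit form of the condition on `top`.
  set top := max xhigh (2 + 8 * (M + 1) * l / r) with htop
  have htop2 : 2 + 8 * (M + 1) * l / r ≤ top := le_max_right _ _
  have htop0 : 0 < top := lt_of_lt_of_le (by positivity) htop2
  have htμ : 0 < top ^ (r / l) := Real.rpow_pos_of_pos htop0 _
  have hxμ : 0 < x ^ (r / l) := Real.rpow_pos_of_pos hx0 _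
  -- Half the limiting lower bound for `1 - VP` provided by `one_sub_VP_ge`.
  set κ := (1 - x) * x ^ (r / l) / (2 * top ^ (r / l)) with hκ
  have hκ0 : 0 < κ := div_pos (mul_pos (by linarith) hxμ) (by positivity)
  -- Real time in which failures of all `M + 1` players reduce the odds from `1` to `(1 + x) / 2`,
  -- midway between `1` and the limit `x` of the upper cutoff. The number of rounds will be `⌊τ /
  -- Δ⌋₊`.
  set τ := -Real.log ((1 + x) / 2) / (l * (M + 1)) with hτ
  have hτ0 : 0 < τ := by
    refine div_pos (neg_pos.2 (Real.log_neg (by linarith) (by linarith))) (by positivity)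
  have hexpτ : Real.exp (-(l * (M + 1)) * τ) = (1 + x) / 2 := by
    rw [hτ, show -(l * (M + 1)) * (-Real.log ((1 + x) / 2) / (l * (M + 1)))
      = Real.log ((1 + x) / 2) by field_simp, Real.exp_log (by linarith)]
  refine ⟨π₀, top, κ, le_max_left _ _, ?_⟩
  have tδ := tendsto_exp_neg_mul r
  have tq := tendsto_exp_neg_mul l
  have tr := tendsto_one_sub_exp_div r
  have tl := tendsto_one_sub_exp_div l
  have tc := tendsto_lowCut hr hl
  have te := tendsto_highCut hr hl M
  rw [← hx] at tc te
  have pos : ∀ᶠ Δ : ℝ in 𝓝[>] 0, 0 < Δ := self_mem_nhdsWithin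
  have e1 : ∀ᶠ Δ : ℝ in 𝓝[>] 0, 1 - Real.exp (-l * Δ) ^ (M + 1) < 1 / 8 := by
    have := (tq.pow (M + 1)).const_sub 1
    exact this.eventually_lt_const (by norm_num)
  have e2 : ∀ᶠ Δ : ℝ in 𝓝[>] 0, 10 * (M + 1) * ((1 - Real.exp (-l * Δ)) / Δ) * (M * π₀)
      < (1 - Real.exp (-r * Δ)) / Δ := by
    refine ((tl.const_mul (10 * ((M : ℝ) + 1))).mul_const (M * π₀)).eventually_lt tr ?_
    rw [hMπ, show 10 * ((M : ℝ) + 1) * l * (r / (20 * (M + 1) * (r + l)))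
      = r * (l / (2 * (r + l))) by field_simp; ring]
    have : l / (2 * (r + l)) < 1 := by rw [div_lt_one (by positivity)]; linarith
    exact mul_lt_of_lt_one_right hr this
  have e3 : ∀ᶠ Δ : ℝ in 𝓝[>] 0, 8 * (M + 1) * (1 - Real.exp (-r * Δ))
      < Real.exp (-r * Δ) ^ 2 * π₀ := by
    refine ((tδ.const_sub 1).const_mul (8 * ((M : ℝ) + 1))).eventually_lt
      ((tδ.pow 2).mul_const π₀) ?_
    simpa using hπ₀0
  have e4 : ∀ᶠ Δ : ℝ in 𝓝[>] 0, 8 * (M + 1) * (1 - Real.exp (-l * Δ))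
      < 1 - lowCut (Real.exp (-r * Δ)) (Real.exp (-l * Δ)) := by
    refine ((tq.const_sub 1).const_mul (8 * ((M : ℝ) + 1))).eventually_lt (tc.const_sub 1) ?_
    simpa using hx1
  have e5 : ∀ᶠ Δ : ℝ in 𝓝[>] 0, 4 * (M + 1) * ((1 - Real.exp (-l * Δ)) / Δ)
      < (1 - Real.exp (-r * Δ)) / Δ * (top - 1) := by
    refine (tl.const_mul (4 * ((M : ℝ) + 1))).eventually_lt (tr.mul_const (top - 1)) ?_
    have h1 : r * (1 + 8 * (M + 1) * l / r) ≤ r * (top - 1) := by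
      gcongr; linarith
    have h2 : r * (1 + 8 * (M + 1) * l / r) = r + 8 * (M + 1) * l := by field_simp
    have h3 : 0 < ((M : ℝ) + 1) * l := by positivity
    linarith
  have e6 : ∀ᶠ Δ : ℝ in 𝓝[>] 0, highCut M (Real.exp (-r * Δ)) (Real.exp (-l * Δ)) < xlow :=
    te.eventually_lt_const hlow
  have e7 : ∀ᶠ Δ : ℝ in 𝓝[>] 0, κ * top ^ (r / l) < Real.exp (-r * Δ) *
        (1 - highCut M (Real.exp (-r * Δ)) (Real.exp (-l * Δ))) *
        highCut M (Real.exp (-r * Δ)) (Real.exp (-l * Δ)) ^ (r / l) := by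
    refine ((tδ.mul (te.const_sub 1)).mul (te.rpow_const (Or.inl hx0.ne'))).eventually_const_lt ?_
    have h1 : κ * top ^ (r / l) = (1 - x) * x ^ (r / l) / 2 := by
      rw [hκ]; field_simp
    have h2 : 0 < (1 - x) * x ^ (r / l) := mul_pos (by linarith) hxμ
    rw [h1]
    linarith
  have e8 : ∀ᶠ Δ : ℝ in 𝓝[>] 0, highCut M (Real.exp (-r * Δ)) (Real.exp (-l * Δ)) < (1 + x) / 2 :=
    te.eventually_lt_const (by linarith)
  -- For small `Δ` the rounds last at least `τ / 2`, so `δ ^ m` is bounded away from `1`, while the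
  -- cost of one safe period vanishes.
  have e9 : ∀ᶠ Δ : ℝ in 𝓝[>] 0, Real.exp (-r * (τ / 2)) *
      (κ + (1 - Real.exp (-r * Δ)) * top) < Real.exp (-r * Δ) * κ := by
    refine ((((tδ.const_sub 1).mul_const top).const_add κ).const_mul _).eventually_lt
      (tδ.mul_const κ) ?_
    have : Real.exp (-r * (τ / 2)) < 1 :=
      Real.exp_lt_one_iff.2 (by have := mul_pos hr (half_pos hτ0); linarith)
    simp only [sub_self, zero_mul, add_zero, one_mul]
    exact mul_lt_of_lt_one_left hκ0 this
  have e10 : ∀ᶠ Δ : ℝ in 𝓝[>] 0, Δ < τ / 2 :=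
    (tendsto_id.mono_left nhdsWithin_le_nhds).eventually_lt_const (by simpa using hτ0)
  filter_upwards [pos, e1, e2, e3, e4, e5, e6, e7, e8, e9, e10] with Δ hΔ h1 h2 h3 h4 h5 h6 h7 h8
    h9 h10
  have hδ1 : Real.exp (-r * Δ) < 1 := Real.exp_lt_one_iff.2 (by have := mul_pos hr hΔ; linarith)
  have hq1 : Real.exp (-l * Δ) < 1 := Real.exp_lt_one_iff.2 (by have := mul_pos hl hΔ; linarith)
  refine ⟨⟨hM, Real.exp_pos _, hδ1, Real.exp_pos _, hq1, hπ₀0, ?_, h1.le, ?_, h3, h4.le⟩, ?_,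
    h6.le, h7.le, ⌊τ / Δ⌋₊, ?_, ?_, ?_⟩
  · rw [hMπ, div_le_div_iff₀ (by positivity) (by norm_num)]
    have : 0 ≤ (M : ℝ) * (r + l) := by positivity
    linarith
  · have h := mul_le_mul_of_nonneg_right h2.le hΔ.le
    rw [div_mul_cancel₀ _ hΔ.ne'] at h
    refine le_trans (le_of_eq ?_) h
    field_simp
  · have h := mul_le_mul_of_nonneg_right h5.le hΔ.le
    have e : (1 - Real.exp (-r * Δ)) / Δ * (top - 1) * Δ = (1 - Real.exp (-r * Δ)) * (top - 1) := by
      field_simp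
    rw [e] at h
    refine le_trans (le_of_eq ?_) h
    field_simp
  · refine Nat.le_floor ?_
    rw [Nat.cast_one, le_div_iff₀ hΔ]
    linarith
  · have hfl := Nat.floor_le (div_nonneg hτ0.le hΔ.le)
    rw [le_div_iff₀ hΔ] at hfl
    rw [← Real.exp_nat_mul]
    refine h8.le.trans ?_
    rw [← hexpτ]
    refine Real.exp_le_exp.2 ?_
    push_cast
    have : l * ((M : ℝ) + 1) * (⌊τ / Δ⌋₊ * Δ) ≤ l * ((M : ℝ) + 1) * τ := by gcongr
    linarith
  · have hfl := Nat.lt_floor_add_one (τ / Δ)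
    rw [div_lt_iff₀ hΔ] at hfl
    have h11 : Real.exp (-r * Δ) ^ ⌊τ / Δ⌋₊ ≤ Real.exp (-r * (τ / 2)) := by
      rw [← Real.exp_nat_mul]
      refine Real.exp_le_exp.2 ?_
      have : r * (τ / 2) ≤ r * (⌊τ / Δ⌋₊ * Δ) := by gcongr; linarith
      linarith
    refine le_trans ?_ h9.le
    have : 0 ≤ (1 - Real.exp (-r * Δ)) * top := mul_nonneg (by linarith) htop0.le
    gcongr

/-- Equilibrium of the cost game for small period lengths. -/
lemma exists_automaton {M : ℕ} (hM : 1 ≤ M) {xlow xhigh : ℝ} (hlow : r / (r + l) < xlow)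
    (hlow1 : xlow ≤ 1) (hlh : xlow < xhigh) :
    ∃ Δbar : ℝ, 0 < Δbar ∧ ∀ Δ : ℝ, 0 < Δ → Δ < Δbar → ∀ X : ℝ, 0 < X →
      ∃ (A : Automaton) (val : Bool → ℕ → ℝ),
        A.IsEquilibrium M (Real.exp (-r * Δ)) (Real.exp (-l * Δ)) X val ∧
        (∀ i j, X * Real.exp (-l * Δ) ^ j < r / (r + l) → A.mix i j = 0) ∧
        (∀ j, xlow < X * Real.exp (-l * Δ) ^ j → A.mix true j = 1) ∧
        (∀ j, A.rew true j (M + 1) = 1) ∧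
        (X ≤ xhigh → ∀ j,
          (if xlow < X * Real.exp (-l * Δ) ^ j then (1 - Real.exp (-r * Δ))
            else (1 - Real.exp (-r * Δ)) * (X * Real.exp (-l * Δ) ^ j)) +
          Real.exp (-r * Δ) * val false (j +
            ((if r / (r + l) ≤ X * Real.exp (-l * Δ) ^ j ∧ X * Real.exp (-l * Δ) ^ j ≤ xlow ∨
              xhigh ≤ X * Real.exp (-l * Δ) ^ j then M else 0) +
            if xlow < X * Real.exp (-l * Δ) ^ j then 1 else 0)) ≤ val false j) := by
  obtain ⟨π₀, top, κ, htop, hev⟩ := eventually_finePeriod hr hl hM hlow xhigh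
  obtain ⟨Δbar, hΔbar, hsub⟩ := (mem_nhdsGT_iff_exists_Ioo_subset).1 hev
  refine ⟨Δbar, hΔbar, fun Δ hΔ hΔ' X hX => ?_⟩
  obtain ⟨H, h1, h2, h3, m, h4, h5, h6⟩ := hsub ⟨hΔ, hΔ'⟩
  have hqμ : Real.exp (-l * Δ) ^ (r / l) = Real.exp (-r * Δ) := by
    rw [← Real.exp_mul]
    congr 1
    field_simp
  obtain ⟨A, val, k1, k2, k3, k4, k5⟩ := H.exists_equilibrium hX h1 (div_pos hr hl).le hqμ h5 h4 h6 h3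
  have hc := le_lowCut hr hl hΔ
  exact ⟨A, val, k1, fun i j hj => k2 i j (hj.le.trans hc), fun j hj => k3 j (h2.trans hj.le), k4,
    fun hXh j => k5 _ _ _ hc h2 hlow1 hlh htop hXh j⟩

end Limits

/-! ### Lump-free paths form a measurable set. -/

/-- A monotone counting path without a jump on the left of `t` is continuous at `t`. -/
lemma continuousAt_of_monotone_of_eq {n : ℝ≥0 → ℕ} (hn : Monotone n)
    (hr : ∀ t, ContinuousWithinAt n (Set.Ici t) t) {s t : ℝ≥0} (hst : s < t) (h : n s = n t) :
    ContinuousAt n t := by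
  rw [continuousAt_iff_continuous_left_right]
  refine ⟨?_, hr t⟩
  have h1 : ∀ᶠ u in 𝓝[Set.Iic t] t, n u = n t := by
    filter_upwards [self_mem_nhdsWithin, mem_nhdsWithin_of_mem_nhds (Ioi_mem_nhds hst)]
      with u hu hu'
    exact le_antisymm (hn hu) (h ▸ hn (le_of_lt hu'))
  exact (continuousWithinAt_const (b := n t)).congr_of_eventuallyEq h1 rfl

lemma continuousAt_zero_of_right {n : ℝ≥0 → ℕ} (hr : ContinuousWithinAt n (Set.Ici 0) 0) :
    ContinuousAt n 0 := by
  have : Set.Ici (0 : ℝ≥0) = Set.univ := by ext; simp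
  rwa [this, continuousWithinAt_univ] at hr

namespace Bandit

variable (G : Bandit) {Δ : ℝ≥0}

/-- At a discontinuity the counting path exceeds all its earlier values, so it is injective on
discontinuities, with values at most `n Δ`. Finiteness matters because `Set.ncard` is `0` on
infinite sets, which would make such a path look lump-free. -/
lemma finite_discontinuities (y : G.ArmPath Δ) : {t | ¬ ContinuousAt y.1 t}.Finite := by
  obtain ⟨w, n, hw, -, hn, hr, -, hy⟩ := y.2
  have hdis : ∀ t, ¬ ContinuousAt y.1 t → ¬ ContinuousAt n t := by
    intro t ht hc
    refine ht ?_
    rw [show y.1 = fun t : Set.Iio Δ => w t + G.h * (n t : ℝ) from funext hy]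
    have h1 : ContinuousAt (fun t : Set.Iio Δ => n t) t :=
      ContinuousAt.comp (f := Subtype.val) (g := n) hc continuous_subtype_val.continuousAt
    have h2 : ContinuousAt (fun t : Set.Iio Δ => (n t : ℝ)) t :=
      (continuous_of_discreteTopology (f := fun k : ℕ => (k : ℝ))).continuousAt.comp h1
    fun_prop
  have key : ∀ s t : Set.Iio Δ, ¬ ContinuousAt y.1 t → s < t → n s < n t := by
    intro s t ht hst
    refine lt_of_le_of_ne (hn hst.le) fun h => hdis t ht ?_
    exact continuousAt_of_monotone_of_eq hn hr hst h
  refine Set.Finite.of_injOn (f := fun t : Set.Iio Δ => n t) (t := Set.Iic (n Δ))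
    (fun t _ => hn (le_of_lt t.2)) (fun s hs t ht hst => ?_) (Set.finite_Iic _)
  rcases lt_trichotomy s t with h | h | h
  · exact absurd hst (key s t ht h).ne
  · exact h
  · exact absurd hst (key t s hs h).ne'

lemma lumps_eq_zero_iff (y : G.ArmPath Δ) : G.lumps y = 0 ↔ Continuous y.1 := by
  rw [lumps, Set.ncard_eq_zero (G.finite_discontinuities y), continuous_iff_continuousAt,
    Set.eq_empty_iff_forall_notMem]
  simp

/-- Continuity of paths can be checked on a countable dense set of times. -/
lemma continuous_iff_dense {D : Set (Set.Iio Δ)} (hD : Dense D) (y : G.ArmPath Δ) :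
    Continuous y.1 ↔ ∀ T ∈ D, ∃ k : ℕ, ∀ s ∈ D, ∀ t ∈ D, s ≤ T → t ≤ T →
      dist s t < 1 / ((k : ℝ) + 1) → |y.1 s - y.1 t| < G.h / 2 := by
  obtain ⟨w, n, hw, -, hn, hr, -, hy⟩ := y.2
  have hh := G.h_pos
  constructor
  · intro hc T _
    have h1 : ContinuousOn (fun t => w t + G.h * (n t : ℝ)) (Set.Icc 0 T.1) := by
      refine ContinuousOn.mono (s := Set.Iio Δ) ?_ fun t ht => lt_of_le_of_lt ht.2 T.2
      rw [continuousOn_iff_continuous_domRestrict]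
      convert hc using 1
      ext t
      exact (hy t).symm
    have h2 := isCompact_Icc.uniformContinuousOn_of_continuous h1
    rw [Metric.uniformContinuousOn_iff] at h2
    obtain ⟨ε, hε, h3⟩ := h2 (G.h / 2) (by linarith)
    obtain ⟨k, hk⟩ := exists_nat_one_div_lt hε
    refine ⟨k, fun s _ t _ hs ht hst => ?_⟩
    have := h3 s ⟨zero_le, hs⟩ t ⟨zero_le, ht⟩ (hst.trans hk)
    rwa [Real.dist_eq, ← hy, ← hy] at this
  · intro hosc
    have hnc : ∀ t : Set.Iio Δ, ContinuousAt n t := by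
      intro t
      by_contra hdis
      have ht0 : (0 : ℝ≥0) < t := by
        rcases eq_or_lt_of_le (zero_le (a := (t : ℝ≥0))) with h | h
        · rw [← h] at hdis
          exact absurd (continuousAt_zero_of_right (hr 0)) hdis
        · exact h
      have hjump : ∀ s < (t : ℝ≥0), n s < n t := fun s hs =>
        lt_of_le_of_ne (hn hs.le) fun h => hdis (continuousAt_of_monotone_of_eq hn hr hs h)
      obtain ⟨T, hTD, hT⟩ : ∃ T ∈ D, t < T := by
        obtain ⟨v, hv, hv'⟩ := exists_between (show (t : ℝ≥0) < Δ from t.2)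
        obtain ⟨T, h1, h2⟩ := hD.exists_mem_open (isOpen_Ioi (a := t)) ⟨⟨v, hv'⟩, hv⟩
        exact ⟨T, h1, h2⟩
      obtain ⟨k, hk⟩ := hosc T hTD
      -- Near a jump the continuous part stays within `h / 4` of its value there, whereas the
      -- counting part contributes at least `h` across the jump; the increment would exceed `h / 2`.
      have hev : ∀ᶠ u in 𝓝 (t : ℝ≥0), dist (w u) (w t) < G.h / 4 ∧
          dist u (t : ℝ≥0) < 1 / ((k : ℝ) + 1) / 2 :=
        (Metric.tendsto_nhds.1 hw.continuousAt _ (by linarith)).and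
          (Metric.ball_mem_nhds _ (by positivity))
      obtain ⟨a, b, ⟨hat, htb⟩, hab⟩ := (mem_nhds_iff_exists_Ioo_subset' ⟨0, ht0⟩ ⟨Δ, t.2⟩).1 hev
      obtain ⟨u, ⟨hu1, hu2⟩, huD⟩ : ∃ u, (u ∈ {u : Set.Iio Δ | a < u ∧ u < t}) ∧ u ∈ D := by
        obtain ⟨v, hv, hv'⟩ := exists_between hat
        refine (hD.exists_mem_open (U := {u : Set.Iio Δ | a < u ∧ u < t}) ?_
          ⟨⟨v, hv'.trans t.2⟩, hv, hv'⟩).imp fun u h => ⟨h.2, h.1⟩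
        exact (isOpen_lt (by fun_prop) (by fun_prop)).inter (isOpen_lt (by fun_prop) (by fun_prop))
      obtain ⟨v, ⟨hv1, hv2⟩, hvD⟩ :
          ∃ v, (v ∈ {v : Set.Iio Δ | t < v ∧ (v : ℝ≥0) < min b T}) ∧ v ∈ D := by
        obtain ⟨x, hx, hx'⟩ := exists_between (lt_min htb hT)
        refine (hD.exists_mem_open (U := {v : Set.Iio Δ | t < v ∧ (v : ℝ≥0) < min b T}) ?_
          ⟨⟨x, (hx'.trans_le (min_le_right _ _)).trans T.2⟩, hx, hx'⟩).imp fun u h => ⟨h.2, h.1⟩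
        exact (isOpen_lt (by fun_prop) (by fun_prop)).inter (isOpen_lt (by fun_prop) (by fun_prop))
      have hu := hab ⟨hu1, (show (u : ℝ≥0) < t from hu2).trans htb⟩
      have hv := hab ⟨hat.trans (show (t : ℝ≥0) < v from hv1), hv2.trans_le (min_le_left _ _)⟩
      have huv : dist v u < 1 / ((k : ℝ) + 1) := by
        have h1 := dist_triangle_right (v : ℝ≥0) (u : ℝ≥0) (t : ℝ≥0)
        rw [Subtype.dist_eq]
        linarith [hu.2, hv.2]
      have h1 := hk v hvD u huD (le_of_lt (hv2.trans_le (min_le_right _ _)))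
        ((hu2.trans hT).le) huv
      have h2 := hu.1
      have h3 := hv.1
      rw [Real.dist_eq, abs_lt] at h2 h3
      rw [abs_lt, hy, hy] at h1
      have h4 : (n u : ℝ) + 1 ≤ n v := by
        exact_mod_cast (hjump u hu2).trans_le (hn (le_of_lt hv1))
      have h5 : G.h * ((n u : ℝ) + 1) ≤ G.h * n v := by gcongr
      linarith [h1.2]
    rw [show y.1 = fun t : Set.Iio Δ => w t + G.h * (n t : ℝ) from funext hy,
      continuous_iff_continuousAt]
    intro t
    have h1 : ContinuousAt (fun t : Set.Iio Δ => n t) t :=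
      ContinuousAt.comp (f := Subtype.val) (g := n) (hnc t) continuous_subtype_val.continuousAt
    have h2 : ContinuousAt (fun t : Set.Iio Δ => (n t : ℝ)) t :=
      (continuous_of_discreteTopology (f := fun k : ℕ => (k : ℝ))).continuousAt.comp h1
    fun_prop

/-- The paths without lump-sums. -/
def lumpFree (Δ : ℝ≥0) : Set (G.ArmPath Δ) := {y | G.lumps y = 0}

lemma measurableSet_lumpFree : MeasurableSet (G.lumpFree Δ) := by
  obtain ⟨D, hDc, hD⟩ := TopologicalSpace.exists_countable_dense (Set.Iio Δ)
  have : G.lumpFree Δ = ⋂ T ∈ D, ⋃ k : ℕ, ⋂ s ∈ D, ⋂ t ∈ D,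
      {y | s ≤ T → t ≤ T → dist s t < 1 / ((k : ℝ) + 1) → |y.1 s - y.1 t| < G.h / 2} := by
    ext y
    simp only [lumpFree, Set.mem_ofPred_eq, lumps_eq_zero_iff, G.continuous_iff_dense hD,
      Set.mem_iInter, Set.mem_iUnion]
  rw [this]
  refine MeasurableSet.biInter hDc fun T _ => MeasurableSet.iUnion fun k =>
    MeasurableSet.biInter hDc fun s _ => MeasurableSet.biInter hDc fun t _ => ?_
  have hm : MeasurableSet {y : G.ArmPath Δ | |y.1 s - y.1 t| < G.h / 2} := by
    have h1 : ∀ s, Measurable fun y : G.ArmPath Δ => y.1 s := fun s =>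
      (measurable_pi_apply s).comp measurable_subtype_coe
    exact measurableSet_lt (((h1 s).sub (h1 t)).abs) measurable_const
  by_cases h : s ≤ T ∧ t ≤ T ∧ dist s t < 1 / ((k : ℝ) + 1)
  · simpa only [h.1, h.2.1, h.2.2, true_imp_iff] using hm
  · convert MeasurableSet.univ
    ext y
    simp only [Set.mem_ofPred_eq, Set.mem_univ, iff_true]
    exact fun h1 h2 h3 => absurd ⟨h1, h2, h3⟩ h

end Bandit

/-! ### The laws of lump-free paths in the two states. -/

lemma IsPoissonProcess.measure_eq_zero {Ω : Type} [MeasurableSpace Ω] {l : ℝ≥0} {N : ℝ≥0 → Ω → ℕ}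
    {P : Measure Ω} (hN : IsPoissonProcess l N P) (t : ℝ≥0) :
    P {ω | N t ω = 0} = ENNReal.ofReal (Real.exp (-(l * t))) := by
  have h1 : HasLaw (N t) (poissonMeasure (l * t)) P := by
    have h := hN.law 0 t zero_le
    rw [tsub_zero] at h
    refine h.congr ?_
    filter_upwards [hN.zero] with ω hω
    simp [hω]
  rw [h1.measure_eq (p := fun k => k = 0) (measurableSet_singleton 0)]
  have : {x : ℕ | x = 0} = {0} := rfl
  rw [this, poissonMeasure_singleton]
  simp

/-- The probability of no lump-sum before `Δ`. -/
lemma IsPoissonProcess.measure_forall_eq_zero {Ω : Type} [MeasurableSpace Ω] {l : ℝ≥0}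
    {N : ℝ≥0 → Ω → ℕ} {P : Measure Ω} (hN : IsPoissonProcess l N P) {Δ : ℝ≥0} {τ : ℕ → ℝ≥0}
    (hτ : ∀ i, τ i < Δ) (hlim : Tendsto τ atTop (𝓝 Δ)) :
    P {ω | ∀ i, N (τ i) ω = 0} = ENNReal.ofReal (Real.exp (-(l * Δ))) := by
  apply le_antisymm
  · have h1 : ∀ i, P {ω | ∀ i, N (τ i) ω = 0} ≤ ENNReal.ofReal (Real.exp (-(l * τ i))) := fun i => by
      rw [← hN.measure_eq_zero]
      exact measure_mono fun ω hω => hω i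
    refine ge_of_tendsto' (f := fun i => ENNReal.ofReal (Real.exp (-(l * τ i)))) (x := atTop) ?_ h1
    refine (ENNReal.continuous_ofReal.tendsto _).comp ?_
    have hc : Continuous fun t : ℝ≥0 => Real.exp (-(l * (t : ℝ))) := by fun_prop
    exact (hc.tendsto Δ).comp hlim
  · rw [← hN.measure_eq_zero]
    refine measure_mono_ae ?_
    filter_upwards [hN.paths] with ω hω h0 i
    have : N (τ i) ω ≤ N Δ ω := hω.1 (hτ i).le
    have h0' : N Δ ω = 0 := h0
    show N (τ i) ω = 0
    omega

namespace Bandit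

variable (G : Bandit) {Δ : ℝ≥0}

/-- An arm path is lump-free iff the underlying Poisson process has not jumped. -/
lemma continuous_arm_iff {y : G.ArmPath Δ} {a σ : ℝ} {z : ℝ≥0 → ℝ} {n : ℝ≥0 → ℕ}
    (hz : Continuous z) (hn : Monotone n) (h0 : n 0 = 0) {τ : ℕ → ℝ≥0}
    (hτ : ∀ i, τ i < Δ) (hlim : Tendsto τ atTop (𝓝 Δ))
    (hy : ∀ t : Set.Iio Δ, y.1 t = a * (t : ℝ≥0) + σ * z t + G.h * n t) :
    y ∈ G.lumpFree Δ ↔ ∀ i, n (τ i) = 0 := by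
  have hh := G.h_pos
  show G.lumps y = 0 ↔ _
  rw [lumps_eq_zero_iff]
  constructor
  · intro hc i
    have h1 : Continuous fun t : Set.Iio Δ => (n t : ℝ) := by
      have : (fun t : Set.Iio Δ => (n t : ℝ)) =
          fun t => (y.1 t - a * (t : ℝ≥0) - σ * z t) / G.h := by
        ext t
        rw [hy t]
        field_simp
        ring
      rw [this]
      have : Continuous fun t : Set.Iio Δ => ((t : ℝ≥0) : ℝ) := by fun_prop
      fun_prop
    have h2 : Continuous fun t : Set.Iio Δ => n t :=
      Nat.isClosedEmbedding_coe_real.isEmbedding.continuous_iff.2 h1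
    have : PreconnectedSpace (Set.Iio Δ) :=
      isPreconnected_iff_preconnectedSpace.1 Set.ordConnected_Iio.isPreconnected
    have hpos : (0 : ℝ≥0) < Δ := lt_of_le_of_lt zero_le (hτ i)
    have := PreconnectedSpace.constant (Y := ℕ) inferInstance h2 (x := ⟨τ i, hτ i⟩) (y := ⟨0, hpos⟩)
    simpa [h0] using this
  · intro h
    have hn0 : ∀ t : Set.Iio Δ, n t = 0 := by
      intro t
      obtain ⟨i, hi⟩ := (hlim.eventually_const_lt (show (t : ℝ≥0) < Δ from t.2)).exists
      have := hn hi.le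
      have := h i
      omega
    have : y.1 = fun t : Set.Iio Δ => a * (t : ℝ≥0) + σ * z t := by
      ext t
      rw [hy t, hn0 t]
      simp
    rw [this]
    have : Continuous fun t : Set.Iio Δ => ((t : ℝ≥0) : ℝ) := by fun_prop
    fun_prop

/-- Finite-dimensional distributions of the arm path on the event that there is no lump-sum. -/
lemma IsArmLaw.measure_lumpFree_inter (hΔ : 0 < Δ) {θ : Fin 2} {Q : Measure (G.ArmPath Δ)}
    (hQ : G.IsArmLaw Δ θ Q) (I : Finset (Set.Iio Δ)) {A : Set (I → ℝ)} (hA : MeasurableSet A) :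
    Q (G.lumpFree Δ ∩ {y | I.restrict y.1 ∈ A}) =
      ENNReal.ofReal (Real.exp (-(G.lam θ * Δ))) *
      BrownianReal.projectiveFamily (I.map ⟨Subtype.val, Subtype.val_injective⟩)
        {z | (fun i : I => G.α θ * ((i : Set.Iio Δ) : ℝ≥0) + G.σ * z ⟨i.1.1, by simp⟩) ∈ A} := by
  obtain ⟨Ω, mΩ, P, Z, N, X, hP, hZ, hN, hind, hX, hlaw⟩ := hQ
  set J := I.map ⟨Subtype.val, Subtype.val_injective⟩ with hJ
  -- Paths live on `[0, Δ)`, so absence of lump-sums is tested at times increasing to `Δ` and not at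
  -- `Δ` itself.
  set τ : ℕ → ℝ≥0 := fun i => Δ * (i / (i + 1)) with hτdef
  have hτ : ∀ i, τ i < Δ := fun i => by
    have : (i : ℝ≥0) / (i + 1) < 1 := by
      rw [div_lt_one (by positivity)]
      exact lt_add_one _
    exact mul_lt_of_lt_one_right hΔ this
  have hlim : Tendsto τ atTop (𝓝 Δ) := by
    have : Tendsto (fun i : ℕ => (i : ℝ≥0) / (i + 1)) atTop (𝓝 1) := by
      rw [← NNReal.tendsto_coe]
      push_cast
      exact tendsto_natCast_div_add_atTop (1 : ℝ)
    simpa using this.const_mul Δ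
  set A' : Set (J → ℝ) :=
    {z | (fun i : I => G.α θ * ((i : Set.Iio Δ) : ℝ≥0) + G.σ * z ⟨i.1.1, by simp [hJ]⟩) ∈ A}
    with hA'def
  have hA' : MeasurableSet A' := by
    have : Measurable fun (z : J → ℝ) (i : I) =>
        G.α θ * (((i : Set.Iio Δ) : ℝ≥0) : ℝ) + G.σ * z ⟨i.1.1, by simp [hJ]⟩ := by
      fun_prop
    exact this hA
  have hmeas : MeasurableSet (G.lumpFree Δ ∩ {y | I.restrict y.1 ∈ A}) := by
    refine G.measurableSet_lumpFree.inter ?_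
    have : Measurable fun y : G.ArmPath Δ => I.restrict y.1 :=
      (Finset.measurable_restrict I).comp measurable_subtype_coe
    exact this hA
  rw [← hlaw.map_eq, Measure.map_apply_of_aemeasurable hlaw.aemeasurable hmeas]
  -- Without lump-sums the path is drift plus Brownian motion, so the event splits almost surely
  -- into a Brownian and a Poisson event, which are independent.
  have hae : X ⁻¹' (G.lumpFree Δ ∩ {y | I.restrict y.1 ∈ A}) =ᵐ[P]
      ((fun ω t => Z t ω) ⁻¹' (J.restrict ⁻¹' A') ∩
        (fun ω t => N t ω) ⁻¹' {n : ℝ≥0 → ℕ | ∀ i, n (τ i) = 0} : Set Ω) := by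
    filter_upwards [hX, hZ.cont, hN.zero, hN.paths] with ω h1 h2 h3 h4
    have e1 : X ω ∈ G.lumpFree Δ ↔ ∀ i, N (τ i) ω = 0 :=
      G.continuous_arm_iff h2 h4.1 h3 hτ hlim h1
    by_cases h0 : ∀ i, N (τ i) ω = 0
    · have hN0 : ∀ t : Set.Iio Δ, N t ω = 0 := by
        intro t
        obtain ⟨i, hi⟩ := (hlim.eventually_const_lt (show (t : ℝ≥0) < Δ from t.2)).exists
        have h5 : N t ω ≤ N (τ i) ω := h4.1 hi.le
        have := h0 i
        omega
      have e2 : I.restrict (X ω).1 = fun i : I =>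
          G.α θ * (((i : Set.Iio Δ) : ℝ≥0) : ℝ) + G.σ * Z i.1.1 ω := by
        ext i
        rw [Finset.restrict, h1 i.1, hN0 i.1]
        simp
      apply propext
      show (X ω ∈ G.lumpFree Δ ∧ I.restrict (X ω).1 ∈ A) ↔ (_ ∈ A ∧ ∀ i, N (τ i) ω = 0)
      rw [e1, e2]
      exact and_comm
    · apply propext
      show (X ω ∈ G.lumpFree Δ ∧ _) ↔ (_ ∧ ∀ i, N (τ i) ω = 0)
      rw [e1]
      simp only [h0, false_and, and_false]
  rw [measure_congr hae]
  have hset : MeasurableSet {n : ℝ≥0 → ℕ | ∀ i, n (τ i) = 0} := by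
    have : {n : ℝ≥0 → ℕ | ∀ i, n (τ i) = 0} = ⋂ i, (fun n => n (τ i)) ⁻¹' {0} := by
      ext n; simp
    rw [this]
    exact MeasurableSet.iInter fun i => measurable_pi_apply (τ i) (measurableSet_singleton 0)
  rw [(indepFun_iff_measure_inter_preimage_eq_mul.1 hind) _ _
    (Finset.measurable_restrict J hA') hset, mul_comm]
  congr 1
  · have := hN.measure_forall_eq_zero hτ hlim
    have hl : 0 ≤ G.lam θ := by
      have h0 := G.lam_zero_nonneg
      have h1 := G.lam_le
      fin_cases θ
      · exact h0
      · exact h0.trans h1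
    rw [Real.coe_toNNReal _ hl] at this
    exact this
  · exact (hZ.hasLaw J).measure_eq (p := fun z => z ∈ A') hA'

/-- Without lump-sums, arm paths are almost surely lump-free. -/
lemma IsArmLaw.lumpFree_ae (hΔ : 0 < Δ) {θ : Fin 2} (hθ : G.lam θ = 0)
    {Q : Measure (G.ArmPath Δ)} [IsProbabilityMeasure Q] (hQ : G.IsArmLaw Δ θ Q) :
    ∀ᵐ y ∂Q, y ∈ G.lumpFree Δ := by
  have h := IsArmLaw.measure_lumpFree_inter G hΔ hQ ∅ (A := Set.univ) MeasurableSet.univ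
  have e : G.lumpFree Δ ∩ {y | Finset.restrict ∅ y.1 ∈ (Set.univ : Set ((∅ : Finset (Set.Iio Δ)) → ℝ))}
      = G.lumpFree Δ := by
    ext y; simp
  have e' : ∀ f : ((((∅ : Finset (Set.Iio Δ)).map ⟨Subtype.val, Subtype.val_injective⟩ :
      Finset ℝ≥0) → ℝ) → ((∅ : Finset (Set.Iio Δ)) → ℝ)), {z | f z ∈ Set.univ} = Set.univ := by
    intro f; ext z; simp
  rw [e, e', measure_univ, hθ] at h
  simp only [zero_mul, neg_zero, Real.exp_zero, ENNReal.ofReal_one, mul_one] at h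
  exact (mem_ae_iff_prob_eq_one G.measurableSet_lumpFree).2 h

/-- If the continuous payoff component is uninformative and there are no lump-sums in the bad
state, then the two states have the same law of lump-free paths. -/
lemma IsArmLaw.restrict_lumpFree (hα : G.α 0 = G.α 1) (h0 : G.lam 0 = 0) (hΔ : 0 < Δ)
    {Q : Fin 2 → ProbabilityMeasure (G.ArmPath Δ)} (hQ : ∀ θ, G.IsArmLaw Δ θ (Q θ)) :
    (Q 1 : Measure (G.ArmPath Δ)).restrict (G.lumpFree Δ) =
      ENNReal.ofReal (Real.exp (-G.lam 1 * Δ)) • (Q 0 : Measure (G.ArmPath Δ)) := by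
  have hC := G.measurableSet_lumpFree (Δ := Δ)
  have hcyl : ∀ (I : Finset (Set.Iio Δ)) {A : Set (I → ℝ)}, MeasurableSet A →
      (Q 1 : Measure (G.ArmPath Δ)) (G.lumpFree Δ ∩ {y | I.restrict y.1 ∈ A}) =
      ENNReal.ofReal (Real.exp (-G.lam 1 * Δ)) *
        (Q 0 : Measure (G.ArmPath Δ)) (G.lumpFree Δ ∩ {y | I.restrict y.1 ∈ A}) := by
    intro I A hA
    rw [IsArmLaw.measure_lumpFree_inter G hΔ (hQ 1) I hA,
      IsArmLaw.measure_lumpFree_inter G hΔ (hQ 0) I hA, h0, hα]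
    simp
  have hone := IsArmLaw.lumpFree_ae G hΔ h0 (hQ 0)
  -- Both measures are pushed forward to the full product space, where finite-dimensional marginals
  -- determine a finite measure. The bad-state law is carried by lump-free paths, hence its
  -- restriction is harmless.
  set μ := ((Q 1 : Measure (G.ArmPath Δ)).restrict (G.lumpFree Δ)).map Subtype.val with hμ
  set ν := (ENNReal.ofReal (Real.exp (-G.lam 1 * Δ)) • (Q 0 : Measure (G.ArmPath Δ))).map
    Subtype.val with hν
  have hfin : IsFiniteMeasure (ENNReal.ofReal (Real.exp (-G.lam 1 * Δ)) •
      (Q 0 : Measure (G.ArmPath Δ))) := ⟨by simp⟩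
  have hμν : μ = ν := by
    refine IsProjectiveLimit.unique (P := fun I => μ.map I.restrict) (fun I => rfl) fun I => ?_
    ext A hA
    have hmI := Finset.measurable_restrict (X := fun _ : Set.Iio Δ => ℝ) I
    rw [Measure.map_apply hmI hA, Measure.map_apply hmI hA, hμ, hν,
      Measure.map_apply measurable_subtype_coe (hmI hA),
      Measure.map_apply measurable_subtype_coe (hmI hA),
      Measure.restrict_apply (measurable_subtype_coe (hmI hA)), Set.inter_comm,
      Measure.smul_apply, smul_eq_mul]
    refine Eq.trans ?_ (hcyl I hA).symm
    congr 1
    refine (measure_congr ?_).symm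
    filter_upwards [hone] with y hy
    apply propext
    exact and_iff_right hy
  ext s hs
  obtain ⟨t, ht, rfl⟩ := hs
  rw [← Measure.map_apply measurable_subtype_coe ht, ← Measure.map_apply measurable_subtype_coe ht,
    ← hμ, ← hν, hμν]

end Bandit

/-! ### Transition kernels and the recursion for payoffs. -/

namespace Bandit

variable (G : Bandit) {N : ℕ} {Δ : ℝ≥0}

section Kernel

variable (Q : ProbabilityMeasure (G.ArmPath Δ)) (S : Fin N → G.Strategy N Δ)

lemma measurable_next (x : G.Info N Δ) : Measurable (G.next x) :=
  (G.measurable_next_fiber (N := N) (Δ := Δ) x.1).comp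
    (measurable_const.prodMk measurable_id : Measurable fun z => (x.2, z))

/-- Real-valued probability of an action profile. -/
noncomputable def weight (x : G.Info N Δ) (a : Fin N → Bool) : ℝ :=
  ∏ n, if a n then ((S n).act x : ℝ) else 1 - ((S n).act x : ℝ)

lemma weight_factor_nonneg (x : G.Info N Δ) (b : Bool) (n : Fin N) :
    0 ≤ if b then ((S n).act x : ℝ) else 1 - ((S n).act x : ℝ) := by
  split_ifs
  · exact unitInterval.nonneg _
  · linarith [unitInterval.le_one ((S n).act x)]

lemma weight_nonneg (x : G.Info N Δ) (a : Fin N → Bool) : 0 ≤ G.weight S x a :=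
  Finset.prod_nonneg fun n _ => G.weight_factor_nonneg S x (a n) n

lemma profileProb_eq (x : G.Info N Δ) (a : Fin N → Bool) :
    G.profileProb S x a = ENNReal.ofReal (G.weight S x a) :=
  (ENNReal.ofReal_prod_of_nonneg fun n _ => G.weight_factor_nonneg S x (a n) n).symm

lemma sum_weight (x : G.Info N Δ) : ∑ a, G.weight S x a = 1 := by
  have h := Finset.prod_univ_sum (fun _ : Fin N => (Finset.univ : Finset Bool))
    (fun n b => if b then ((S n).act x : ℝ) else 1 - ((S n).act x : ℝ))
  rw [Fintype.piFinset_univ] at h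
  unfold weight
  rw [← h]
  refine Finset.prod_eq_one fun n _ => ?_
  simp

/-- Distribution of the observations and the next public draw, given the action profile `a`. -/
noncomputable def outcome (a : Fin N → Bool) : Measure ((Fin N → G.Obs Δ) × unitInterval) :=
  (Measure.pi fun n => G.obsLaw Q (a n)).prod volume

instance (a : Fin N → Bool) : IsProbabilityMeasure (G.outcome Q a) := by
  unfold outcome
  infer_instance

lemma step_apply (x : G.Info N Δ) : G.step Q S x =
    ∑ a, ENNReal.ofReal (G.weight S x a) • (G.outcome Q a).map (G.next x) := by
  simp only [← profileProb_eq]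
  rfl

instance : IsMarkovKernel (G.step Q S) := ⟨fun x => ⟨by
  rw [G.step_apply Q S x]
  have : ∀ a, ((G.outcome Q a).map (G.next x)) Set.univ = 1 := fun a => by
    rw [Measure.map_apply (G.measurable_next x) MeasurableSet.univ]
    simp
  simp only [Measure.coe_finsetSum, Finset.sum_apply, Measure.smul_apply, smul_eq_mul, this,
    mul_one]
  rw [← ENNReal.ofReal_sum_of_nonneg fun a _ => G.weight_nonneg S x a, G.sum_weight]
  simp⟩⟩

instance instMarkovAhead : ∀ j, IsMarkovKernel (G.ahead Q S j)
  | 0 => by unfold ahead; infer_instance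
  | j + 1 => by
    have := instMarkovAhead j
    unfold ahead
    infer_instance

lemma integral_step (x : G.Info N Δ) {f : G.Info N Δ → ℝ} (hf : Measurable f) {B : ℝ}
    (hB : ∀ y, |f y| ≤ B) :
    ∫ y, f y ∂(G.step Q S x) = ∑ a, G.weight S x a * ∫ z, f (G.next x z) ∂(G.outcome Q a) := by
  have hmap : ∀ a, IsProbabilityMeasure ((G.outcome Q a).map (G.next x)) := fun a =>
    Measure.isProbabilityMeasure_map (G.measurable_next x).aemeasurable
  have hint : ∀ a, Integrable f ((G.outcome Q a).map (G.next x)) := fun a =>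
    Integrable.of_bound hf.aestronglyMeasurable B (Eventually.of_forall hB)
  rw [G.step_apply, integral_finsetSum_measure fun a _ => (hint a).smul_measure (by simp)]
  refine Finset.sum_congr rfl fun a _ => ?_
  rw [integral_smul_measure, ENNReal.toReal_ofReal (G.weight_nonneg S x a), smul_eq_mul,
    integral_map (G.measurable_next x).aemeasurable hf.aestronglyMeasurable]

lemma ae_step {x : G.Info N Δ} {T : Set (G.Info N Δ)} (hT : MeasurableSet T)
    (h : ∀ a, 0 < G.weight S x a → ∀ᵐ z ∂(G.outcome Q a), G.next x z ∈ T) :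
    ∀ᵐ y ∂(G.step Q S x), y ∈ T := by
  change G.step Q S x {y | y ∉ T} = 0
  rw [G.step_apply, Measure.coe_finsetSum, Finset.sum_apply]
  refine Finset.sum_eq_zero fun a _ => ?_
  rw [Measure.smul_apply, smul_eq_mul]
  rcases (G.weight_nonneg S x a).eq_or_lt with h0 | h0
  · rw [← h0]; simp
  · have : ((G.outcome Q a).map (G.next x)) {y | y ∉ T} = 0 :=
      (ae_map_iff (G.measurable_next x).aemeasurable hT).2 (h a h0)
    rw [this, mul_zero]

end Kernel

section Payoff

variable (Q : Fin 2 → ProbabilityMeasure (G.ArmPath Δ)) (S : Fin N → G.Strategy N Δ) (n : Fin N)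

lemma discount_pos : 0 < G.discount Δ := Real.exp_pos _

lemma discount_lt_one (hΔ : 0 < Δ) : G.discount Δ < 1 :=
  Real.exp_lt_one_iff.2 (by
    have := mul_pos G.r_pos (NNReal.coe_pos.2 hΔ)
    linarith)

/-- Expected flow payoff. -/
noncomputable def flow (θ : Fin 2) (x : G.Info N Δ) : ℝ :=
  (1 - ((S n).act x : ℝ)) * G.s + ((S n).act x : ℝ) * G.m θ

lemma measurable_flow (θ : Fin 2) : Measurable (G.flow S n θ) := by
  have h := measurable_subtype_coe.comp (S n).measurable_act
  unfold flow
  exact ((measurable_const.sub h).mul measurable_const).add (h.mul measurable_const)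

lemma abs_flow_le (θ : Fin 2) (x : G.Info N Δ) : |G.flow S n θ x| ≤ |G.s| + |G.m θ| := by
  have h0 := unitInterval.nonneg ((S n).act x)
  have h1 := unitInterval.le_one ((S n).act x)
  unfold flow
  refine (abs_add_le _ _).trans ?_
  rw [abs_mul, abs_mul, abs_of_nonneg h0, abs_of_nonneg (show (0 : ℝ) ≤ 1 - _ by linarith)]
  have := abs_nonneg G.s
  have := abs_nonneg (G.m θ)
  nlinarith

/-- Expected flow payoff `j` periods ahead. -/
noncomputable def flowAhead (θ : Fin 2) (j : ℕ) (x : G.Info N Δ) : ℝ :=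
  ∫ y, G.flow S n θ y ∂(G.ahead (Q θ) S j x)

lemma abs_flowAhead_le (θ : Fin 2) (j : ℕ) (x : G.Info N Δ) :
    |G.flowAhead Q S n θ j x| ≤ |G.s| + |G.m θ| := by
  have h := norm_integral_le_of_norm_le_const (μ := G.ahead (Q θ) S j x)
    (Eventually.of_forall fun y => (Real.norm_eq_abs _).trans_le (G.abs_flow_le S n θ y))
  simpa [flowAhead] using h

lemma measurable_flowAhead (θ : Fin 2) (j : ℕ) : Measurable (G.flowAhead Q S n θ j) :=
  ((G.measurable_flow S n θ).stronglyMeasurable.integral_kernel (κ := G.ahead (Q θ) S j)).measurable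

lemma flowAhead_zero (θ : Fin 2) (x : G.Info N Δ) :
    G.flowAhead Q S n θ 0 x = G.flow S n θ x := by
  rw [flowAhead, ahead, Kernel.id_apply,
    integral_dirac' _ _ (G.measurable_flow S n θ).stronglyMeasurable]

lemma flowAhead_succ (θ : Fin 2) (j : ℕ) (x : G.Info N Δ) :
    G.flowAhead Q S n θ (j + 1) x = ∫ y, G.flowAhead Q S n θ j y ∂(G.step (Q θ) S x) := by
  rw [flowAhead, ahead, Kernel.integral_comp]
  · rfl
  · have := instMarkovAhead G (Q θ) S j
    exact Integrable.of_bound (G.measurable_flow S n θ).aestronglyMeasurable _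
      (Eventually.of_forall fun y => (Real.norm_eq_abs _).trans_le (G.abs_flow_le S n θ y))

lemma statePayoff_eq (θ : Fin 2) (x : G.Info N Δ) : G.statePayoff Q S n θ x =
    (1 - G.discount Δ) * ∑' j, G.discount Δ ^ j * G.flowAhead Q S n θ j x := rfl

variable (hΔ : 0 < Δ)
include hΔ

lemma summable_flowAhead (θ : Fin 2) (x : G.Info N Δ) :
    Summable fun j => G.discount Δ ^ j * G.flowAhead Q S n θ j x := by
  refine Summable.of_norm_bounded (g := fun j => G.discount Δ ^ j * (|G.s| + |G.m θ|))
    ((summable_geometric_of_lt_one G.discount_pos.le (G.discount_lt_one hΔ)).mul_right _)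
    fun j => ?_
  rw [norm_mul, Real.norm_eq_abs, Real.norm_eq_abs, abs_of_pos (pow_pos G.discount_pos j)]
  exact mul_le_mul_of_nonneg_left (G.abs_flowAhead_le Q S n θ j x) (pow_pos G.discount_pos j).le

lemma abs_statePayoff_le (θ : Fin 2) (x : G.Info N Δ) :
    |G.statePayoff Q S n θ x| ≤ |G.s| + |G.m θ| := by
  have hδ := G.discount_lt_one hΔ
  rw [statePayoff_eq, abs_mul, abs_of_pos (show 0 < 1 - G.discount Δ by linarith)]
  have h := tsum_of_norm_bounded (f := fun j => G.discount Δ ^ j * G.flowAhead Q S n θ j x)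
    ((hasSum_geometric_of_lt_one G.discount_pos.le hδ).mul_right (|G.s| + |G.m θ|)) fun j => by
      rw [norm_mul, Real.norm_eq_abs, Real.norm_eq_abs, abs_of_pos (pow_pos G.discount_pos j)]
      exact mul_le_mul_of_nonneg_left (G.abs_flowAhead_le Q S n θ j x)
        (pow_pos G.discount_pos j).le
  rw [Real.norm_eq_abs] at h
  calc _ ≤ (1 - G.discount Δ) * ((1 - G.discount Δ)⁻¹ * (|G.s| + |G.m θ|)) :=
        mul_le_mul_of_nonneg_left h (by linarith)
    _ = _ := by
      rw [← mul_assoc, mul_inv_cancel₀ (by linarith), one_mul]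

lemma measurable_statePayoff (θ : Fin 2) : Measurable (G.statePayoff Q S n θ) := by
  have h1 : Measurable fun x => ∑' j, G.discount Δ ^ j * G.flowAhead Q S n θ j x := by
    refine measurable_of_tendsto_metrizable (f := fun k x =>
      ∑ j ∈ Finset.range k, G.discount Δ ^ j * G.flowAhead Q S n θ j x) (fun k => ?_) ?_
    · exact Finset.measurable_sum _ fun j _ =>
        (G.measurable_flowAhead Q S n θ j).const_mul _
    · rw [tendsto_pi_nhds]
      exact fun x => (G.summable_flowAhead Q S n hΔ θ x).hasSum.tendsto_sum_nat
  exact h1.const_mul _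

/-- Recursive formula for payoffs. -/
lemma statePayoff_rec (θ : Fin 2) (x : G.Info N Δ) :
    G.statePayoff Q S n θ x = (1 - G.discount Δ) * G.flow S n θ x +
      G.discount Δ * ∫ y, G.statePayoff Q S n θ y ∂(G.step (Q θ) S x) := by
  have hδ := G.discount_lt_one hΔ
  have hsum : HasSum (fun j => ∫ y, G.discount Δ ^ j * G.flowAhead Q S n θ j y
      ∂(G.step (Q θ) S x)) (∫ y, ∑' j, G.discount Δ ^ j * G.flowAhead Q S n θ j y
        ∂(G.step (Q θ) S x)) := by
    have hb : ∀ j y, ‖G.discount Δ ^ j * G.flowAhead Q S n θ j y‖ ≤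
        G.discount Δ ^ j * (|G.s| + |G.m θ|) := fun j y => by
      rw [norm_mul, Real.norm_eq_abs, Real.norm_eq_abs, abs_of_pos (pow_pos G.discount_pos j)]
      exact mul_le_mul_of_nonneg_left (G.abs_flowAhead_le Q S n θ j y) (pow_pos G.discount_pos j).le
    refine hasSum_integral_of_summable_integral_norm (fun j => ?_) ?_
    · exact Integrable.of_bound ((G.measurable_flowAhead Q S n θ j).const_mul _).aestronglyMeasurable
        _ (Eventually.of_forall (hb j))
    · refine Summable.of_nonneg_of_le (fun j => integral_nonneg fun y => norm_nonneg _) (fun j => ?_)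
        ((summable_geometric_of_lt_one G.discount_pos.le hδ).mul_right (|G.s| + |G.m θ|))
      have := integral_mono_of_nonneg (μ := G.step (Q θ) S x)
        (Eventually.of_forall fun y => norm_nonneg (G.discount Δ ^ j * G.flowAhead Q S n θ j y))
        (integrable_const (G.discount Δ ^ j * (|G.s| + |G.m θ|))) (Eventually.of_forall (hb j))
      simpa using this
  rw [statePayoff_eq, (G.summable_flowAhead Q S n hΔ θ x).tsum_eq_zero_add]
  simp only [pow_zero, one_mul, flowAhead_zero, flowAhead_succ, statePayoff_eq]
  rw [integral_const_mul, ← hsum.tsum_eq, mul_add, ← mul_assoc (G.discount Δ),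
    mul_comm (G.discount Δ), mul_assoc _ (G.discount Δ), ← tsum_mul_left (a := G.discount Δ)]
  congr 3
  ext j
  rw [integral_const_mul]
  ring

end Payoff

end Bandit

/-! ### The summary of a history and Bayesian beliefs. -/

namespace Bandit

variable (G : Bandit) {N : ℕ} {Δ : ℝ≥0}

/-- Observations of a player that do not contain a lump-sum. -/
def clean (Δ : ℝ≥0) : Set (G.Obs Δ) := Sum.elim (fun _ => True) (fun y => y ∈ G.lumpFree Δ)

lemma inl_mem_clean (u : Unit) : (Sum.inl u : G.Obs Δ) ∈ G.clean Δ := trivial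

lemma measurableSet_clean : MeasurableSet (G.clean Δ) := by
  rw [measurableSet_sum_iff]
  exact ⟨MeasurableSet.univ, G.measurableSet_lumpFree⟩

/-- Number of players who use the risky arm. -/
def usage (o : Fin N → G.Obs Δ) : ℕ := ∑ n, if (o n).isRight then 1 else 0

lemma measurable_usage : Measurable (G.usage : (Fin N → G.Obs Δ) → ℕ) := by
  refine Finset.measurable_sum _ fun n _ => ?_
  have h : Measurable fun o : G.Obs Δ => if o.isRight then 1 else 0 :=
    measurable_fun_sum (f := fun o : G.Obs Δ => if o.isRight then 1 else 0)
      (measurable_const (a := 0)) (measurable_const (a := 1))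
  exact h.comp (measurable_pi_apply n)

/-- The likelihood ratio of an arm-period without a lump-sum. -/
noncomputable def failure (Δ : ℝ≥0) : ℝ := Real.exp (-G.lam 1 * Δ)

lemma failure_pos : 0 < G.failure Δ := Real.exp_pos _

/-- A summary of a history: whether a lump-sum has occurred, the number of arm-periods in which the
risky arm was used, and the current mode. -/
abbrev Tally : Type := Bool × ℕ × Bool

section Track

variable (rew : Bool → ℕ → ℕ → unitInterval) (i₀ : Bool)

open Classical in
/-- One-period update of the summary. -/
noncomputable def update (τ : Tally) (z : (Fin N → G.Obs Δ) × unitInterval) : Tally :=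
  (τ.1 || decide (¬ ∀ n, z.1 n ∈ G.clean Δ), τ.2.1 + G.usage z.1,
    -- The public draw that opens the next period selects the mode; being uniform, it yields `true`
    -- with probability `rew`.
    decide (z.2 ≤ rew τ.2.2 τ.2.1 (G.usage z.1)))

/-- The summary of the history of the first `ℓ` periods. -/
noncomputable def trackAux : ∀ ℓ : ℕ, (Fin ℓ → G.Period N Δ) → unitInterval → Tally
  | 0, _, _ => (false, 0, i₀)
  | ℓ + 1, h, u =>
    G.update rew (trackAux ℓ (Fin.init h) (h (Fin.last ℓ)).1) ((h (Fin.last ℓ)).2, u)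

/-- The summary of the available information. -/
noncomputable def track (x : G.Info N Δ) : Tally := G.trackAux rew i₀ x.1 x.2.1 x.2.2

lemma track_start (u : unitInterval) : G.track rew i₀ (G.start N Δ u) = (false, 0, i₀) := rfl

lemma track_next (x : G.Info N Δ) (z : (Fin N → G.Obs Δ) × unitInterval) :
    G.track rew i₀ (G.next x z) = G.update rew (G.track rew i₀ x) z := by
  simp [track, next, trackAux]

open Classical in
lemma measurable_update {β : Type*} [MeasurableSpace β] {f : β → Tally}
    {g : β → (Fin N → G.Obs Δ) × unitInterval} (hf : Measurable f) (hg : Measurable g) :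
    Measurable fun b => G.update rew (f b) (g b) := by
  have hu : Measurable fun b => G.usage (g b).1 := G.measurable_usage.comp hg.fst
  have hc : MeasurableSet {b | ∀ n, (g b).1 n ∈ G.clean Δ} := by
    have : {b | ∀ n, (g b).1 n ∈ G.clean Δ} = ⋂ n, (fun b => (g b).1 n) ⁻¹' G.clean Δ := by
      ext; simp
    rw [this]
    exact MeasurableSet.iInter fun n =>
      ((measurable_pi_apply n).comp hg.fst) G.measurableSet_clean
  have h1 : Measurable fun b => decide (¬ ∀ n, (g b).1 n ∈ G.clean Δ) :=
    measurable_to_bool (by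
      convert hc.compl using 1
      ext b
      simp)
  have h2 : Measurable fun b => rew (f b).2.2 (f b).2.1 (G.usage (g b).1) :=
    (measurable_of_countable (fun t : Bool × ℕ × ℕ => rew t.1 t.2.1 t.2.2)).comp
      (hf.snd.snd.prodMk (hf.snd.fst.prodMk hu))
  have h3 : Measurable fun b => decide ((g b).2 ≤ rew (f b).2.2 (f b).2.1 (G.usage (g b).1)) :=
    measurable_to_bool (by
      convert measurableSet_le hg.snd h2 using 1
      ext b
      simp)
  have h4 : Measurable fun b => ((f b).1 || decide (¬ ∀ n, (g b).1 n ∈ G.clean Δ)) :=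
    (measurable_of_countable (fun t : Bool × Bool => t.1 || t.2)).comp (hf.fst.prodMk h1)
  exact h4.prodMk ((hf.snd.fst.add hu).prodMk h3)

lemma measurable_track : Measurable (G.track rew i₀ : G.Info N Δ → Tally) := by
  refine G.measurable_of_fibers fun ℓ => ?_
  change Measurable fun z : (Fin ℓ → G.Period N Δ) × unitInterval => G.trackAux rew i₀ ℓ z.1 z.2
  induction ℓ with
  | zero => exact measurable_const
  | succ ℓ ih =>
    have h : Measurable fun z : (Fin (ℓ + 1) → G.Period N Δ) × unitInterval =>
        ((Fin.init z.1 : Fin ℓ → G.Period N Δ), (z.1 (Fin.last ℓ)).1) :=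
      (measurable_pi_iff.2 fun i => (measurable_pi_apply (Fin.castSucc i)).comp measurable_fst).prodMk
        (by fun_prop)
    exact G.measurable_update rew (ih.comp h) (by fun_prop)

/-- The strategy that depends on the summary only. -/
noncomputable def ofTally (f : Tally → unitInterval) : G.Strategy N Δ where
  act x := f (G.track rew i₀ x)
  measurable_act := (measurable_of_countable f).comp (G.measurable_track rew i₀)

end Track

section Belief

lemma info_induction {P : G.Info N Δ → Prop} (hs : ∀ u, P (G.start N Δ u))
    (hn : ∀ x z, P x → P (G.next x z)) (x : G.Info N Δ) : P x := by
  obtain ⟨ℓ, h, u⟩ := x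
  induction ℓ generalizing u with
  | zero =>
    have : h = Fin.elim0 := Subsingleton.elim _ _
    rw [this]
    exact hs u
  | succ ℓ ih =>
    have := hn ⟨ℓ, (Fin.init h, (h (Fin.last ℓ)).1)⟩ ((h (Fin.last ℓ)).2, u) (ih _ _)
    simpa only [next, Prod.mk.eta, Fin.snoc_init_self] using this

lemma likelihood_next (θ : Fin 2) (x : G.Info N Δ) (z : (Fin N → G.Obs Δ) × unitInterval) :
    G.likelihood θ (G.next x z) = G.likelihood θ x * ∏ n, G.obsLikelihood θ (z.1 n) := by
  have h := Fin.prod_univ_castSucc fun i : Fin (x.1 + 1) =>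
    ∏ n : Fin N, G.obsLikelihood θ (((G.next x z).2.1 i).2 n)
  simp only [next, Fin.snoc_castSucc, Fin.snoc_last] at h
  exact h

lemma likelihood_start (θ : Fin 2) (u : unitInterval) : G.likelihood θ (G.start N Δ u) = 1 :=
  Fin.prod_univ_zero _

variable (hα : G.α 0 = G.α 1) (h0 : G.lam 0 = 0)

include hα h0 in
lemma lam_one_pos : 0 < G.lam 1 := by
  have h1 := G.low_lt_safe.trans G.safe_lt_high
  rw [hα, h0] at h1
  have : 0 < G.lam 1 * G.h := by linarith
  exact pos_of_mul_pos_left this G.h_pos.le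

include hα h0 in
lemma failure_lt_one (hΔ : 0 < Δ) : G.failure Δ < 1 :=
  Real.exp_lt_one_iff.2 (by
    have := mul_pos (G.lam_one_pos hα h0) (NNReal.coe_pos.2 hΔ)
    linarith)

include hα h0 in
lemma obsLikelihood_clean {o : G.Obs Δ} (ho : o ∈ G.clean Δ) :
    0 < G.obsLikelihood 0 o ∧
      G.obsLikelihood 1 o = G.obsLikelihood 0 o * G.failure Δ ^ (if o.isRight then 1 else 0) := by
  rcases o with u | y
  · simp [obsLikelihood]
  · have hy : G.lumps y = 0 := ho
    simp [obsLikelihood, hy, h0, hα, failure, Real.exp_pos]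

include hα h0 in
lemma obsLikelihood_one_pos (o : G.Obs Δ) : 0 < G.obsLikelihood 1 o := by
  rcases o with u | y
  · simp [obsLikelihood]
  · exact mul_pos (Real.exp_pos _) (mul_pos (pow_pos (G.lam_one_pos hα h0) _) (Real.exp_pos _))

include h0 in
lemma obsLikelihood_zero_of_notMem {o : G.Obs Δ} (ho : o ∉ G.clean Δ) :
    G.obsLikelihood 0 o = 0 := by
  rcases o with u | y
  · exact absurd trivial ho
  · have hy : G.lumps y ≠ 0 := ho
    simp [obsLikelihood, h0, hy]

variable (rew : Bool → ℕ → ℕ → unitInterval) (i₀ : Bool)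

include hα h0 in
-- A lump-sum is impossible in the bad state, and a lump-free arm-period has likelihood ratio
-- `failure`, since the drifts agree. Beliefs are thus functions of the summary after every history,
-- on or off the path of play.
lemma likelihood_track (x : G.Info N Δ) : 0 < G.likelihood 1 x ∧
    ((G.track rew i₀ x).1 = true → G.likelihood 0 x = 0) ∧
    ((G.track rew i₀ x).1 = false → 0 < G.likelihood 0 x ∧
      G.likelihood 1 x = G.likelihood 0 x * G.failure Δ ^ (G.track rew i₀ x).2.1) := by
  induction x using G.info_induction with
  | hs u =>
    simp [likelihood_start, track_start]
  | hn x z ih =>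
    obtain ⟨ih1, ih2, ih3⟩ := ih
    rw [G.likelihood_next, G.likelihood_next, G.track_next]
    refine ⟨mul_pos ih1 (Finset.prod_pos fun n _ => G.obsLikelihood_one_pos hα h0 _),
      fun h => ?_, fun h => ?_⟩
    · simp only [update, Bool.or_eq_true, decide_eq_true_eq] at h
      rcases h with h | h
      · rw [ih2 h, zero_mul]
      · push Not at h
        obtain ⟨n, hn⟩ := h
        rw [Finset.prod_eq_zero (Finset.mem_univ n) (G.obsLikelihood_zero_of_notMem h0 hn),
          mul_zero]
    · simp only [update, Bool.or_eq_false_iff, decide_eq_false_iff_not, not_not] at h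
      obtain ⟨e1, e2⟩ := ih3 h.1
      refine ⟨mul_pos e1 (Finset.prod_pos fun n _ => (G.obsLikelihood_clean hα h0 (h.2 n)).1), ?_⟩
      rw [e2, Finset.prod_congr rfl fun n _ => (G.obsLikelihood_clean hα h0 (h.2 n)).2,
        Finset.prod_mul_distrib, Finset.prod_pow_eq_pow_sum]
      simp only [update, usage, pow_add]
      ring

include hα h0 in
lemma belief_of_seen {p : ℝ} (hp : 0 < p) {x : G.Info N Δ} (hx : (G.track rew i₀ x).1 = true) :
    G.belief p x = 1 := by
  obtain ⟨h1, h2, -⟩ := G.likelihood_track hα h0 rew i₀ x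
  rw [belief, h2 hx, mul_zero, add_zero, div_self (mul_pos hp h1).ne']

include hα h0 in
lemma belief_of_unseen {p : ℝ} {x : G.Info N Δ} (hx : (G.track rew i₀ x).1 = false) :
    G.belief p x = p * G.failure Δ ^ (G.track rew i₀ x).2.1 /
      (p * G.failure Δ ^ (G.track rew i₀ x).2.1 + (1 - p)) := by
  obtain ⟨h1, -, h3⟩ := G.likelihood_track hα h0 rew i₀ x
  obtain ⟨h3, h4⟩ := h3 hx
  rw [belief, h4, show p * (G.likelihood 0 x * G.failure Δ ^ (G.track rew i₀ x).2.1) =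
    G.likelihood 0 x * (p * G.failure Δ ^ (G.track rew i₀ x).2.1) by ring,
    mul_comm (1 - p), ← mul_add, mul_div_mul_left _ _ h3.ne']

end Belief

/-! ### Change of measure over one period. -/

/-- Profiles of observations without a lump-sum. -/
def cleanProfile (N : ℕ) (Δ : ℝ≥0) : Set ((Fin N → G.Obs Δ) × unitInterval) :=
  (Set.univ.pi fun _ => G.clean Δ) ×ˢ Set.univ

section Law

variable (hα : G.α 0 = G.α 1) (h0 : G.lam 0 = 0) (hΔ : 0 < Δ)
  {Q : Fin 2 → ProbabilityMeasure (G.ArmPath Δ)} (hQ : ∀ θ, G.IsArmLaw Δ θ (Q θ : Measure (G.ArmPath Δ)))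

/-- Number of players who are to use the risky arm. -/
def riskyCount (a : Fin N → Bool) : ℕ := ∑ n, if a n then 1 else 0

include hα h0 hΔ hQ

lemma obsLaw_restrict (a : Bool) : (G.obsLaw (Q 1) a).restrict (G.clean Δ) =
    ENNReal.ofReal (G.failure Δ ^ (if a then 1 else 0)) • G.obsLaw (Q 0) a := by
  cases a
  · simp only [obsLaw, Bool.false_eq_true, if_false, pow_zero, ENNReal.ofReal_one, one_smul]
    classical
    rw [restrict_dirac' G.measurableSet_clean, if_pos (G.inl_mem_clean _)]
  · simp only [obsLaw, if_true, pow_one]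
    rw [Measure.restrict_map measurable_inr G.measurableSet_clean,
      show Sum.inr ⁻¹' G.clean Δ = G.lumpFree Δ from rfl,
      IsArmLaw.restrict_lumpFree G hα h0 hΔ hQ,
      Measure.map_smul]
    rfl

/-- By independence the likelihood ratio of a lump-free outcome depends on the action profile only
through the number of risky arms. -/
lemma outcome_restrict (a : Fin N → Bool) :
    (G.outcome (Q 1) a).restrict (G.cleanProfile N Δ) =
      ENNReal.ofReal (G.failure Δ ^ riskyCount a) • G.outcome (Q 0) a := by
  have h : (Measure.pi fun n => G.obsLaw (Q 1) (a n)).restrict (Set.univ.pi fun _ => G.clean Δ) =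
      ENNReal.ofReal (G.failure Δ ^ riskyCount a) • Measure.pi fun n => G.obsLaw (Q 0) (a n) := by
    rw [Measure.restrict_pi_pi]
    refine Measure.pi_eq fun s hs => ?_
    simp only [G.obsLaw_restrict hα h0 hΔ hQ, Measure.smul_apply, Measure.pi_pi, smul_eq_mul,
      Finset.prod_mul_distrib, riskyCount]
    rw [← ENNReal.ofReal_prod_of_nonneg fun n _ => (pow_pos G.failure_pos _).le,
      Finset.prod_pow_eq_pow_sum]
  rw [outcome, outcome, cleanProfile, ← Measure.prod_restrict, h, Measure.restrict_univ,
    Measure.prod_smul_left]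

end Law

section Almost

lemma outcome_usage (Q : ProbabilityMeasure (G.ArmPath Δ)) (a : Fin N → Bool) :
    ∀ᵐ z ∂(G.outcome Q a), G.usage z.1 = riskyCount a := by
  have hm : MeasurableSet {o : G.Obs Δ | o.isRight = true} := by
    have : {o : G.Obs Δ | o.isRight = true} = Set.range Sum.inr := by
      ext o
      cases o <;> simp
    rw [this]
    exact measurableSet_range_inr
  have h1 : ∀ n, ∀ᵐ o ∂(G.obsLaw Q (a n)), o.isRight = a n := fun n => by
    cases a n
    · have hm' : MeasurableSet {o : G.Obs Δ | o.isRight = false} := by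
        convert hm.compl using 1
        ext o
        simp
      simp only [obsLaw, Bool.false_eq_true, if_false]
      rw [ae_dirac_iff hm']
      rfl
    · simp only [obsLaw, if_true]
      rw [ae_map_iff measurable_inr.aemeasurable hm]
      exact Eventually.of_forall fun y => rfl
  have h2 : ∀ᵐ o ∂(Measure.pi fun n => G.obsLaw Q (a n)), ∀ n, (o n).isRight = a n :=
    ae_all_iff.2 fun n => (Measure.quasiMeasurePreserving_eval
      (fun n => G.obsLaw Q (a n)) n).ae (h1 n)
  have h3 : ∀ᵐ z ∂(G.outcome Q a), ∀ n, (z.1 n).isRight = a n :=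
    Measure.quasiMeasurePreserving_fst.ae h2
  filter_upwards [h3] with z hz
  simp only [usage, riskyCount, hz]

lemma outcome_clean (h0 : G.lam 0 = 0) (hΔ : 0 < Δ) {Q : ProbabilityMeasure (G.ArmPath Δ)}
    (hQ : G.IsArmLaw Δ 0 Q) (a : Fin N → Bool) :
    ∀ᵐ z ∂(G.outcome Q a), ∀ n, z.1 n ∈ G.clean Δ := by
  have h1 : ∀ n, ∀ᵐ o ∂(G.obsLaw Q (a n)), o ∈ G.clean Δ := fun n => by
    cases a n
    · simp only [obsLaw, Bool.false_eq_true, if_false]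
      exact (ae_dirac_iff (G.measurableSet_clean (Δ := Δ))).2 (G.inl_mem_clean (Δ := Δ) ())
    · simp only [obsLaw, if_true]
      exact (ae_map_iff measurable_inr.aemeasurable G.measurableSet_clean).2
        (IsArmLaw.lumpFree_ae G hΔ h0 hQ)
  have h2 : ∀ᵐ o ∂(Measure.pi fun n => G.obsLaw Q (a n)), ∀ n, o n ∈ G.clean Δ :=
    ae_all_iff.2 fun n => (Measure.quasiMeasurePreserving_eval
      (fun n => G.obsLaw Q (a n)) n).ae (h1 n)
  exact Measure.quasiMeasurePreserving_fst.ae h2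

variable (rew : Bool → ℕ → ℕ → unitInterval) (i₀ : Bool)

/-- Occurrence of a lump-sum. -/
noncomputable def seen (x : G.Info N Δ) : Bool := (G.track rew i₀ x).1

/-- Number of past arm-periods in which the risky arm was used. -/
noncomputable def trials (x : G.Info N Δ) : ℕ := (G.track rew i₀ x).2.1

/-- The current mode. -/
noncomputable def mode (x : G.Info N Δ) : Bool := (G.track rew i₀ x).2.2

lemma measurable_seen : Measurable (G.seen rew i₀ : G.Info N Δ → Bool) :=
  (G.measurable_track rew i₀).fst

lemma measurable_trials : Measurable (G.trials rew i₀ : G.Info N Δ → ℕ) :=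
  (G.measurable_track rew i₀).snd.fst

lemma measurable_mode : Measurable (G.mode rew i₀ : G.Info N Δ → Bool) :=
  (G.measurable_track rew i₀).snd.snd

lemma seen_next_of_seen {x : G.Info N Δ} (hx : G.seen rew i₀ x = true)
    (z : (Fin N → G.Obs Δ) × unitInterval) : G.seen rew i₀ (G.next x z) = true := by
  rw [seen] at hx
  simp [seen, track_next, update, hx]

lemma seen_next_of_clean {x : G.Info N Δ} (hx : G.seen rew i₀ x = false)
    {z : (Fin N → G.Obs Δ) × unitInterval} (hz : ∀ n, z.1 n ∈ G.clean Δ) :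
    G.seen rew i₀ (G.next x z) = false := by
  rw [seen] at hx
  simp [seen, track_next, update, hx, hz]

lemma seen_next_of_not_clean (x : G.Info N Δ)
    {z : (Fin N → G.Obs Δ) × unitInterval} (hz : ¬ ∀ n, z.1 n ∈ G.clean Δ) :
    G.seen rew i₀ (G.next x z) = true := by
  classical
  simp only [seen, track_next, update]
  rw [decide_eq_true hz, Bool.or_true]

lemma trials_next (x : G.Info N Δ) (z : (Fin N → G.Obs Δ) × unitInterval) :
    G.trials rew i₀ (G.next x z) = G.trials rew i₀ x + G.usage z.1 := by
  simp [trials, track_next, update]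

lemma mode_next (x : G.Info N Δ) (z : (Fin N → G.Obs Δ) × unitInterval) :
    G.mode rew i₀ (G.next x z) =
      decide (z.2 ≤ rew (G.mode rew i₀ x) (G.trials rew i₀ x) (G.usage z.1)) := by
  simp only [mode, trials, track_next, update]
  congr

end Almost

section Transition

variable (rew : Bool → ℕ → ℕ → unitInterval) (i₀ : Bool)
  (hα : G.α 0 = G.α 1) (h0 : G.lam 0 = 0) (hΔ : 0 < Δ)
  {Q : Fin 2 → ProbabilityMeasure (G.ArmPath Δ)} (hQ : ∀ θ, G.IsArmLaw Δ θ (Q θ))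
  (S : Fin N → G.Strategy N Δ)

lemma volume_decide_le {F : Bool → ℝ} (η : unitInterval) :
    ∫ u : unitInterval, F (decide (u ≤ η)) = η * F true + (1 - η) * F false := by
  have h1 : volume.real (Set.Iic η) = (η : ℝ) := by
    rw [measureReal_def, unitInterval.volume_Iic]
    exact ENNReal.toReal_ofReal (unitInterval.nonneg η)
  have h2 : (fun u : unitInterval => F (decide (u ≤ η))) =
      fun u => F false + (Set.Iic η).indicator (fun _ => F true - F false) u := by
    ext u
    by_cases h : u ≤ η <;> simp [h]
  rw [h2, integral_add (integrable_const _)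
    ((integrable_const _).indicator measurableSet_Iic),
    integral_indicator_const _ measurableSet_Iic, h1]
  simp
  ring

include h0 hΔ hQ in
lemma step_unseen {x : G.Info N Δ} (hx : G.seen rew i₀ x = false) :
    ∀ᵐ y ∂(G.step (Q 0) S x), G.seen rew i₀ y = false := by
  refine G.ae_step (Q 0) S (T := {y | G.seen rew i₀ y = false})
    ((G.measurable_seen rew i₀) (measurableSet_singleton false)) fun a _ => ?_
  filter_upwards [G.outcome_clean h0 hΔ (hQ 0) a] with z hz
  exact G.seen_next_of_clean rew i₀ hx hz

lemma step_seen {x : G.Info N Δ} (hx : G.seen rew i₀ x = true) (θ : Fin 2) :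
    ∀ᵐ y ∂(G.step (Q θ) S x), G.seen rew i₀ y = true := by
  refine G.ae_step (Q θ) S (T := {y | G.seen rew i₀ y = true})
    ((G.measurable_seen rew i₀) (measurableSet_singleton true)) fun a _ => ?_
  exact Eventually.of_forall fun z => G.seen_next_of_seen rew i₀ hx z

/-- Transition of the summary. -/
lemma integral_step_track {F : Bool → ℕ → ℝ} {B : ℝ} (hB : ∀ i j, |F i j| ≤ B) (θ : Fin 2)
    (x : G.Info N Δ) :
    ∫ y, F (G.mode rew i₀ y) (G.trials rew i₀ y) ∂(G.step (Q θ) S x) =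
      ∑ a, G.weight S x a * (rew (G.mode rew i₀ x) (G.trials rew i₀ x) (riskyCount a) *
        F true (G.trials rew i₀ x + riskyCount a) +
        (1 - rew (G.mode rew i₀ x) (G.trials rew i₀ x) (riskyCount a)) *
        F false (G.trials rew i₀ x + riskyCount a)) := by
  have hm : Measurable fun y : G.Info N Δ => F (G.mode rew i₀ y) (G.trials rew i₀ y) :=
    (measurable_of_countable (fun t : Bool × ℕ => F t.1 t.2)).comp
      ((G.measurable_mode rew i₀).prodMk (G.measurable_trials rew i₀))
  rw [G.integral_step (Q θ) S x hm fun y => hB _ _]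
  refine Finset.sum_congr rfl fun a _ => ?_
  congr 1
  rw [integral_congr_ae (g := fun z => F (decide (z.2 ≤
    rew (G.mode rew i₀ x) (G.trials rew i₀ x) (riskyCount a)))
      (G.trials rew i₀ x + riskyCount a))]
  · rw [outcome, integral_fun_snd (fun u : unitInterval => F (decide (u ≤
      rew (G.mode rew i₀ x) (G.trials rew i₀ x) (riskyCount a)))
        (G.trials rew i₀ x + riskyCount a)),
      volume_decide_le (F := fun b => F b (G.trials rew i₀ x + riskyCount a))]
    simp
  · filter_upwards [G.outcome_usage (Q θ) a] with z hz
    rw [mode_next, trials_next, hz]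

include hα h0 hΔ hQ in
-- Discarding the outcomes with a lump-sum loses a nonnegative amount, which is zero if `f` vanishes
-- there.
lemma integral_outcome_le {f : (Fin N → G.Obs Δ) × unitInterval → ℝ} (hf : Measurable f) {B : ℝ}
    (hB : ∀ z, f z ≤ B) (hf0 : ∀ z, 0 ≤ f z) (a : Fin N → Bool) :
    G.failure Δ ^ riskyCount a * ∫ z, f z ∂(G.outcome (Q 0) a) ≤ ∫ z, f z ∂(G.outcome (Q 1) a) ∧
    ((∀ z, (¬ ∀ n, z.1 n ∈ G.clean Δ) → f z = 0) → ∫ z, f z ∂(G.outcome (Q 1) a) =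
      G.failure Δ ^ riskyCount a * ∫ z, f z ∂(G.outcome (Q 0) a)) := by
  have hint : Integrable f (G.outcome (Q 1) a) :=
    Integrable.of_bound hf.aestronglyMeasurable B (Eventually.of_forall fun z => by
      rw [Real.norm_eq_abs, abs_of_nonneg (hf0 z)]
      exact hB z)
  have h1 : ∫ z in G.cleanProfile N Δ, f z ∂(G.outcome (Q 1) a) =
      G.failure Δ ^ riskyCount a * ∫ z, f z ∂(G.outcome (Q 0) a) := by
    rw [G.outcome_restrict hα h0 hΔ hQ, integral_smul_measure,
      ENNReal.toReal_ofReal (pow_pos G.failure_pos _).le, smul_eq_mul]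
  constructor
  · rw [← h1]
    exact setIntegral_le_integral hint (Eventually.of_forall hf0)
  · intro h
    rw [← h1, setIntegral_eq_integral_of_forall_compl_eq_zero]
    intro z hz
    refine h z fun hc => hz ?_
    simpa [cleanProfile] using hc

include hα h0 hΔ hQ in
/-- Change of measure from the good to the bad state. -/
lemma integral_step_le {f : G.Info N Δ → ℝ} (hf : Measurable f) {B : ℝ}
    (hB : ∀ y, f y ≤ B) (hf0 : ∀ y, 0 ≤ f y) (x : G.Info N Δ) :
    ∫ y, G.failure Δ ^ G.trials rew i₀ y * f y ∂(G.step (Q 0) S x) ≤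
      G.failure Δ ^ G.trials rew i₀ x * ∫ y, f y ∂(G.step (Q 1) S x) ∧
    ((∀ y, G.seen rew i₀ y = true → f y = 0) →
      G.failure Δ ^ G.trials rew i₀ x * ∫ y, f y ∂(G.step (Q 1) S x) =
      ∫ y, G.failure Δ ^ G.trials rew i₀ y * f y ∂(G.step (Q 0) S x)) := by
  have hq := G.failure_pos (Δ := Δ)
  have hq1 : G.failure Δ ≤ 1 := (G.failure_lt_one hα h0 hΔ).le
  have hnext := G.measurable_next x
  have hfn : Measurable fun z => f (G.next x z) := hf.comp hnext
  have hpow : Measurable fun y : G.Info N Δ => G.failure Δ ^ G.trials rew i₀ y :=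
    (measurable_of_countable (fun j : ℕ => G.failure Δ ^ j)).comp (G.measurable_trials rew i₀)
  have hb : ∀ y, |f y| ≤ B := fun y => by
    rw [abs_of_nonneg (hf0 y)]
    exact hB y
  have hb' : ∀ y : G.Info N Δ, |G.failure Δ ^ G.trials rew i₀ y * f y| ≤ B := fun y => by
    rw [abs_mul, abs_of_pos (pow_pos hq _)]
    exact (mul_le_of_le_one_left (abs_nonneg _) (pow_le_one₀ hq.le hq1)).trans (hb y)
  have e : ∀ a : Fin N → Bool, ∫ z, G.failure Δ ^ G.trials rew i₀ (G.next x z) * f (G.next x z)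
      ∂(G.outcome (Q 0) a) = G.failure Δ ^ G.trials rew i₀ x * (G.failure Δ ^ riskyCount a *
        ∫ z, f (G.next x z) ∂(G.outcome (Q 0) a)) := fun a => by
    rw [← mul_assoc, ← pow_add, ← integral_const_mul]
    refine integral_congr_ae ?_
    filter_upwards [G.outcome_usage (Q 0) a] with z hz
    rw [trials_next, hz]
  rw [G.integral_step (Q 0) S x (f := fun y => G.failure Δ ^ G.trials rew i₀ y * f y)
    (hpow.mul hf) hb', G.integral_step (Q 1) S x hf hb,
    Finset.mul_sum]
  simp only [e]
  have key := fun a => G.integral_outcome_le hα h0 hΔ hQ hfn (fun z => hB _) (fun z => hf0 _) a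
  constructor
  · refine Finset.sum_le_sum fun a _ => ?_
    rw [mul_left_comm]
    exact mul_le_mul_of_nonneg_left (mul_le_mul_of_nonneg_left (key a).1 (G.weight_nonneg S x a))
      (pow_pos hq _).le
  · intro h
    refine Finset.sum_congr rfl fun a _ => ?_
    rw [mul_left_comm, (key a).2 fun z hz => h _ (G.seen_next_of_not_clean rew i₀ x hz)]

end Transition

end Bandit

/-! ### Verification of equilibria by cost functions. -/

/-- A bounded function that is dominated by its discounted expectation on an invariant set is
nonpositive there. -/
lemma nonpos_of_le_discounted {X : Type*} [MeasurableSpace X] {κ : Kernel X X} [IsMarkovKernel κ]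
    {T : Set X} (hT : ∀ x ∈ T, ∀ᵐ y ∂(κ x), y ∈ T) {f : X → ℝ} (hf : Measurable f) {K δ : ℝ}
    (hK : ∀ x, |f x| ≤ K) (hδ0 : 0 ≤ δ) (hδ1 : δ < 1) (h : ∀ x ∈ T, f x ≤ δ * ∫ y, f y ∂(κ x)) :
    ∀ x ∈ T, f x ≤ 0 := by
  have hn : ∀ k : ℕ, ∀ x ∈ T, f x ≤ δ ^ k * K := by
    intro k
    induction k with
    | zero =>
      intro x _
      rw [pow_zero, one_mul]
      exact (le_abs_self _).trans (hK x)
    | succ k ih =>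
      intro x hx
      refine (h x hx).trans ?_
      rw [pow_succ', mul_assoc]
      refine mul_le_mul_of_nonneg_left ?_ hδ0
      have hi : Integrable f (κ x) :=
        Integrable.of_bound hf.aestronglyMeasurable K (Eventually.of_forall hK)
      have h1 : f ≤ᵐ[κ x] fun _ => δ ^ k * K := (hT x hx).mono fun y hy => ih y hy
      simpa using integral_mono_ae hi (integrable_const _) h1
  intro x hx
  have hlim : Tendsto (fun k : ℕ => δ ^ k * K) atTop (𝓝 (0 * K)) :=
    (tendsto_pow_atTop_nhds_zero_of_lt_one hδ0 hδ1).mul_const K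
  rw [zero_mul] at hlim
  exact ge_of_tendsto' hlim fun k => hn k x hx

section Binomial

/-- One player is singled out because a deviator's probability differs from that of the opponents,
who share a common one and give a binomial count. -/
lemma sum_bool_insertNth {M : ℕ} (n : Fin (M + 1)) (w : Fin (M + 1) → ℝ) (g : ℕ → ℝ) :
    ∑ a : Fin (M + 1) → Bool, (∏ i, if a i then w i else 1 - w i) * g (∑ i, if a i then 1 else 0) =
      (1 - w n) * ∑ a : Fin M → Bool, (∏ i, if a i then w (n.succAbove i) else
        1 - w (n.succAbove i)) * g (∑ i, if a i then 1 else 0) +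
      w n * ∑ a : Fin M → Bool, (∏ i, if a i then w (n.succAbove i) else
        1 - w (n.succAbove i)) * g ((∑ i, if a i then 1 else 0) + 1) := by
  rw [← (Fin.insertNthEquiv (fun _ => Bool) n).sum_comp, Fintype.sum_prod_type, Fintype.sum_bool,
    add_comm, Finset.mul_sum, Finset.mul_sum]
  simp only [Fin.insertNthEquiv_apply, Fin.prod_univ_succAbove _ n, Fin.sum_univ_succAbove _ n,
    Fin.insertNth_apply_same, Fin.insertNth_apply_succAbove, if_true, Bool.false_eq_true, if_false,
    zero_add, mul_assoc, add_comm 1]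

lemma sum_bool_eq_bexp (M : ℕ) (π : ℝ) (g : ℕ → ℝ) :
    ∑ a : Fin M → Bool, (∏ i, if a i then π else 1 - π) * g (∑ i, if a i then 1 else 0) =
      bexp M π g := by
  induction M generalizing g with
  | zero => simp [bexp]
  | succ M ih =>
    rw [sum_bool_insertNth 0 (fun _ => π) g, ih g, ih fun k => g (k + 1)]
    rfl

end Binomial

namespace Bandit

variable (G : Bandit) {N : ℕ} {Δ : ℝ≥0}

lemma sum_weight_riskyCount {M : ℕ} (S : Fin (M + 1) → G.Strategy (M + 1) Δ)
    (x : G.Info (M + 1) Δ) (n : Fin (M + 1)) {π : ℝ}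
    (hπ : ∀ i, i ≠ n → ((S i).act x : ℝ) = π) (g : ℕ → ℝ) :
    ∑ a, G.weight S x a * g (riskyCount a) = (1 - ((S n).act x : ℝ)) * bexp M π g +
      ((S n).act x : ℝ) * bexp M π (fun k => g (k + 1)) := by
  have h := sum_bool_insertNth n (fun i => ((S i).act x : ℝ)) g
  simp only [hπ _ (Fin.succAbove_ne n _)] at h
  rw [sum_bool_eq_bexp M π g, sum_bool_eq_bexp M π fun k => g (k + 1)] at h
  exact h

section Verification

variable {Q : Fin 2 → ProbabilityMeasure (G.ArmPath Δ)} (S : Fin N → G.Strategy N Δ) (n : Fin N)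
  (p : ℝ) (rew : Bool → ℕ → ℕ → unitInterval) (i₀ : Bool)

lemma m_zero_lt : G.m 0 < G.s := G.low_lt_safe

lemma lt_m_one : G.s < G.m 1 := G.safe_lt_high

lemma statePayoff_one_le (hΔ : 0 < Δ) (x : G.Info N Δ) : G.statePayoff Q S n 1 x ≤ G.m 1 := by
  have hδ := G.discount_lt_one hΔ
  have hm := G.measurable_statePayoff Q S n hΔ 1
  have hb := G.abs_statePayoff_le Q S n hΔ 1
  have h := nonpos_of_le_discounted (κ := G.step (Q 1) S) (T := Set.univ)
    (f := fun x => G.statePayoff Q S n 1 x - G.m 1) (K := |G.s| + |G.m 1| + |G.m 1|)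
    (fun x _ => Eventually.of_forall fun _ => trivial) (hm.sub_const _)
    (fun x => (abs_sub _ _).trans (by linarith [hb x])) G.discount_pos.le hδ ?_ x trivial
  · linarith
  · intro x _
    rw [G.statePayoff_rec Q S n hΔ, integral_sub (Integrable.of_bound hm.aestronglyMeasurable _
      (Eventually.of_forall hb)) (integrable_const _)]
    have h1 := unitInterval.le_one ((S n).act x)
    have h2 := G.lt_m_one
    simp only [integral_const, probReal_univ, one_smul, flow]
    nlinarith [mul_nonneg (sub_nonneg.2 h1) (mul_nonneg (sub_nonneg.2 h2.le) (sub_nonneg.2 hδ.le))]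

lemma statePayoff_one_eq (hΔ : 0 < Δ) {T : Set (G.Info N Δ)}
    (hT : ∀ x ∈ T, ∀ᵐ y ∂(G.step (Q 1) S x), y ∈ T) (hS : ∀ x ∈ T, (S n).act x = 1)
    {x : G.Info N Δ} (hx : x ∈ T) : G.statePayoff Q S n 1 x = G.m 1 := by
  have hδ := G.discount_lt_one hΔ
  have hm := G.measurable_statePayoff Q S n hΔ 1
  have hb := G.abs_statePayoff_le Q S n hΔ 1
  refine le_antisymm (G.statePayoff_one_le S n hΔ x) ?_
  have h := nonpos_of_le_discounted (κ := G.step (Q 1) S) hT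
    (f := fun x => G.m 1 - G.statePayoff Q S n 1 x) (K := |G.m 1| + (|G.s| + |G.m 1|))
    (hm.const_sub _)
    (fun x => (abs_sub _ _).trans (by linarith [hb x])) G.discount_pos.le hδ ?_ x hx
  · linarith
  · intro x hx
    rw [G.statePayoff_rec Q S n hΔ, integral_sub (integrable_const _)
      (Integrable.of_bound hm.aestronglyMeasurable _ (Eventually.of_forall hb))]
    simp only [integral_const, probReal_univ, one_smul, flow, hS x hx, Set.Icc.coe_one]
    linarith

lemma statePayoff_one_of_seen (hΔ : 0 < Δ)
    (hS : ∀ x, G.seen rew i₀ x = true → (S n).act x = 1) {x : G.Info N Δ}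
    (hx : G.seen rew i₀ x = true) : G.statePayoff Q S n 1 x = G.m 1 :=
  G.statePayoff_one_eq S n hΔ (T := {x | G.seen rew i₀ x = true})
    (fun _ hx => G.step_seen rew i₀ S hx 1) hS hx

/-- Expected opportunity cost of the current action in the absence of a lump-sum, per unit of
likelihood in the bad state. -/
noncomputable def stage (x : G.Info N Δ) : ℝ :=
  (1 - G.discount Δ) * (p * G.failure Δ ^ G.trials rew i₀ x *
    ((1 - ((S n).act x : ℝ)) * (G.m 1 - G.s)) + (1 - p) * (((S n).act x : ℝ) * (G.s - G.m 0)))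

/-- Expected shortfall of the continuation payoff from its full-information value, per unit of
likelihood in the bad state. -/
noncomputable def cost (Q : Fin 2 → ProbabilityMeasure (G.ArmPath Δ)) (x : G.Info N Δ) : ℝ :=
  p * (G.failure Δ ^ G.trials rew i₀ x * (G.m 1 - G.statePayoff Q S n 1 x)) +
    (1 - p) * (G.s - G.statePayoff Q S n 0 x)

variable (hα : G.α 0 = G.α 1) (h0 : G.lam 0 = 0) (hΔ : 0 < Δ)

lemma measurable_failure_pow :
    Measurable fun y : G.Info N Δ => G.failure Δ ^ G.trials rew i₀ y :=
  (measurable_of_countable (fun j : ℕ => G.failure Δ ^ j)).comp (G.measurable_trials rew i₀)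

include hΔ in
lemma measurable_cost : Measurable (G.cost S n p rew i₀ Q) := by
  have h1 := G.measurable_statePayoff Q S n hΔ 1
  have h0 := G.measurable_statePayoff Q S n hΔ 0
  have hq := G.measurable_failure_pow (N := N) (Δ := Δ) rew i₀
  unfold cost
  exact ((hq.mul (h1.const_sub _)).const_mul _).add ((h0.const_sub _).const_mul _)

include hα h0 hΔ in
lemma exists_abs_cost_le : ∃ K, ∀ x, |G.cost S n p rew i₀ Q x| ≤ K := by
  refine ⟨|p| * (|G.m 1| + (|G.s| + |G.m 1|)) + |1 - p| * (|G.s| + (|G.s| + |G.m 0|)),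
    fun x => ?_⟩
  have hq := G.failure_pos (Δ := Δ)
  have hq1 := (G.failure_lt_one hα h0 hΔ).le
  refine (abs_add_le _ _).trans (add_le_add ?_ ?_)
  · rw [abs_mul, abs_mul, abs_of_pos (pow_pos hq _)]
    refine mul_le_mul_of_nonneg_left ?_ (abs_nonneg _)
    refine (mul_le_of_le_one_left (abs_nonneg _) (pow_le_one₀ hq.le hq1)).trans ?_
    exact (abs_sub _ _).trans (by linarith [G.abs_statePayoff_le Q S n hΔ 1 x])
  · rw [abs_mul]
    refine mul_le_mul_of_nonneg_left ?_ (abs_nonneg _)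
    exact (abs_sub _ _).trans (by linarith [G.abs_statePayoff_le Q S n hΔ 0 x])

variable (hQ : ∀ θ, G.IsArmLaw Δ θ (Q θ))

include hα h0 hΔ hQ

/-- After a lump-sum the shortfall in state `1` is nonnegative, and zero if the risky arm is used
from then on. Everything else can be computed under the bad-state kernel, where histories remain
free of lump-sums. -/
lemma cost_ge (hp : 0 ≤ p) (x : G.Info N Δ) :
    G.stage S n p rew i₀ x + G.discount Δ * ∫ y, G.cost S n p rew i₀ Q y ∂(G.step (Q 0) S x) ≤
      G.cost S n p rew i₀ Q x ∧
    ((∀ x, G.seen rew i₀ x = true → (S n).act x = 1) → G.cost S n p rew i₀ Q x =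
      G.stage S n p rew i₀ x + G.discount Δ * ∫ y, G.cost S n p rew i₀ Q y ∂(G.step (Q 0) S x)) := by
  have h1 := G.measurable_statePayoff Q S n hΔ 1
  have h2 := G.measurable_statePayoff Q S n hΔ 0
  have hb1 := G.abs_statePayoff_le Q S n hΔ 1
  have hb2 := G.abs_statePayoff_le Q S n hΔ 0
  have hq := G.measurable_failure_pow (N := N) (Δ := Δ) rew i₀
  have hq0 := G.failure_pos (Δ := Δ)
  have hq1 := (G.failure_lt_one hα h0 hΔ).le
  have hi : ∀ θ θ', Integrable (G.statePayoff Q S n θ) (G.step (Q θ') S x) := fun θ θ' =>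
    Integrable.of_bound (G.measurable_statePayoff Q S n hΔ θ).aestronglyMeasurable _
      (Eventually.of_forall (G.abs_statePayoff_le Q S n hΔ θ))
  obtain ⟨k1, k2⟩ := G.integral_step_le rew i₀ hα h0 hΔ hQ S
    (f := fun y => G.m 1 - G.statePayoff Q S n 1 y) (B := G.m 1 + (|G.s| + |G.m 1|))
    (h1.const_sub _) (fun y => by linarith [neg_abs_le (G.statePayoff Q S n 1 y), hb1 y])
    (fun y => sub_nonneg.2 (G.statePayoff_one_le S n hΔ y)) x
  have hfi : Integrable (fun y => G.failure Δ ^ G.trials rew i₀ y *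
      (G.m 1 - G.statePayoff Q S n 1 y)) (G.step (Q 0) S x) :=
    Integrable.of_bound (hq.mul (h1.const_sub _)).aestronglyMeasurable (|G.m 1| + (|G.s| + |G.m 1|))
      (Eventually.of_forall fun y => by
        rw [Real.norm_eq_abs, abs_mul, abs_of_pos (pow_pos hq0 _)]
        refine (mul_le_of_le_one_left (abs_nonneg _) (pow_le_one₀ hq0.le hq1)).trans ?_
        exact (abs_sub _ _).trans (by linarith [hb1 y]))
  have hsi : Integrable (fun y => G.s - G.statePayoff Q S n 0 y) (G.step (Q 0) S x) :=
    (integrable_const _).sub (hi 0 0)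
  have e1 : ∫ y, G.cost S n p rew i₀ Q y ∂(G.step (Q 0) S x) =
      p * ∫ y, G.failure Δ ^ G.trials rew i₀ y * (G.m 1 - G.statePayoff Q S n 1 y)
        ∂(G.step (Q 0) S x) + (1 - p) * (G.s - ∫ y, G.statePayoff Q S n 0 y ∂(G.step (Q 0) S x)) := by
    unfold cost
    rw [integral_add (hfi.const_mul _) (hsi.const_mul _),
      integral_const_mul, integral_const_mul, integral_sub (integrable_const _) (hi 0 0)]
    simp
  have e2 : ∫ y, (G.m 1 - G.statePayoff Q S n 1 y) ∂(G.step (Q 1) S x) =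
      G.m 1 - ∫ y, G.statePayoff Q S n 1 y ∂(G.step (Q 1) S x) := by
    rw [integral_sub (integrable_const _) (hi 1 1)]
    simp
  have e3 : G.cost S n p rew i₀ Q x = G.stage S n p rew i₀ x + G.discount Δ *
      (p * (G.failure Δ ^ G.trials rew i₀ x * ∫ y, (G.m 1 - G.statePayoff Q S n 1 y)
        ∂(G.step (Q 1) S x)) +
        (1 - p) * (G.s - ∫ y, G.statePayoff Q S n 0 y ∂(G.step (Q 0) S x))) := by
    rw [e2]
    unfold cost
    rw [G.statePayoff_rec Q S n hΔ 1, G.statePayoff_rec Q S n hΔ 0]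
    simp only [stage, flow]
    ring
  have hδ := G.discount_pos (Δ := Δ)
  constructor
  · rw [e3, e1]
    have := mul_le_mul_of_nonneg_left k1 hp
    have := mul_le_mul_of_nonneg_left this hδ.le
    linarith
  · intro hS
    rw [e3, e1, k2 fun y hy => by
      rw [G.statePayoff_one_of_seen S n rew i₀ hΔ hS hy, sub_self]]

/-- Subsolutions of the Bellman equation are lower bounds for the cost. -/
lemma le_cost (hp : 0 ≤ p) {F : G.Info N Δ → ℝ} (hF : Measurable F) {K : ℝ} (hK : ∀ x, |F x| ≤ K)
    (h : ∀ x, G.seen rew i₀ x = false →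
      F x ≤ G.stage S n p rew i₀ x + G.discount Δ * ∫ y, F y ∂(G.step (Q 0) S x))
    {x : G.Info N Δ} (hx : G.seen rew i₀ x = false) : F x ≤ G.cost S n p rew i₀ Q x := by
  obtain ⟨K', hK'⟩ := G.exists_abs_cost_le (Q := Q) S n p rew i₀ hα h0 hΔ
  have hm := G.measurable_cost (Q := Q) S n p rew i₀ hΔ
  have h := nonpos_of_le_discounted (κ := G.step (Q 0) S) (T := {x | G.seen rew i₀ x = false})
    (f := fun x => F x - G.cost S n p rew i₀ Q x) (K := K + K')
    (fun x hx => G.step_unseen rew i₀ h0 hΔ hQ S hx) (hF.sub hm)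
    (fun x => (abs_sub _ _).trans (add_le_add (hK x) (hK' x))) G.discount_pos.le
    (G.discount_lt_one hΔ) ?_ x hx
  · linarith
  · intro x hx
    rw [integral_sub (Integrable.of_bound hF.aestronglyMeasurable _ (Eventually.of_forall hK))
      (Integrable.of_bound hm.aestronglyMeasurable _ (Eventually.of_forall hK'))]
    linarith [h x hx, (G.cost_ge S n p rew i₀ hα h0 hΔ hQ hp x).1]

/-- Supersolutions of the Bellman equation are upper bounds for the cost of strategies that prescribe
the risky arm after a lump-sum. -/
lemma cost_le (hp : 0 ≤ p) (hS : ∀ x, G.seen rew i₀ x = true → (S n).act x = 1)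
    {F : G.Info N Δ → ℝ} (hF : Measurable F) {K : ℝ} (hK : ∀ x, |F x| ≤ K)
    (h : ∀ x, G.seen rew i₀ x = false →
      G.stage S n p rew i₀ x + G.discount Δ * ∫ y, F y ∂(G.step (Q 0) S x) ≤ F x)
    {x : G.Info N Δ} (hx : G.seen rew i₀ x = false) : G.cost S n p rew i₀ Q x ≤ F x := by
  obtain ⟨K', hK'⟩ := G.exists_abs_cost_le (Q := Q) S n p rew i₀ hα h0 hΔ
  have hm := G.measurable_cost (Q := Q) S n p rew i₀ hΔ
  have h := nonpos_of_le_discounted (κ := G.step (Q 0) S) (T := {x | G.seen rew i₀ x = false})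
    (f := fun x => G.cost S n p rew i₀ Q x - F x) (K := K' + K)
    (fun x hx => G.step_unseen rew i₀ h0 hΔ hQ S hx) (hm.sub hF)
    (fun x => (abs_sub _ _).trans (add_le_add (hK' x) (hK x))) G.discount_pos.le
    (G.discount_lt_one hΔ) ?_ x hx
  · linarith
  · intro x hx
    rw [integral_sub (Integrable.of_bound hm.aestronglyMeasurable _ (Eventually.of_forall hK'))
      (Integrable.of_bound hF.aestronglyMeasurable _ (Eventually.of_forall hK))]
    linarith [h x hx, (G.cost_ge S n p rew i₀ hα h0 hΔ hQ hp x).2 hS]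

omit hΔ hQ in
-- The denominator and the full-information terms do not depend on strategies, so maximizing the
-- continuation payoff is minimizing `cost`.
lemma contPayoff_of_unseen (hp : 0 < p) (hp1 : p < 1) {x : G.Info N Δ}
    (hx : G.seen rew i₀ x = false) :
    G.contPayoff Q S n (G.belief p x) x =
      (p * G.failure Δ ^ G.trials rew i₀ x * G.m 1 + (1 - p) * G.s - G.cost S n p rew i₀ Q x) /
        (p * G.failure Δ ^ G.trials rew i₀ x + (1 - p)) := by
  have hq := pow_pos (G.failure_pos (Δ := Δ)) (G.trials rew i₀ x)
  have hD : p * G.failure Δ ^ G.trials rew i₀ x + (1 - p) ≠ 0 := by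
    have := mul_pos hp hq
    intro h
    linarith
  rw [contPayoff, G.belief_of_unseen hα h0 rew i₀ hx]
  change p * G.failure Δ ^ G.trials rew i₀ x / (p * G.failure Δ ^ G.trials rew i₀ x + (1 - p)) * _ +
    (1 - p * G.failure Δ ^ G.trials rew i₀ x /
      (p * G.failure Δ ^ G.trials rew i₀ x + (1 - p))) * _ = _
  unfold cost
  generalize G.failure Δ ^ G.trials rew i₀ x = q at *
  field_simp
  ring

/-- Sufficient condition for equilibrium in terms of a common cost function. -/
lemma isPBE_of_cost (hp : 0 < p) (hp1 : p < 1)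
    (hS : ∀ n x, G.seen rew i₀ x = true → (S n).act x = 1)
    {F : G.Info N Δ → ℝ} (hF : Measurable F) {K : ℝ} (hK : ∀ x, |F x| ≤ K)
    (hopt : ∀ n x, G.seen rew i₀ x = false →
      G.stage S n p rew i₀ x + G.discount Δ * ∫ y, F y ∂(G.step (Q 0) S x) ≤ F x)
    (hdev : ∀ n T x, G.seen rew i₀ x = false →
      F x ≤ G.stage (Function.update S n T) n p rew i₀ x +
        G.discount Δ * ∫ y, F y ∂(G.step (Q 0) (Function.update S n T) x)) :
    G.IsPBE Q p S := by
  intro x n T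
  cases hx : G.seen rew i₀ x
  · have hq := pow_pos (G.failure_pos (Δ := Δ)) (G.trials rew i₀ x)
    have hD : 0 < p * G.failure Δ ^ G.trials rew i₀ x + (1 - p) := by
      have := mul_pos hp hq
      linarith
    rw [G.contPayoff_of_unseen S n p rew i₀ hα h0 hp hp1 hx,
      G.contPayoff_of_unseen (Function.update S n T) n p rew i₀ hα h0 hp hp1 hx]
    refine div_le_div_of_nonneg_right ?_ hD.le
    linarith [G.cost_le S n p rew i₀ hα h0 hΔ hQ hp.le (hS n) hF hK (hopt n) hx,
      G.le_cost (Function.update S n T) n p rew i₀ hα h0 hΔ hQ hp.le hF hK (hdev n T) hx]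
  · rw [G.belief_of_seen hα h0 rew i₀ hp hx]
    simp only [contPayoff, sub_self, zero_mul, add_zero, one_mul]
    rw [G.statePayoff_one_of_seen S n rew i₀ hΔ (hS n) hx]
    exact G.statePayoff_one_le _ n hΔ x

end Verification

end Bandit

/-! ### Odds of beliefs and of cutoffs. -/

namespace Bandit

variable (G : Bandit) {M : ℕ} {Δ : ℝ≥0}

section Odds

/-- Odds ratio of a belief, normalized so that the myopic cutoff has odds ratio `1`. -/
noncomputable def odds (c : ℝ) : ℝ := c * (G.m 1 - G.s) / ((1 - c) * (G.s - G.m 0))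

lemma odds_pos {c : ℝ} (h0 : 0 < c) (h1 : c < 1) : 0 < G.odds c :=
  div_pos (mul_pos h0 (sub_pos.2 G.lt_m_one)) (mul_pos (sub_pos.2 h1) (sub_pos.2 G.m_zero_lt))

lemma odds_lt_odds {c d : ℝ} (hc : c < 1) (hd : d < 1) : G.odds c < G.odds d ↔ c < d := by
  have hA := sub_pos.2 G.lt_m_one
  have hB := sub_pos.2 G.m_zero_lt
  have hAB := mul_pos hA hB
  rw [odds, odds, div_lt_div_iff₀ (mul_pos (sub_pos.2 hc) hB) (mul_pos (sub_pos.2 hd) hB),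
    ← sub_pos, ← sub_pos (a := d), show d * (G.m 1 - G.s) * ((1 - c) * (G.s - G.m 0)) -
      c * (G.m 1 - G.s) * ((1 - d) * (G.s - G.m 0)) =
      (d - c) * ((G.m 1 - G.s) * (G.s - G.m 0)) by ring, mul_pos_iff_of_pos_right hAB]

lemma odds_le_odds {c d : ℝ} (hc : c < 1) (hd : d < 1) : G.odds c ≤ G.odds d ↔ c ≤ d := by
  rw [← not_lt, ← not_lt, G.odds_lt_odds hd hc]

lemma odds_myopicCutoff : G.odds G.myopicCutoff = 1 := by
  have hA := sub_pos.2 G.lt_m_one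
  have hB := sub_pos.2 G.m_zero_lt
  have hD : 0 < G.m 1 - G.m 0 := by linarith
  have e : 1 - (G.s - G.m 0) / (G.m 1 - G.m 0) = (G.m 1 - G.s) / (G.m 1 - G.m 0) := by
    rw [eq_div_iff hD.ne', sub_mul, div_mul_cancel₀ _ hD.ne']
    ring
  rw [odds, myopicCutoff, e, div_mul_eq_mul_div, div_mul_eq_mul_div, mul_comm (G.m 1 - G.s),
    div_self (div_pos (mul_pos hB hA) hD).ne']

lemma myopicCutoff_lt_one : G.myopicCutoff < 1 := by
  have hA := sub_pos.2 G.lt_m_one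
  have hB := sub_pos.2 G.m_zero_lt
  rw [myopicCutoff, div_lt_one (by linarith)]
  linarith

lemma cutoff_pos {μ : ℝ} (hμ : 0 < μ) : 0 < G.cutoff μ := by
  have hA := sub_pos.2 G.lt_m_one
  have hB := sub_pos.2 G.m_zero_lt
  unfold cutoff
  positivity

lemma odds_cutoff {μ : ℝ} (hμ : 0 < μ) : G.odds (G.cutoff μ) = μ / (μ + 1) := by
  have hA := sub_pos.2 G.lt_m_one
  have hB := sub_pos.2 G.m_zero_lt
  have hD : 0 < (μ + 1) * (G.m 1 - G.s) + μ * (G.s - G.m 0) := by positivity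
  have e : 1 - μ * (G.s - G.m 0) / ((μ + 1) * (G.m 1 - G.s) + μ * (G.s - G.m 0)) =
      (μ + 1) * (G.m 1 - G.s) / ((μ + 1) * (G.m 1 - G.s) + μ * (G.s - G.m 0)) := by
    rw [eq_div_iff hD.ne', sub_mul, div_mul_cancel₀ _ hD.ne']
    ring
  rw [odds, cutoff, e]
  have h1 : (μ + 1) ≠ 0 := by positivity
  generalize (μ + 1) * (G.m 1 - G.s) + μ * (G.s - G.m 0) = D at *
  field_simp

lemma eq_of_rho (hρ : G.rho = 0) : G.α 0 = G.α 1 := by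
  have h := G.σ_pos
  rw [rho, div_eq_zero_iff] at hρ
  rcases hρ with h1 | h1
  · linarith [pow_eq_zero_iff (two_ne_zero) |>.1 h1]
  · exact absurd h1 (by positivity)

/-- With `rho` and `lam 0` zero, only the linear term and the discount rate are left in the equation
for the exponent. -/
lemma IsExponent.mul_eq {μ : ℝ} (hμ : G.IsExponent 1 μ) (hρ : G.rho = 0) (h0 : G.lam 0 = 0) :
    G.lam 1 * μ = G.r := by
  have h := hμ.2
  rw [hρ, h0] at h
  simp at h
  linarith

lemma odds_cutoff_eq {μ : ℝ} (hμ : G.IsExponent 1 μ) (hρ : G.rho = 0) (h0 : G.lam 0 = 0) :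
    G.odds (G.cutoff μ) = G.r / (G.r + G.lam 1) := by
  have hl := G.lam_one_pos (G.eq_of_rho hρ) h0
  have hμ0 := hμ.1
  rw [G.odds_cutoff hμ0, ← IsExponent.mul_eq G hμ hρ h0, div_eq_div_iff (by positivity)
    (by positivity)]
  ring

variable {N : ℕ} (rew : Bool → ℕ → ℕ → unitInterval) (i₀ : Bool)
  (hα : G.α 0 = G.α 1) (h0 : G.lam 0 = 0) {p : ℝ} (hp : 0 < p) (hp1 : p < 1)

include hα h0 hp hp1

lemma belief_lt_one_of_unseen {x : G.Info N Δ} (hx : G.seen rew i₀ x = false) :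
    G.belief p x < 1 := by
  have hq := pow_pos (G.failure_pos (Δ := Δ)) (G.track rew i₀ x).2.1
  have := mul_pos hp hq
  rw [G.belief_of_unseen hα h0 rew i₀ hx, div_lt_one (by linarith)]
  linarith

lemma odds_belief {x : G.Info N Δ} (hx : G.seen rew i₀ x = false) :
    G.odds (G.belief p x) = G.odds p * G.failure Δ ^ G.trials rew i₀ x := by
  have hA := sub_pos.2 G.lt_m_one
  have hB := sub_pos.2 G.m_zero_lt
  have hq := pow_pos (G.failure_pos (Δ := Δ)) (G.trials rew i₀ x)
  have hD : 0 < p * G.failure Δ ^ G.trials rew i₀ x + (1 - p) := by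
    have := mul_pos hp hq
    linarith
  rw [G.belief_of_unseen hα h0 rew i₀ hx]
  change G.odds (p * G.failure Δ ^ G.trials rew i₀ x /
    (p * G.failure Δ ^ G.trials rew i₀ x + (1 - p))) = _
  have h1 : (1 - p) ≠ 0 := by linarith
  have e : 1 - p * G.failure Δ ^ G.trials rew i₀ x /
      (p * G.failure Δ ^ G.trials rew i₀ x + (1 - p)) =
      (1 - p) / (p * G.failure Δ ^ G.trials rew i₀ x + (1 - p)) := by
    rw [eq_div_iff hD.ne', sub_mul, div_mul_cancel₀ _ hD.ne']
    ring
  rw [odds, odds, e]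
  generalize p * G.failure Δ ^ G.trials rew i₀ x + (1 - p) = D at *
  field_simp

end Odds

/-! ### The automaton as a strategy profile. -/

section Play

variable (A : Automaton) (i₀ : Bool)

/-- All players follow the automaton until the first lump-sum, and use the risky arm from then on. -/
noncomputable def play : Fin (M + 1) → G.Strategy (M + 1) Δ := fun _ =>
  G.ofTally A.rew i₀ fun τ => if τ.1 then 1 else A.mix τ.2.2 τ.2.1

lemma play_act_of_seen (n : Fin (M + 1)) {x : G.Info (M + 1) Δ}
    (hx : G.seen A.rew i₀ x = true) : ((G.play A i₀ n).act x) = 1 :=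
  if_pos hx

lemma play_act_of_unseen (n : Fin (M + 1)) {x : G.Info (M + 1) Δ}
    (hx : G.seen A.rew i₀ x = false) :
    (G.play A i₀ n).act x = A.mix (G.mode A.rew i₀ x) (G.trials A.rew i₀ x) :=
  if_neg (by rw [seen] at hx; simp [hx])

lemma measurable_tally_fun (rew : Bool → ℕ → ℕ → unitInterval) {N : ℕ} (F : Bool → ℕ → ℝ) :
    Measurable fun x : G.Info N Δ => F (G.mode rew i₀ x) (G.trials rew i₀ x) :=
  (measurable_of_countable (fun t : Bool × ℕ => F t.1 t.2)).comp
    ((G.measurable_mode rew i₀).prodMk (G.measurable_trials rew i₀))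

variable {p : ℝ} {Q : Fin 2 → ProbabilityMeasure (G.ArmPath Δ)}

/-- Cost of the current action and continuation cost against opponents who use the risky arm with
probability `π`. -/
lemma stage_add_integral (hp1 : p < 1) (rew : Bool → ℕ → ℕ → unitInterval)
    (S : Fin (M + 1) → G.Strategy (M + 1) Δ) (n : Fin (M + 1)) (x : G.Info (M + 1) Δ) {π : ℝ}
    (hπ : ∀ i, i ≠ n → ((S i).act x : ℝ) = π) {val : Bool → ℕ → ℝ}
    (hval : ∀ i j, 0 ≤ val i j ∧ val i j ≤ 1) :
    G.stage S n p rew i₀ x + G.discount Δ * ∫ y, (1 - p) * (G.s - G.m 0) *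
      val (G.mode rew i₀ y) (G.trials rew i₀ y) ∂(G.step (Q 0) S x) =
    (1 - p) * (G.s - G.m 0) * ((1 - ((S n).act x : ℝ)) * ((1 - G.discount Δ) *
        (G.odds p * G.failure Δ ^ G.trials rew i₀ x) + G.discount Δ * bexp M π fun k =>
          rew (G.mode rew i₀ x) (G.trials rew i₀ x) k * val true (G.trials rew i₀ x + k) +
          (1 - rew (G.mode rew i₀ x) (G.trials rew i₀ x) k) * val false (G.trials rew i₀ x + k)) +
      ((S n).act x : ℝ) * ((1 - G.discount Δ) + G.discount Δ * bexp M π fun k =>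
          rew (G.mode rew i₀ x) (G.trials rew i₀ x) (k + 1) *
            val true (G.trials rew i₀ x + (k + 1)) +
          (1 - rew (G.mode rew i₀ x) (G.trials rew i₀ x) (k + 1)) *
            val false (G.trials rew i₀ x + (k + 1)))) := by
  have hB := sub_pos.2 G.m_zero_lt
  have h1p := sub_pos.2 hp1
  have hX : (1 - p) * (G.s - G.m 0) * G.odds p = p * (G.m 1 - G.s) := by
    rw [odds, mul_div_cancel₀ _ (mul_pos h1p hB).ne']
  rw [integral_const_mul, G.integral_step_track rew i₀ S (F := val) (B := 1)
    (fun i j => abs_le.2 ⟨by linarith [(hval i j).1], (hval i j).2⟩) 0 x,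
    G.sum_weight_riskyCount S x n hπ fun k =>
      rew (G.mode rew i₀ x) (G.trials rew i₀ x) k * val true (G.trials rew i₀ x + k) +
        (1 - rew (G.mode rew i₀ x) (G.trials rew i₀ x) k) * val false (G.trials rew i₀ x + k)]
  unfold stage
  linear_combination (-(1 - ((S n).act x : ℝ)) * (1 - G.discount Δ) *
    G.failure Δ ^ G.trials rew i₀ x) * hX

variable (hα : G.α 0 = G.α 1) (h0 : G.lam 0 = 0) (hΔ : 0 < Δ) (hQ : ∀ θ, G.IsArmLaw Δ θ (Q θ))
  {val : Bool → ℕ → ℝ}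
  (hA : A.IsEquilibrium M (G.discount Δ) (G.failure Δ) (G.odds p) val)

/-- Cost under the automaton. -/
noncomputable def autoCost {N : ℕ} (p : ℝ) (rew : Bool → ℕ → ℕ → unitInterval)
    (val : Bool → ℕ → ℝ) (x : G.Info N Δ) : ℝ :=
  (1 - p) * (G.s - G.m 0) * val (G.mode rew i₀ x) (G.trials rew i₀ x)

lemma measurable_autoCost {N : ℕ} (p : ℝ) (rew : Bool → ℕ → ℕ → unitInterval)
    (val : Bool → ℕ → ℝ) : Measurable (G.autoCost (N := N) (Δ := Δ) i₀ p rew val) :=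
  (G.measurable_tally_fun i₀ rew val).const_mul _

lemma abs_autoCost_le {N : ℕ} (hp1 : p < 1) (rew : Bool → ℕ → ℕ → unitInterval)
    (hval : ∀ i j, 0 ≤ val i j ∧ val i j ≤ 1) (x : G.Info N Δ) :
    |G.autoCost i₀ p rew val x| ≤ (1 - p) * (G.s - G.m 0) := by
  have hB := mul_pos (sub_pos.2 hp1) (sub_pos.2 G.m_zero_lt)
  have h := hval (G.mode rew i₀ x) (G.trials rew i₀ x)
  rw [autoCost, abs_of_nonneg (mul_nonneg hB.le h.1)]
  exact mul_le_of_le_one_right hB.le h.2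

include hA in
-- Current plus continuation cost is affine in the deviator's probability, so the inequalities for
-- the two pure actions suffice. This holds for every `T`, because `T` enters only through its
-- action at `x`.
lemma autoCost_le (hp1 : p < 1) (n : Fin (M + 1)) (T : G.Strategy (M + 1) Δ)
    {x : G.Info (M + 1) Δ} (hx : G.seen A.rew i₀ x = false) :
    G.autoCost i₀ p A.rew val x ≤
      G.stage (Function.update (G.play A i₀) n T) n p A.rew i₀ x + G.discount Δ *
        ∫ y, G.autoCost i₀ p A.rew val y ∂(G.step (Q 0) (Function.update (G.play A i₀) n T) x) := by
  have hB := mul_pos (sub_pos.2 hp1) (sub_pos.2 G.m_zero_lt)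
  unfold autoCost
  rw [G.stage_add_integral i₀ hp1 A.rew _ n x (π := A.mix (G.mode A.rew i₀ x)
    (G.trials A.rew i₀ x)) (fun i hi => by
      rw [Function.update_of_ne hi, G.play_act_of_unseen A i₀ i hx]) hA.bdd]
  refine mul_le_mul_of_nonneg_left ?_ hB.le
  set t := ((Function.update (G.play A i₀) n T n).act x : ℝ)
  have ht0 : 0 ≤ t := unitInterval.nonneg _
  have ht1 : t ≤ 1 := unitInterval.le_one _
  have h1 := mul_le_mul_of_nonneg_left (hA.safe (G.mode A.rew i₀ x) (G.trials A.rew i₀ x))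
    (sub_nonneg.2 ht1)
  have h2 := mul_le_mul_of_nonneg_left (hA.risky (G.mode A.rew i₀ x) (G.trials A.rew i₀ x)) ht0
  unfold Automaton.safeCost Automaton.cont at h1
  unfold Automaton.riskyCost Automaton.cont at h2
  linarith

include hA in
lemma autoCost_eq (hp1 : p < 1) (n : Fin (M + 1))
    {x : G.Info (M + 1) Δ} (hx : G.seen A.rew i₀ x = false) :
    G.stage (G.play A i₀) n p A.rew i₀ x + G.discount Δ *
        ∫ y, G.autoCost i₀ p A.rew val y ∂(G.step (Q 0) (G.play A i₀) x) =
      G.autoCost i₀ p A.rew val x := by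
  unfold autoCost
  rw [G.stage_add_integral i₀ hp1 A.rew _ n x (π := A.mix (G.mode A.rew i₀ x)
    (G.trials A.rew i₀ x)) (fun i _ => by rw [G.play_act_of_unseen A i₀ i hx]) hA.bdd,
    G.play_act_of_unseen A i₀ n hx]
  congr 1
  exact hA.mixed (G.mode A.rew i₀ x) (G.trials A.rew i₀ x)

include hα h0 hΔ hQ hA in
lemma isSSE_play (hp : 0 < p) (hp1 : p < 1) : G.IsSSE Q p (G.play (M := M) (Δ := Δ) A i₀) :=
  ⟨G.isPBE_of_cost (G.play A i₀) p A.rew i₀ hα h0 hΔ hQ hp hp1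
    (fun n _ hx => G.play_act_of_seen A i₀ n hx) (G.measurable_autoCost i₀ p A.rew val)
    (G.abs_autoCost_le i₀ hp1 A.rew hA.bdd)
    (fun n _ hx => (G.autoCost_eq A i₀ hA hp1 n hx).le)
    (fun n T _ hx => G.autoCost_le A i₀ hA hp1 n T hx), fun _ _ _ => rfl⟩

end Play

end Bandit

/-! ### Play on the path, and payoff bounds. -/

namespace Bandit

variable (G : Bandit) {M : ℕ} {N : ℕ} {Δ : ℝ≥0}

lemma measurable_start : Measurable (G.start N Δ) :=
  (G.measurable_sigma_mk 0).comp (measurable_const.prodMk measurable_id)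

section PathLaw

variable {Q : Fin 2 → ProbabilityMeasure (G.ArmPath Δ)} {S : Fin N → G.Strategy N Δ}
  {T : Set (G.Info N Δ)}

lemma ahead_mem (hT : MeasurableSet T) (Q : ProbabilityMeasure (G.ArmPath Δ))
    (h : ∀ x ∈ T, ∀ᵐ y ∂(G.step Q S x), y ∈ T) (ℓ : ℕ) :
    ∀ x ∈ T, ∀ᵐ y ∂(G.ahead Q S ℓ x), y ∈ T := by
  induction ℓ with
  | zero =>
    intro x hx
    rw [ahead, Kernel.id_apply]
    exact (ae_dirac_iff hT).2 hx
  | succ ℓ ih =>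
    intro x hx
    rw [ahead]
    exact Kernel.ae_comp_of_ae_ae hT ((h x hx).mono ih)

/-- Sets that contain the initial information and are invariant in both states have full measure on
the path of play. -/
lemma pathLaw_mem (hT : MeasurableSet T) (h0 : ∀ u, G.start N Δ u ∈ T)
    (h : ∀ θ, ∀ x ∈ T, ∀ᵐ y ∂(G.step (Q θ) S x), y ∈ T) (p : ℝ) (ℓ : ℕ) :
    ∀ᵐ x ∂(G.pathLaw Q S p ℓ), x ∈ T := by
  have key : ∀ θ, ∀ᵐ x ∂(((volume : Measure unitInterval).map (G.start N Δ)).bind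
      (G.ahead (Q θ) S ℓ)), x ∈ T := fun θ => by
    refine Measure.ae_comp_of_ae_ae hT ?_
    have h1 : ∀ᵐ x ∂((volume : Measure unitInterval).map (G.start N Δ)), x ∈ T :=
      (ae_map_iff G.measurable_start.aemeasurable hT).2 (Eventually.of_forall h0)
    exact h1.mono (G.ahead_mem hT (Q θ) (h θ) ℓ)
  rw [pathLaw, ae_add_measure_iff]
  exact ⟨Measure.ae_smul_measure (key 1) _, Measure.ae_smul_measure (key 0) _⟩

end PathLaw

section AllRisky

/-- The strategy that always prescribes the risky arm. -/
def alwaysRisky (N : ℕ) (Δ : ℝ≥0) : G.Strategy N Δ := ⟨fun _ => 1, measurable_const⟩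

/-- If the good state is certain, using the risky arm forever is an equilibrium. -/
lemma isSSE_alwaysRisky (hα : G.α 0 = G.α 1) (h0 : G.lam 0 = 0) (hΔ : 0 < Δ)
    (Q : Fin 2 → ProbabilityMeasure (G.ArmPath Δ)) :
    G.IsSSE Q 1 fun _ : Fin N => G.alwaysRisky N Δ := by
  refine ⟨fun x n T => ?_, fun _ _ _ => rfl⟩
  have hb : G.belief 1 x = 1 := by
    have := (G.likelihood_track hα h0 (fun _ _ _ => 0) false x).1
    simp [belief, this.ne']
  rw [hb]
  simp only [contPayoff, sub_self, zero_mul, add_zero, one_mul]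
  rw [G.statePayoff_one_eq (fun _ : Fin N => G.alwaysRisky N Δ) n hΔ (T := Set.univ)
    (fun _ _ => Eventually.of_forall fun _ => trivial) (fun _ _ => rfl) trivial]
  exact G.statePayoff_one_le _ n hΔ x

end AllRisky

section OnPath

variable (A : Automaton) {Q : Fin 2 → ProbabilityMeasure (G.ArmPath Δ)}

lemma riskyCount_of_weight_pos {S : Fin N → G.Strategy N Δ} {x : G.Info N Δ}
    (hS : ∀ n, (S n).act x = 1) {a : Fin N → Bool} (ha : 0 < G.weight S x a) :
    riskyCount a = N := by
  have h : ∀ n, a n = true := by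
    intro n
    by_contra hn
    refine ha.ne' (Finset.prod_eq_zero (Finset.mem_univ n) ?_)
    rw [if_neg hn, hS n]
    simp
  simp [riskyCount, h]

/-- On the path of play, the automaton started in the experimentation mode prescribes the risky arm
whenever the odds ratio exceeds the threshold. -/
lemma play_onPath {X xlow : ℝ} (hX : 0 < X) (hα : G.α 0 = G.α 1) (h0 : G.lam 0 = 0) (hΔ : 0 < Δ)
    (hmix : ∀ j, xlow < X * G.failure Δ ^ j → A.mix true j = 1)
    (hrew : ∀ j, A.rew true j (M + 1) = 1) (p : ℝ) (ℓ : ℕ) :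
    ∀ᵐ x ∂(G.pathLaw Q (G.play (M := M) A true) p ℓ), G.seen A.rew true x = true ∨
      X * G.failure Δ ^ G.trials A.rew true x ≤ xlow ∨ G.mode A.rew true x = true := by
  have hq := G.failure_pos (Δ := Δ)
  have hq1 := (G.failure_lt_one hα h0 hΔ).le
  have hT : MeasurableSet {x : G.Info (M + 1) Δ | G.seen A.rew true x = true ∨
      X * G.failure Δ ^ G.trials A.rew true x ≤ xlow ∨ G.mode A.rew true x = true} :=
    (G.measurable_track A.rew true) (MeasurableSet.of_discrete
      (s := {τ : Tally | τ.1 = true ∨ X * G.failure Δ ^ τ.2.1 ≤ xlow ∨ τ.2.2 = true}))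
  refine G.pathLaw_mem hT (fun u => Or.inr (Or.inr rfl)) (fun θ x hx => ?_) p ℓ
  refine G.ae_step (Q θ) _ hT fun a ha => ?_
  rcases hs : G.seen A.rew true x with _ | _
  -- Without a lump-sum the odds never rise, so once at or below `xlow` they stay there. Above
  -- `xlow` in the normal mode everybody experiments, which gives the count `M + 1` that keeps the
  -- mode.
  · rcases le_or_gt (X * G.failure Δ ^ G.trials A.rew true x) xlow with h1 | h1
    · refine Eventually.of_forall fun z => Or.inr (Or.inl ?_)
      rw [trials_next, pow_add, ← mul_assoc]
      exact (mul_le_of_le_one_right (mul_pos hX (pow_pos hq _)).le (pow_le_one₀ hq.le hq1)).trans h1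
    · have hm : G.mode A.rew true x = true := by
        rcases hx with h | h | h
        · rw [hs] at h
          exact absurd h (by simp)
        · exact absurd h (not_le.2 h1)
        · exact h
      have hact : ∀ n, (G.play (M := M) A true n).act x = 1 := fun n => by
        rw [G.play_act_of_unseen A true n hs, hm, hmix _ h1]
      have hk := G.riskyCount_of_weight_pos hact ha
      filter_upwards [G.outcome_usage (Q θ) a] with z hz
      refine Or.inr (Or.inr ?_)
      rw [mode_next, hz, hk, hm, hrew]
      exact decide_eq_true (unitInterval.le_one z.2)
  · exact Eventually.of_forall fun z => Or.inl (G.seen_next_of_seen A.rew true hs z)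

end OnPath

section Punishment

variable {Q : Fin 2 → ProbabilityMeasure (G.ArmPath Δ)} {p : ℝ}

lemma contPayoff_start (S : Fin N → G.Strategy N Δ) (n : Fin N)
    (rew : Bool → ℕ → ℕ → unitInterval) (i₀ : Bool) (u : unitInterval) :
    G.contPayoff Q S n p (G.start N Δ u) =
      p * G.m 1 + (1 - p) * G.s - G.cost S n p rew i₀ Q (G.start N Δ u) := by
  have h : G.trials rew i₀ (G.start N Δ u) = 0 := rfl
  rw [cost, h, contPayoff]
  ring

lemma abs_contPayoff_le (hΔ : 0 < Δ) (S : Fin N → G.Strategy N Δ) (n : Fin N) (x : G.Info N Δ) :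
    |G.contPayoff Q S n p x| ≤ |p| * (|G.s| + |G.m 1|) + |1 - p| * (|G.s| + |G.m 0|) := by
  refine (abs_add_le _ _).trans ?_
  rw [abs_mul, abs_mul]
  exact add_le_add (mul_le_mul_of_nonneg_left (G.abs_statePayoff_le Q S n hΔ 1 x) (abs_nonneg _))
    (mul_le_mul_of_nonneg_left (G.abs_statePayoff_le Q S n hΔ 0 x) (abs_nonneg _))

lemma integrable_contPayoff_start (hΔ : 0 < Δ) (S : Fin N → G.Strategy N Δ) (n : Fin N) :
    Integrable (fun u : unitInterval => G.contPayoff Q S n p (G.start N Δ u)) := by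
  have hm : Measurable (G.contPayoff Q S n p) :=
    ((G.measurable_statePayoff Q S n hΔ 1).const_mul _).add
      ((G.measurable_statePayoff Q S n hΔ 0).const_mul _)
  exact Integrable.of_bound (hm.comp G.measurable_start).aestronglyMeasurable _
    (Eventually.of_forall fun u => G.abs_contPayoff_le hΔ S n _)

lemma payoff_le_bestReplyPayoff (hΔ : 0 < Δ) (S : Fin N → G.Strategy N Δ) (n : Fin N)
    (T : G.Strategy N Δ) :
    G.payoff Q (Function.update S n T) n p ≤ G.bestReplyPayoff Q S n p := by
  refine le_ciSup (f := fun T => G.payoff Q (Function.update S n T) n p)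
    ⟨|p| * (|G.s| + |G.m 1|) + |1 - p| * (|G.s| + |G.m 0|), ?_⟩ T
  rintro _ ⟨T, rfl⟩
  refine (le_abs_self _).trans ?_
  have := norm_integral_le_of_norm_le_const (μ := (volume : Measure unitInterval))
    (f := fun u => G.contPayoff Q (Function.update S n T) n p (G.start N Δ u)) (Eventually.of_forall fun u =>
      G.abs_contPayoff_le (Q := Q) (p := p) hΔ (Function.update S n T) n (G.start N Δ u))
  simpa [payoff] using this

lemma payoff_le {S : Fin N → G.Strategy N Δ} {n : Fin N} (hΔ : 0 < Δ) {c : ℝ}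
    (h : ∀ u, G.contPayoff Q S n p (G.start N Δ u) ≤ c) : G.payoff Q S n p ≤ c := by
  have := integral_mono (G.integrable_contPayoff_start (Q := Q) (p := p) hΔ S n)
    (integrable_const c) h
  simpa [payoff] using this

lemma le_payoff {S : Fin N → G.Strategy N Δ} {n : Fin N} (hΔ : 0 < Δ) {c : ℝ}
    (h : ∀ u, c ≤ G.contPayoff Q S n p (G.start N Δ u)) : c ≤ G.payoff Q S n p := by
  have := integral_mono (integrable_const c)
    (G.integrable_contPayoff_start (Q := Q) (p := p) hΔ S n) h
  simpa [payoff] using this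

variable (A : Automaton) (hα : G.α 0 = G.α 1) (h0 : G.lam 0 = 0) (hΔ : 0 < Δ)
  (hQ : ∀ θ, G.IsArmLaw Δ θ (Q θ)) {val : Bool → ℕ → ℝ}
  (hA : A.IsEquilibrium M (G.discount Δ) (G.failure Δ) (G.odds p) val)
  (hp : 0 < p) (hp1 : p < 1)

include hα h0 hΔ hQ hA hp hp1

lemma payoff_play_le (i₀ : Bool) (n : Fin (M + 1)) :
    G.payoff Q (G.play A i₀) n p ≤
      p * G.m 1 + (1 - p) * G.s - (1 - p) * (G.s - G.m 0) * val i₀ 0 := by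
  refine G.payoff_le hΔ fun u => ?_
  rw [G.contPayoff_start (G.play A i₀) n A.rew i₀ u]
  have h := G.le_cost (G.play A i₀) n p A.rew i₀ hα h0 hΔ hQ hp.le
    (G.measurable_autoCost i₀ p A.rew val) (G.abs_autoCost_le i₀ hp1 A.rew hA.bdd)
    (fun x hx => (G.autoCost_eq A i₀ hA hp1 n hx).ge) (x := G.start (M + 1) Δ u) rfl
  have e : G.autoCost i₀ p A.rew val (G.start (M + 1) Δ u) =
      (1 - p) * (G.s - G.m 0) * val i₀ 0 := rfl
  linarith

/-- A lower bound for the best-reply payoff against opponents who use the risky arm if and only if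
the summary of the history lies in `B`. -/
lemma le_bestReplyPayoff {xlow : ℝ} {B : ℕ → Prop} [DecidablePred B]
    (hval : ∀ j, (if xlow < G.odds p * G.failure Δ ^ j then 1 - G.discount Δ
        else (1 - G.discount Δ) * (G.odds p * G.failure Δ ^ j)) +
      G.discount Δ * val false (j + ((if B j then M else 0) +
        if xlow < G.odds p * G.failure Δ ^ j then 1 else 0)) ≤ val false j)
    {R : Fin (M + 1) → G.Strategy (M + 1) Δ}
    (hR : ∀ n x, G.seen A.rew false x = false →
      (R n).act x = if B (G.trials A.rew false x) then 1 else 0) (n : Fin (M + 1)) :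
    p * G.m 1 + (1 - p) * G.s - (1 - p) * (G.s - G.m 0) * val false 0 ≤
      G.bestReplyPayoff Q R n p := by
  have hB := mul_pos (sub_pos.2 hp1) (sub_pos.2 G.m_zero_lt)
  -- The reply whose cost `VP` dominates: risky after a lump-sum and at odds above `xlow`, safe
  -- otherwise.
  set T : G.Strategy (M + 1) Δ := G.ofTally A.rew false fun τ =>
    if τ.1 = true ∨ xlow < G.odds p * G.failure Δ ^ τ.2.1 then 1 else 0 with hT
  refine le_trans (G.le_payoff hΔ fun u => ?_) (G.payoff_le_bestReplyPayoff hΔ R n T)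
  rw [G.contPayoff_start (Function.update R n T) n A.rew false u]
  -- The opponents ignore the mode, so the punishment value is used in both modes; `A.rew` serves
  -- only to define the summary.
  have hb : ∀ i j, 0 ≤ (fun (_ : Bool) j => val false j) i j ∧
      (fun (_ : Bool) j => val false j) i j ≤ 1 := fun _ j => hA.bdd false j
  have h := G.cost_le (Function.update R n T) n p A.rew false hα h0 hΔ hQ hp.le
    (fun x hx => by
      rw [Function.update_self]
      exact if_pos (Or.inl hx))
    (G.measurable_autoCost false p A.rew fun _ j => val false j)
    (G.abs_autoCost_le false hp1 A.rew hb)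
    (fun x hx => by
      have hTx : (Function.update R n T n).act x =
          if xlow < G.odds p * G.failure Δ ^ G.trials A.rew false x then 1 else 0 := by
        rw [Function.update_self]
        have hx' : (G.track A.rew false x).1 = false := hx
        change (if (G.track A.rew false x).1 = true ∨
          xlow < G.odds p * G.failure Δ ^ (G.track A.rew false x).2.1 then (1 : unitInterval)
          else 0) = _
        by_cases c : xlow < G.odds p * G.failure Δ ^ (G.track A.rew false x).2.1 <;>
          simp [hx', trials, c]
      unfold autoCost
      rw [G.stage_add_integral false hp1 A.rew _ n x
        (π := if B (G.trials A.rew false x) then 1 else 0) (fun i hi => by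
          rw [Function.update_of_ne hi, hR i x hx]
          split_ifs <;> simp) hb, hTx]
      refine mul_le_mul_of_nonneg_left ?_ hB.le
      have hv := hval (G.trials A.rew false x)
      by_cases c1 : B (G.trials A.rew false x) <;>
      by_cases c2 : xlow < G.odds p * G.failure Δ ^ G.trials A.rew false x <;>
      simp only [c1, c2, if_true, if_false, bexp_one, bexp_zero, Set.Icc.coe_one,
        Set.Icc.coe_zero, add_zero, zero_add] at hv ⊢ <;>
      linarith)
    (x := G.start (M + 1) Δ u) rfl
  have e : G.autoCost false p A.rew (fun _ j => val false j) (G.start (M + 1) Δ u) =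
      (1 - p) * (G.s - G.m 0) * val false 0 := rfl
  linarith

end Punishment

end Bandit

/-! ### Proof of the theorem. -/

theorem proposition8 (G : Bandit) (hρ : G.rho = 0) (h0 : G.lam 0 = 0) (N : ℕ) (hN : 2 ≤ N)
    (μ₁ : ℝ) (hμ₁ : G.IsExponent 1 μ₁) (plow phigh : ℝ) (h1 : G.cutoff μ₁ < plow)
    (h2 : plow < G.myopicCutoff) (h3 : G.myopicCutoff < phigh) (h4 : phigh < 1) :
    ∃ Δbar : ℝ≥0, 0 < Δbar ∧ ∀ Δ : ℝ≥0, 0 < Δ → Δ < Δbar →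
      ∀ Q : Fin 2 → ProbabilityMeasure (G.ArmPath Δ), (∀ θ, G.IsArmLaw Δ θ (Q θ)) →
        (∀ p : ℝ, plow < p → p ≤ 1 →
          ∃ S : Fin N → G.Strategy N Δ, G.IsSSE Q p S ∧
            (∀ ℓ : ℕ, ∀ᵐ x ∂(G.pathLaw Q S p ℓ),
              plow < G.belief p x → ∀ n, (S n).act x = 1) ∧
            (∀ x, G.belief p x < G.cutoff μ₁ → ∀ n, (S n).act x = 0)) ∧
        (∀ p : ℝ, plow ≤ p → p ≤ phigh →
          ∃ S : Fin N → G.Strategy N Δ, G.IsSSE Q p S ∧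
            ∃ R : Fin N → G.Strategy N Δ,
              (∀ n x,
                (G.belief p x ∈ Set.Icc (G.cutoff μ₁) plow ∪ Set.Icc phigh 1 → (R n).act x = 1) ∧
                (G.belief p x ∉ Set.Icc (G.cutoff μ₁) plow ∪ Set.Icc phigh 1 → (R n).act x = 0)) ∧
              ∀ n, G.payoff Q S n p ≤ G.bestReplyPayoff Q R n p) := by
  obtain ⟨M, rfl⟩ : ∃ M, N = M + 1 := ⟨N - 1, by omega⟩
  have hα := G.eq_of_rho hρ
  have hl := G.lam_one_pos hα h0
  have hμ := hμ₁.1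
  have hc0 := G.cutoff_pos hμ
  have hm1 := G.myopicCutoff_lt_one
  have hp1' : plow < 1 := h2.trans hm1
  have hc1 : G.cutoff μ₁ < 1 := h1.trans hp1'
  have hcut := G.odds_cutoff_eq hμ₁ hρ h0
  have hlow : G.r / (G.r + G.lam 1) < G.odds plow := by
    rw [← hcut, G.odds_lt_odds hc1 hp1']
    exact h1
  have hlow1 : G.odds plow ≤ 1 := by
    rw [← G.odds_myopicCutoff, G.odds_le_odds hp1' hm1]
    exact h2.le
  have hlh : G.odds plow < G.odds phigh := (G.odds_lt_odds hp1' h4).2 (h2.trans h3)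
  obtain ⟨Δb, hΔb, hmain⟩ := exists_automaton G.r_pos hl (M := M) (by omega) hlow hlow1 hlh
  refine ⟨Δb.toNNReal, Real.toNNReal_pos.2 hΔb, fun Δ hΔ hΔlt Q hQ => ⟨fun p hp hp1 => ?_,
    fun p hp hpH => ?_⟩⟩
  · have hp0 : 0 < p := hc0.trans (h1.trans hp)
    rcases hp1.eq_or_lt with rfl | hp1
    -- At prior `1` the odds would have denominator zero; there the belief is always `1`, and
    -- constant use of the risky arm is an equilibrium.
    · refine ⟨fun _ => G.alwaysRisky (M + 1) Δ, G.isSSE_alwaysRisky hα h0 hΔ Q,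
        fun ℓ => Eventually.of_forall fun _ _ _ => rfl, fun x hx => ?_⟩
      have hL := (G.likelihood_track hα h0 (fun _ _ _ => 0) false x).1
      have hb : G.belief 1 x = 1 := by simp [Bandit.belief, hL.ne']
      exact absurd (hb ▸ hx) (not_lt.2 hc1.le)
    obtain ⟨A, val, hA, hsafe, hmix, hrew, -⟩ := hmain Δ (NNReal.coe_pos.2 hΔ)
      (Real.lt_toNNReal_iff_coe_lt.1 hΔlt) (G.odds p) (G.odds_pos hp0 hp1)
    refine ⟨G.play A true, G.isSSE_play A true hα h0 hΔ hQ hA hp0 hp1, fun ℓ => ?_,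
      fun x hx n => ?_⟩
    · filter_upwards [G.play_onPath (M := M) A (Q := Q) (G.odds_pos hp0 hp1) hα h0 hΔ hmix hrew p ℓ]
        with x hx hbx n
      rcases hs : G.seen A.rew true x with _ | _
      · have hb1 := G.belief_lt_one_of_unseen A.rew true hα h0 hp0 hp1 hs
        have hlt : G.odds plow < G.odds p * G.failure Δ ^ G.trials A.rew true x := by
          rw [← G.odds_belief A.rew true hα h0 hp0 hp1 hs, G.odds_lt_odds hp1' hb1]
          exact hbx
        have hm : G.mode A.rew true x = true := by
          rcases hx with h | h | h
          · rw [hs] at h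
            exact absurd h (by simp)
          · exact absurd h (not_le.2 hlt)
          · exact h
        rw [G.play_act_of_unseen A true n hs, hm]
        exact hmix _ hlt
      · exact G.play_act_of_seen A true n hs
    · rcases hs : G.seen A.rew true x with _ | _
      · have hb1 := G.belief_lt_one_of_unseen A.rew true hα h0 hp0 hp1 hs
        rw [G.play_act_of_unseen A true n hs]
        refine hsafe _ _ ?_
        rw [← hcut]
        change G.odds p * G.failure Δ ^ G.trials A.rew true x < _
        rw [← G.odds_belief A.rew true hα h0 hp0 hp1 hs, G.odds_lt_odds hb1 hc1]
        exact hx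
      · rw [G.belief_of_seen hα h0 A.rew true hp0 hs] at hx
        exact absurd hx (not_lt.2 hc1.le)
  · have hp0 : 0 < p := hc0.trans (h1.trans_le hp)
    have hp1 : p < 1 := hpH.trans_lt h4
    obtain ⟨A, val, hA, -, -, -, hval⟩ := hmain Δ (NNReal.coe_pos.2 hΔ)
      (Real.lt_toNNReal_iff_coe_lt.1 hΔlt) (G.odds p) (G.odds_pos hp0 hp1)
    set B : ℕ → Prop := fun j => G.r / (G.r + G.lam 1) ≤ G.odds p * G.failure Δ ^ j ∧
      G.odds p * G.failure Δ ^ j ≤ G.odds plow ∨ G.odds phigh ≤ G.odds p * G.failure Δ ^ j with hB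
    let _ : DecidablePred B := fun j => instDecidableOr
    set R : Fin (M + 1) → G.Strategy (M + 1) Δ := fun _ => G.ofTally A.rew false fun τ =>
      if τ.1 = true ∨ B τ.2.1 then 1 else 0 with hR
    have hRx : ∀ n x, (R n).act x =
        if G.seen A.rew false x = true ∨ B (G.trials A.rew false x) then 1 else 0 :=
      fun _ _ => rfl
    -- Before a lump-sum, monotonicity of the odds translates the belief intervals into `B`;
    -- afterwards the belief is `1`, which lies in the upper interval.
    have hiff : ∀ x : G.Info (M + 1) Δ,
        (G.seen A.rew false x = true ∨ B (G.trials A.rew false x)) ↔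
        G.belief p x ∈ Set.Icc (G.cutoff μ₁) plow ∪ Set.Icc phigh 1 := by
      intro x
      rcases hs : G.seen A.rew false x with _ | _
      · have hb1 := G.belief_lt_one_of_unseen A.rew false hα h0 hp0 hp1 hs
        simp only [hB, ← G.odds_belief A.rew false hα h0 hp0 hp1 hs, ← hcut,
          G.odds_le_odds hc1 hb1, G.odds_le_odds hb1 hp1', G.odds_le_odds h4 hb1, Set.mem_union,
          Set.mem_Icc, hb1.le, and_true, Bool.false_eq_true, false_or]
      · rw [G.belief_of_seen hα h0 A.rew false hp0 hs]
        simp [h4.le]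
    refine ⟨G.play A false, G.isSSE_play A false hα h0 hΔ hQ hA hp0 hp1, R, fun n x => ⟨fun hx => ?_,
      fun hx => ?_⟩, fun n => ?_⟩
    · rw [hRx n x, if_pos ((hiff x).2 hx)]
    · rw [hRx n x, if_neg fun h => hx ((hiff x).1 h)]
    -- The two payoffs are compared through the same number, full information less the scaled
    -- punishment cost `val false 0`.
    · refine (G.payoff_play_le A hα h0 hΔ hQ hA hp0 hp1 false n).trans
        (G.le_bestReplyPayoff A hα h0 hΔ hQ hA hp0 hp1 (xlow := G.odds plow) (B := B) ?_ ?_ n)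
      · intro j
        exact hval ((G.odds_le_odds hp1 h4).2 hpH) j
      · intro n x hx
        rw [hRx n x, hx]
        simp
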